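/- Let $\mathcal A$ be a finite nonempty alphabet and $\sigma_{n}(x)_{i}=x_{i+n}$ the shift on $\mathcal A^{\mathbb Z^d}$. A (digit) substitution $\theta\colon\mathcal A\to\mathcal A^{\mathcal D}$ consists of an expansive integer matrix $Q$ (all eigenvalues of modulus $>1$), a finite set $\mathcal D\subset\mathbb Z^d$ of representatives of $\mathbb Z^d/Q\mathbb Z^d$, and a pattern $\theta(a)\in\mathcal A^{\mathcal D}$ for every letter $a$; it is iterated by $\theta^{n+1}(a)_{Qj+i}=\theta(\theta^{n}(a)_{j})_{i}$. Its language consists of the subpatterns (up to translation) of the patterns $\theta^k(a)$, $k\ge 1$, and $\mathbb X_\theta$ is the set of configurations all of whose finite subpatterns are in the language; $\theta$ generates a subshift if its language is extensible (each of its patterns with support $B$ extends, for every finite $U\supseteq B$, to one with support $U$). The substitution is primitive if for some $k$ every $\theta^k(a)$ contains every letter, it is aperiodic if no point of $\mathbb X_\theta$ has a nonzero period, and it is a block substitution if $Q$ is diagonal and $\mathcal D$ is a product of integer intervals. The height lattice of $\theta$ is the smallest (with respect to inclusion) lattice $\Gamma\le\mathbb Z^d$ that contains the return module, i.e. the group generated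 by all $j$ with $x_{j+k}=x_k$ for some $k$ and some $x\in\mathbb X_\theta$, and satisfies $\Gamma+Q\mathbb Z^d=\mathbb Z^d$; it is trivial if it equals $\mathbb Z^d$. An automorphism of a subshift is a self-homeomorphism commuting with all shifts. The MEF of a minimal system is its maximal equicontinuous factor, a rotation on a compact Abelian group. Let $\theta$ be an aperiodic primitive block substitution with inflation matrix $Q$ and height lattice $\Gamma=H\mathbb Z^d$, $H$ an integer matrix. Let $\mathcal D_\Gamma\subset\mathbb Z^d$ be a set of representatives of $\mathbb Z^d/\Gamma$, and for $m\in\mathbb Z^d$ let $(m)_\Gamma\in\mathcal D_\Gamma$ be the representative of $m$. Then there is a subshift $\mathbb Y_0$ over a finite alphabet, in dimension $d$, with the following properties. 1. The MEF of $\mathbb Y_0$ is a rotation on a torsion-free group. 2. There is a homeomorphism $\psi\colon\mathbb X_\theta\to\mathbb Y_0\times\mathcal D_\Gamma$ with $\psi\circ\sigma_m=T_m\circ\psi$ for all $m\in\mathbb Z^d$, where $$T_m(y,j)=\bigl(\sigma_{q}(y),\,(j+m)_\Gamma\bigr),\qquad q=H^{-1}\bigl(j+m-(j+m)_\Gamma\bigr).$$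 3. If the matrix $Q'=H^{-1}QH$ has integer entries, then $\mathbb Y_0=\mathbb X_\vartheta$ for a primitive aperiodic substitution $\vartheta$ with inflation matrix $Q'$ that generates a subshift and has trivial height lattice ($\vartheta$ need not be a block substitution). 4. For every automorphism $\Phi$ of $\mathbb X_\theta$ there are an automorphism $\Phi'$ of $\mathbb Y_0$ and $i\in\mathcal D_\Gamma$ such that, for all $(y,j)\in\mathbb Y_0\times\mathcal D_\Gamma$, $$\psi\circ\Phi\circ\psi^{-1}(y,j)=\bigl(\sigma_{q}(\Phi'(y)),\,(j+i)_\Gamma\bigr),\qquad q=H^{-1}\bigl(j+i-(j+i)_\Gamma\bigr).$$ -/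

import Mathlib

/-! ### Subshifts over `ℤ^d` -/

/-- The shift map `σ_n` on `A^(ℤ^d)`: `(σ_n x)_i = x_(i+n)`. -/
def shiftMap {d : ℕ} {A : Type*} (n : Fin d → ℤ) (x : (Fin d → ℤ) → A) : (Fin d → ℤ) → A :=
  fun i => x (i + n)

/-- A subshift: a closed shift-invariant subset of the full shift (product topology). -/
structure Subshift (d : ℕ) (A : Type*) [TopologicalSpace A] where
  carrier : Set ((Fin d → ℤ) → A)
  isClosed_carrier : IsClosed carrier
  shift_mem : ∀ (n : Fin d → ℤ) (x : (Fin d → ℤ) → A), x ∈ carrier → shiftMap n x ∈ carrier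

instance {d : ℕ} {A : Type*} [TopologicalSpace A] : CoeSort (Subshift d A) (Type _) :=
  ⟨fun X => X.carrier⟩

namespace Subshift

variable {d : ℕ} {A : Type*} [TopologicalSpace A]

/-- The shift action of `ℤ^d` on a subshift. -/
def act (X : Subshift d A) (n : Fin d → ℤ) (x : X) : X :=
  ⟨shiftMap n x.1, X.shift_mem n x.1 x.2⟩

/-- No point of the subshift has a nonzero period. -/
def IsAperiodic (X : Subshift d A) : Prop :=
  ∀ (x : X) (n : Fin d → ℤ), X.act n x = x → n = 0

/-- Automorphisms (symmetries): self-homeomorphisms that commute with all shifts. -/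
def IsAutomorphism (X : Subshift d A) (Φ : X ≃ₜ X) : Prop :=
  ∀ (n : Fin d → ℤ) (x : X), Φ (X.act n x) = X.act n (Φ x)

/-- The set of return times: all `j` with `x_(j+k) = x_k` for some `k`. For a minimal subshift the
same set is obtained from each single point `x`. -/
def returnTimes (X : Subshift d A) : Set (Fin d → ℤ) :=
  {j | ∃ (x : X) (k : Fin d → ℤ), x.1 (j + k) = x.1 k}

/-- The return module: the subgroup of `ℤ^d` generated by the return times. -/
def returnModule (X : Subshift d A) : AddSubgroup (Fin d → ℤ) :=
  AddSubgroup.closure X.returnTimes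

end Subshift

/-! ### Digit substitutions -/

/-- The lattice `M ℤ^d`. -/
def columnLattice {d : ℕ} (M : Matrix (Fin d) (Fin d) ℤ) : AddSubgroup (Fin d → ℤ) :=
  M.mulVecLin.range.toAddSubgroup

/-- A digit substitution `θ : A → A^𝒟` with expansive inflation matrix `Q` and complete digit set
`𝒟`, a set of representatives of `ℤ^d / Q ℤ^d`. -/
structure DigitSubstitution (d : ℕ) (A : Type*) where
  Q : Matrix (Fin d) (Fin d) ℤ
  expansive : ∀ z ∈ spectrum ℂ (Q.map (Int.cast : ℤ → ℂ)), 1 < ‖z‖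
  digits : Finset (Fin d → ℤ)
  complete : ∀ n : Fin d → ℤ, ∃! i, i ∈ digits ∧ n - i ∈ columnLattice Q
  rule : A → digits → A

namespace DigitSubstitution

variable {d : ℕ} {A : Type*}

/-- The `n`-supertile `θ^n(a)`, a pattern with support `𝒟^(n)`, given as the set of all pairs
`(j, θ^n(a)_j)`. -/
def supertile (θ : DigitSubstitution d A) : ℕ → A → Set ((Fin d → ℤ) × A)
  | 0, a => {(0, a)}
  | n + 1, a => {p | ∃ q ∈ supertile θ n a, ∃ i : θ.digits,
      p = (θ.Q.mulVec q.1 + (i : Fin d → ℤ), θ.rule q.2 i)}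

/-- For some `k`, every `θ^k(a)` contains every letter. -/
def IsPrimitive (θ : DigitSubstitution d A) : Prop :=
  ∃ k : ℕ, ∀ a b : A, ∃ j : Fin d → ℤ, (j, b) ∈ θ.supertile k a

/-- A block substitution: rectangular digit set and diagonal inflation matrix. The side lengths
of the rectangle are then the absolute values of the diagonal entries, by completeness. -/
def IsBlock (θ : DigitSubstitution d A) : Prop :=
  (∃ ℓ : Fin d → ℤ, θ.Q = Matrix.diagonal ℓ) ∧ ∃ a b : Fin d → ℤ, θ.digits = Finset.Icc a b

/-- The pattern `P|_B` belongs to the language of `θ`: up to translation it is a subpattern of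
some supertile `θ^k(a)` with `k ≥ 1`. Only the values of `P` on `B` matter. -/
def IsLegal (θ : DigitSubstitution d A) (B : Finset (Fin d → ℤ)) (P : (Fin d → ℤ) → A) : Prop :=
  ∃ (a : A) (k : ℕ) (t : Fin d → ℤ), 1 ≤ k ∧ ∀ b ∈ B, (b + t, P b) ∈ θ.supertile k a

/-- The language of `θ` is extensible, so that it is the language of a subshift. -/
def IsExtensible (θ : DigitSubstitution d A) : Prop :=
  ∀ (B U : Finset (Fin d → ℤ)), B ⊆ U → ∀ P : (Fin d → ℤ) → A, θ.IsLegal B P →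
    ∃ P' : (Fin d → ℤ) → A, (∀ b ∈ B, P' b = P b) ∧ θ.IsLegal U P'

/-- The shift space `𝕏_θ`: all configurations whose finite subpatterns are legal. -/
def shiftSpace [TopologicalSpace A] [DiscreteTopology A] (θ : DigitSubstitution d A) :
    Subshift d A where
  carrier := {x | ∀ B : Finset (Fin d → ℤ), θ.IsLegal B x}
  isClosed_carrier := by
    rw [Set.ofPred_forall]
    refine isClosed_iInter fun B => ?_
    rw [← isOpen_compl_iff, isOpen_iff_forall_mem_open]
    intro x hx
    refine ⟨{y | ∀ b ∈ B, y b = x b}, ?_, ?_, fun _ _ => rfl⟩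
    · rintro y hy ⟨a, k, t, hk, h⟩
      exact hx ⟨a, k, t, hk, fun b hb => (hy b hb) ▸ h b hb⟩
    · have : {y : (Fin d → ℤ) → A | ∀ b ∈ B, y b = x b} = ⋂ b ∈ B, (fun y => y b) ⁻¹' {x b} := by
        ext y; simp
      rw [this]
      exact isOpen_biInter_finset fun b _ =>
        (isOpen_discrete ({x b} : Set A)).preimage (continuous_apply b)
  shift_mem := by
    intro n x hx B
    obtain ⟨a, k, t, hk, h⟩ := hx (B.image (· + n))
    refine ⟨a, k, n + t, hk, fun b hb => ?_⟩
    have := h (b + n) (Finset.mem_image_of_mem _ hb)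
    rwa [add_assoc] at this

/-- `Γ` is the height lattice of `𝕏_θ`: the smallest lattice that contains the return module
and is coprime with the supertile lattice, i.e. `Γ + Q ℤ^d = ℤ^d`. -/
def IsHeightLattice [TopologicalSpace A] [DiscreteTopology A] (θ : DigitSubstitution d A)
    (Γ : AddSubgroup (Fin d → ℤ)) : Prop :=
  IsLeast {Λ : AddSubgroup (Fin d → ℤ) |
    θ.shiftSpace.returnModule ≤ Λ ∧ Λ ⊔ columnLattice θ.Q = ⊤} Γ

end DigitSubstitution

/-! ### Maximal equicontinuous factors -/

/-- `p : Y → Z` is a factor map from `(Y, T)` onto an equicontinuous system `(Z, S)`. If `T` is an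
action by homeomorphisms, then so is `S`, because `p` is onto. -/
structure IsEquicontinuousFactor {G Y Z : Type*} [TopologicalSpace Y] [UniformSpace Z]
    (T : G → Y → Y) (S : G → Z → Z) (p : Y → Z) : Prop where
  continuous : Continuous p
  surjective : Function.Surjective p
  equivariant : ∀ (g : G) (y : Y), p (T g y) = S g (p y)
  equicontinuous : Equicontinuous S

/-- `π : Y → Z` is the maximal equicontinuous factor of `(Y, T)`: every equicontinuous factor of
`(Y, T)` on a compact Hausdorff space factors through `π`. -/
def IsMaximalEquicontinuousFactor {G : Type*} {Y Z : Type} [TopologicalSpace Y] [UniformSpace Z]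
    (T : G → Y → Y) (S : G → Z → Z) (π : Y → Z) : Prop :=
  IsEquicontinuousFactor T S π ∧
    ∀ (W : Type) [UniformSpace W] [CompactSpace W] [T2Space W] (R : G → W → W) (p : Y → W),
      IsEquicontinuousFactor T R p → ∃ g : Z → W, Continuous g ∧ p = g ∘ π

/-- The maximal equicontinuous factor of `(Y, T)` is a rotation on a compact Hausdorff Abelian
group without torsion. -/
def HasTorsionFreeMEF {G : Type*} [AddGroup G] {Y : Type} [TopologicalSpace Y]
    (T : G → Y → Y) : Prop :=
  ∃ (K : Type) (_ : AddCommGroup K) (_ : UniformSpace K) (_ : IsUniformAddGroup K)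
    (_ : CompactSpace K) (_ : T2Space K) (α : G →+ K) (π : Y → K),
    IsMaximalEquicontinuousFactor T (fun g z => α g + z) π ∧ IsAddTorsionFree K

/-! ### Suspensions -/

/-- `F` contains exactly one representative of every class of `ℤ^d / Γ`. -/
def IsFundamentalDomain {d : ℕ} (Γ : AddSubgroup (Fin d → ℤ)) (F : Set (Fin d → ℤ)) : Prop :=
  ∀ m : Fin d → ℤ, ∃! j, j ∈ F ∧ m - j ∈ Γ

/-- `(m)_Γ`, the representative of `m` in the fundamental domain. -/
noncomputable def IsFundamentalDomain.rep {d : ℕ} {Γ : AddSubgroup (Fin d → ℤ)}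
    {F : Set (Fin d → ℤ)} (hF : IsFundamentalDomain Γ F) (m : Fin d → ℤ) : F :=
  ⟨(hF m).choose, (hF m).choose_spec.1.1⟩

/-- `H⁻¹ v` for `v ∈ H ℤ^d`, where `H` is nonsingular. -/
noncomputable def latticeCoord {d : ℕ} (H : Matrix (Fin d) (Fin d) ℤ) (v : Fin d → ℤ) :
    Fin d → ℤ :=
  Function.invFun (fun q : Fin d → ℤ => H.mulVec q) v

/-- The skew action `T_m (y, j) = (σ_q y, (j + m)_Γ)` on `Y × F`, where `Γ = H ℤ^d` and
`q = H⁻¹ (j + m - (j + m)_Γ)`. -/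
noncomputable def suspensionAct {d : ℕ} {B : Type*} [TopologicalSpace B] (Y : Subshift d B)
    (H : Matrix (Fin d) (Fin d) ℤ) {F : Set (Fin d → ℤ)}
    (hF : IsFundamentalDomain (columnLattice H) F) (m : Fin d → ℤ) (p : Y × F) : Y × F :=
  (Y.act (latticeCoord H ((p.2 : Fin d → ℤ) + m - hF.rep ((p.2 : Fin d → ℤ) + m))) p.1,
    hF.rep ((p.2 : Fin d → ℤ) + m))

/-! Write R for the return module and X for `θ.shiftSpace`. By recurrence ℤ^d/R is finite, and Q
acts on it. In a finite Abelian group the smallest subgroup coprime with the range of an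
endomorphism is the nilpotent Fitting component. Hence v ∈ Γ if and only if Qv ∈ Γ, and Q^N Γ ⊆ R
for some N.

Suspension: since R ⊆ Γ, all positions of a letter in a configuration lie in one class modulo Γ, so
x 0 determines a class of x. The configurations of class 0 form a closed Γ-invariant set X₀, and X
is the disjoint union of the σ_j X₀ with j ∈ F. Reading patterns on a finite window W along Γ = Hℤ^d
turns X₀ into the subshift Y. By minimality an automorphism translates all classes by the same
amount, so up to a shift it restricts to X₀.

Maximal equicontinuous factor: let L_n be the stabilizer of θ^n(X) (`supertileGroup`). The cuts into
level-n supertiles map X₀ onto an odometer inside the product of the ℤ^d/L_n. Two points of X₀ with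
the same cuts at all levels have equal images in every equicontinuous factor: a translate of one by
Q^n s, with s ∈ Γ bounded, agrees with the other on a large ball, and Q^n s acts almost trivially
because Q^N s ∈ R (`eq_of_forall_exists_eq_shiftMap`). For torsion-freeness a weak recognizability
suffices: aperiodicity bounds the index of Q^n ℤ^d in L_n, so eventually L_(n+1) = Q L_n and
L_(n₀+n) ⊆ Q^n ℤ^d (`exists_supertileGroup_le`). As Q is diagonal, pv ∈ Q^(n+1)ℤ^d implies v ∈ Q^n
ℤ^d for every prime p.

Substitution: σ_(-s) ∘ θ preserves X₀ for a suitable s. If H⁻¹QH is integral, this map acts on codes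
as a digit substitution ϑ whose digits are the points of Γ in a fundamental box of QΓ. Its supertile
supports contain arbitrarily large balls, which gives primitivity, extensibility and Y = 𝕏_ϑ. A
lattice Λ that competes for the height lattice of ϑ yields M₀ = HΛ with Q^m Γ ⊆ M₀ and Γ ⊆ M₀ + QΓ.
As M₀ need not be Q-invariant, Γ ⊆ M₀ is proved one prime at a time (`le_of_sub_mul_mem`). -/

namespace DigitSubstitution

variable {d : ℕ} {A : Type*}

/-! ### Division with remainder and the global substitution map -/

theorem det_ne_zero (θ : DigitSubstitution d A) : θ.Q.det ≠ 0 := by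
  intro h
  have h0 : (0 : ℂ) ∈ spectrum ℂ (θ.Q.map (Int.cast : ℤ → ℂ)) := by
    rw [spectrum.zero_mem_iff, Matrix.isUnit_iff_isUnit_det, isUnit_iff_ne_zero, not_not]
    have := (Int.castRingHom ℂ).map_det θ.Q
    rw [h, map_zero] at this
    exact this.symm
  have := θ.expansive 0 h0
  simp at this
  linarith

theorem mulVec_pow_injective (θ : DigitSubstitution d A) (k : ℕ) :
    Function.Injective (θ.Q ^ k).mulVec := by
  intro v w h
  have h' : (θ.Q ^ k).mulVec (v - w) = 0 := by
    rw [Matrix.mulVec_sub]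
    exact sub_eq_zero.2 h
  exact sub_eq_zero.1 (Matrix.eq_zero_of_mulVec_eq_zero
    (by rw [Matrix.det_pow]; exact pow_ne_zero _ θ.det_ne_zero) h')

theorem mulVec_injective (θ : DigitSubstitution d A) : Function.Injective θ.Q.mulVec := by
  simpa using θ.mulVec_pow_injective 1

/-- The remainder of `n` in the digit set. -/
noncomputable def rem (θ : DigitSubstitution d A) (n : Fin d → ℤ) : θ.digits :=
  ⟨(θ.complete n).choose, (θ.complete n).choose_spec.1.1⟩

theorem exists_quot (θ : DigitSubstitution d A) (n : Fin d → ℤ) :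
    ∃ q, θ.Q.mulVec q = n - θ.rem n :=
  (θ.complete n).choose_spec.1.2

/-- The quotient of `n` by `Q`. -/
noncomputable def quot (θ : DigitSubstitution d A) (n : Fin d → ℤ) : Fin d → ℤ :=
  (θ.exists_quot n).choose

theorem mulVec_quot (θ : DigitSubstitution d A) (n : Fin d → ℤ) :
    θ.Q.mulVec (θ.quot n) = n - θ.rem n :=
  (θ.exists_quot n).choose_spec

theorem mulVec_quot_add_rem (θ : DigitSubstitution d A) (n : Fin d → ℤ) :
    θ.Q.mulVec (θ.quot n) + θ.rem n = n := by
  rw [mulVec_quot]; abel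

theorem rem_mulVec_add (θ : DigitSubstitution d A) (q : Fin d → ℤ) (i : θ.digits) :
    θ.rem (θ.Q.mulVec q + i) = i := by
  obtain ⟨j, -, hj⟩ := θ.complete (θ.Q.mulVec q + i)
  apply Subtype.ext
  rw [hj (θ.rem (θ.Q.mulVec q + i)) ⟨(θ.rem _).2, θ.quot (θ.Q.mulVec q + i), θ.mulVec_quot _⟩]
  exact (hj i ⟨i.2, q, by simp⟩).symm

theorem quot_mulVec_add (θ : DigitSubstitution d A) (q : Fin d → ℤ) (i : θ.digits) :
    θ.quot (θ.Q.mulVec q + i) = q := by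
  apply θ.mulVec_injective
  rw [mulVec_quot, rem_mulVec_add]; abel

theorem quot_add_mulVec (θ : DigitSubstitution d A) (n m : Fin d → ℤ) :
    θ.quot (n + θ.Q.mulVec m) = θ.quot n + m := by
  have h : n + θ.Q.mulVec m = θ.Q.mulVec (θ.quot n + m) + θ.rem n := by
    rw [Matrix.mulVec_add, mulVec_quot]; abel
  rw [h, quot_mulVec_add]

theorem rem_add_mulVec (θ : DigitSubstitution d A) (n m : Fin d → ℤ) :
    θ.rem (n + θ.Q.mulVec m) = θ.rem n := by
  have h : n + θ.Q.mulVec m = θ.Q.mulVec (θ.quot n + m) + θ.rem n := by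
    rw [Matrix.mulVec_add, mulVec_quot]; abel
  rw [h, rem_mulVec_add]

theorem pow_succ_mulVec {M : Matrix (Fin d) (Fin d) ℤ} (k : ℕ) (m : Fin d → ℤ) :
    (M ^ (k + 1)).mulVec m = M.mulVec ((M ^ k).mulVec m) := by
  rw [pow_succ', Matrix.mulVec_mulVec]

theorem pow_add_mulVec {M : Matrix (Fin d) (Fin d) ℤ} (k l : ℕ) (m : Fin d → ℤ) :
    (M ^ (k + l)).mulVec m = (M ^ k).mulVec ((M ^ l).mulVec m) := by
  rw [pow_add, Matrix.mulVec_mulVec]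

theorem quot_iterate_add (θ : DigitSubstitution d A) (k : ℕ) (n m : Fin d → ℤ) :
    θ.quot^[k] (n + (θ.Q ^ k).mulVec m) = θ.quot^[k] n + m := by
  induction k generalizing n with
  | zero => simp
  | succ k ih =>
    rw [Function.iterate_succ_apply, pow_succ_mulVec, quot_add_mulVec, ih,
      Function.iterate_succ_apply]

theorem exists_quot_iterate_eq (θ : DigitSubstitution d A) (k : ℕ) (m : Fin d → ℤ) :
    ∃ n, θ.quot^[k] n = m :=
  ⟨(θ.Q ^ k).mulVec (m - θ.quot^[k] 0), by
    rw [← zero_add ((θ.Q ^ k).mulVec _), quot_iterate_add]; abel⟩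

/-- The substitution as a map on configurations. -/
noncomputable def subst (θ : DigitSubstitution d A) (x : (Fin d → ℤ) → A) : (Fin d → ℤ) → A :=
  fun n => θ.rule (x (θ.quot n)) (θ.rem n)

theorem subst_iterate_shiftMap (θ : DigitSubstitution d A) (k : ℕ) (m : Fin d → ℤ)
    (x : (Fin d → ℤ) → A) :
    θ.subst^[k] (shiftMap m x) = shiftMap ((θ.Q ^ k).mulVec m) (θ.subst^[k] x) := by
  induction k with
  | zero => simp
  | succ k ih =>
    rw [Function.iterate_succ_apply', ih, Function.iterate_succ_apply', pow_succ_mulVec]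
    funext n
    simp only [subst, shiftMap, quot_add_mulVec, rem_add_mulVec]

theorem subst_shiftMap (θ : DigitSubstitution d A) (m : Fin d → ℤ) (x : (Fin d → ℤ) → A) :
    θ.subst (shiftMap m x) = shiftMap (θ.Q.mulVec m) (θ.subst x) := by
  simpa using θ.subst_iterate_shiftMap 1 m x

/-- Locality: a letter of θ^k(x) depends only on the letter of x whose supertile covers its
position. -/
theorem subst_iterate_congr (θ : DigitSubstitution d A) (k : ℕ) {x y : (Fin d → ℤ) → A}
    {n : Fin d → ℤ} (h : x (θ.quot^[k] n) = y (θ.quot^[k] n)) :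
    θ.subst^[k] x n = θ.subst^[k] y n := by
  induction k generalizing n with
  | zero => simpa using h
  | succ k ih =>
    simp only [Function.iterate_succ_apply', subst]
    rw [ih h]

/-- Local rule of `θ^k` for two configurations at two places with the same remainder. -/
theorem subst_iterate_congr_add (θ : DigitSubstitution d A) (k : ℕ) {x y : (Fin d → ℤ) → A}
    {n m : Fin d → ℤ} (h : x (θ.quot^[k] n + m) = y (θ.quot^[k] n)) :
    θ.subst^[k] x (n + (θ.Q ^ k).mulVec m) = θ.subst^[k] y n := by
  have := θ.subst_iterate_congr k (x := shiftMap m x) (y := y) (n := n) h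
  rwa [subst_iterate_shiftMap] at this

/-- Applying the global map to a constant configuration replaces the inductive definition of
supertiles by arithmetic with iterated quotients. -/
theorem mem_supertile_iff (θ : DigitSubstitution d A) (k : ℕ) (a b : A) (j : Fin d → ℤ) :
    (j, b) ∈ θ.supertile k a ↔ θ.quot^[k] j = 0 ∧ b = θ.subst^[k] (fun _ => a) j := by
  induction k generalizing j b with
  | zero => simp [supertile]
  | succ k ih =>
    have hs : θ.subst^[k + 1] (fun _ => a) j = θ.rule (θ.subst^[k] (fun _ => a) (θ.quot j))
        (θ.rem j) := by
      rw [Function.iterate_succ_apply', subst]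
    rw [hs, Function.iterate_succ_apply]
    simp only [supertile, Set.mem_ofPred_eq, Prod.exists, Prod.mk.injEq]
    constructor
    · rintro ⟨q, c, hq, i, rfl, rfl⟩
      obtain ⟨h1, rfl⟩ := (ih _ _).1 hq
      simp only [quot_mulVec_add, rem_mulVec_add]
      exact ⟨h1, trivial⟩
    · rintro ⟨h1, rfl⟩
      exact ⟨θ.quot j, _, (ih _ _).2 ⟨h1, rfl⟩, θ.rem j, (θ.mulVec_quot_add_rem j).symm, rfl⟩

theorem isLegal_iff (θ : DigitSubstitution d A) (B : Finset (Fin d → ℤ))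
    (P : (Fin d → ℤ) → A) :
    θ.IsLegal B P ↔ ∃ (a : A) (k : ℕ) (t : Fin d → ℤ), 1 ≤ k ∧
      ∀ b ∈ B, θ.quot^[k] (b + t) = 0 ∧ P b = θ.subst^[k] (fun _ => a) (b + t) := by
  simp only [IsLegal, mem_supertile_iff]

/-- Every letter occurs in every supertile of sufficiently high level. -/
theorem IsPrimitive.eventually {θ : DigitSubstitution d A} (h : θ.IsPrimitive) :
    ∃ k₀ : ℕ, ∀ k ≥ k₀, ∀ a b : A, ∃ j, θ.quot^[k] j = 0 ∧
      θ.subst^[k] (fun _ => a) j = b := by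
  obtain ⟨k₀, hk⟩ := h
  refine ⟨k₀, fun k hkk a b => ?_⟩
  obtain ⟨l, rfl⟩ := Nat.exists_eq_add_of_le hkk
  -- The pattern θ^(k₀+l)(a) contains θ^(k₀)(c), where c is the letter of θ^l(a) at i, and θ^(k₀)(c)
  -- already contains every letter.
  obtain ⟨i, hi⟩ := θ.exists_quot_iterate_eq l 0
  obtain ⟨j, hj⟩ := hk (θ.subst^[l] (fun _ => a) i) b
  obtain ⟨h1, h2⟩ := (θ.mem_supertile_iff _ _ _ _).1 hj
  refine ⟨j + (θ.Q ^ k₀).mulVec i, ?_, ?_⟩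
  · rw [add_comm k₀, Function.iterate_add_apply, quot_iterate_add, h1, zero_add, hi]
  · rw [Function.iterate_add_apply, h2]
    exact θ.subst_iterate_congr_add k₀ (by rw [h1, zero_add])

/-- A legal pattern occurs in all supertiles of sufficiently high level. -/
theorem IsLegal.eventually {θ : DigitSubstitution d A} (h : θ.IsPrimitive)
    {B : Finset (Fin d → ℤ)} {P : (Fin d → ℤ) → A} (hP : θ.IsLegal B P) :
    ∃ K : ℕ, ∀ n ≥ K, ∀ a : A, ∃ t, ∀ b ∈ B, θ.quot^[n] (b + t) = 0 ∧
      P b = θ.subst^[n] (fun _ => a) (b + t) := by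
  obtain ⟨k₀, hk⟩ := h.eventually
  obtain ⟨c, k, t, -, ht⟩ := (θ.isLegal_iff B P).1 hP
  refine ⟨k + k₀, fun n hn a => ?_⟩
  obtain ⟨l, rfl⟩ : ∃ l, n = k + l := ⟨n - k, by omega⟩
  obtain ⟨j, hj, hja⟩ := hk l (by omega) a c
  refine ⟨t + (θ.Q ^ k).mulVec j, fun b hb => ?_⟩
  obtain ⟨h1, h2⟩ := ht b hb
  constructor
  · rw [← add_assoc, add_comm k, Function.iterate_add_apply, quot_iterate_add, h1, zero_add, hj]
  · rw [h2, ← add_assoc, Function.iterate_add_apply]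
    symm
    apply θ.subst_iterate_congr_add
    rw [h1, zero_add, hja]

theorem isLegal_singleton {θ : DigitSubstitution d A} (h : θ.IsPrimitive) (a : A) :
    θ.IsLegal {0} (fun _ => a) := by
  obtain ⟨k₀, hk⟩ := h.eventually
  obtain ⟨j, hj, hja⟩ := hk (k₀ + 1) (by omega) a a
  rw [isLegal_iff]
  refine ⟨a, k₀ + 1, j, by omega, ?_⟩
  simp only [Finset.mem_singleton, forall_eq, zero_add]
  exact ⟨hj, hja.symm⟩

theorem IsLegal.mono {θ : DigitSubstitution d A} {B B' : Finset (Fin d → ℤ)}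
    {P : (Fin d → ℤ) → A} (hP : θ.IsLegal B P) (h : B' ⊆ B) : θ.IsLegal B' P := by
  obtain ⟨c, k, t, hk, ht⟩ := hP
  exact ⟨c, k, t, hk, fun b hb => ht b (h hb)⟩

section ShiftSpace

variable [TopologicalSpace A] [DiscreteTopology A]

theorem subst_mem {θ : DigitSubstitution d A} {x : (Fin d → ℤ) → A}
    (hx : x ∈ θ.shiftSpace.carrier) : θ.subst x ∈ θ.shiftSpace.carrier := by
  classical
  intro B
  obtain ⟨a, k, t, hk, h⟩ := (θ.isLegal_iff _ _).1 (hx (B.image θ.quot))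
  refine (θ.isLegal_iff _ _).2 ⟨a, k + 1, θ.Q.mulVec t, by omega, fun b hb => ?_⟩
  obtain ⟨h1, h2⟩ := h _ (Finset.mem_image_of_mem _ hb)
  rw [Function.iterate_succ_apply, quot_add_mulVec]
  refine ⟨h1, ?_⟩
  rw [Function.iterate_succ_apply']
  simp only [subst]
  rw [h2, quot_add_mulVec, rem_add_mulVec]

theorem subst_iterate_mem {θ : DigitSubstitution d A} {x : (Fin d → ℤ) → A}
    (hx : x ∈ θ.shiftSpace.carrier) (n : ℕ) : θ.subst^[n] x ∈ θ.shiftSpace.carrier := by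
  induction n with
  | zero => exact hx
  | succ n ih => rw [Function.iterate_succ_apply']; exact subst_mem ih

theorem continuous_subst (θ : DigitSubstitution d A) : Continuous θ.subst :=
  continuous_pi fun n =>
    (continuous_of_discreteTopology (f := fun a => θ.rule a (θ.rem n))).comp
      (continuous_apply (θ.quot n))

theorem continuous_subst_iterate (θ : DigitSubstitution d A) (n : ℕ) :
    Continuous (θ.subst^[n]) := θ.continuous_subst.iterate n

end ShiftSpace

end DigitSubstitution

theorem continuous_shiftMap {d : ℕ} {A : Type*} [TopologicalSpace A] (n : Fin d → ℤ) :
    Continuous (shiftMap (A := A) n) :=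
  continuous_pi fun i => continuous_apply (i + n)

theorem shiftMap_shiftMap {d : ℕ} {A : Type*} (m n : Fin d → ℤ) (x : (Fin d → ℤ) → A) :
    shiftMap m (shiftMap n x) = shiftMap (m + n) x := by
  funext i; simp [shiftMap, add_assoc]

@[simp] theorem shiftMap_zero {d : ℕ} {A : Type*} (x : (Fin d → ℤ) → A) :
    shiftMap 0 x = x := by
  funext i; simp [shiftMap]

/-! ### Geometry of block substitutions -/

/-- A block substitution with inflation matrix `diag ℓ` whose digits are the points `n` with
`a i ≤ n i < a i + |ℓ i|`. -/
structure DigitSubstitution.IsBlockWith {d : ℕ} {A : Type*} (θ : DigitSubstitution d A)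
    (ℓ a : Fin d → ℤ) : Prop where
  Q_eq : θ.Q = Matrix.diagonal ℓ
  two_le : ∀ i, 2 ≤ |ℓ i|
  rem_mem : ∀ n i, a i ≤ (θ.rem n : Fin d → ℤ) i ∧ (θ.rem n : Fin d → ℤ) i < a i + |ℓ i|

namespace DigitSubstitution

variable {d : ℕ} {A : Type*} {θ : DigitSubstitution d A} {ℓ a : Fin d → ℤ}

theorem two_le_abs_of_Q_eq_diagonal (hQ : θ.Q = Matrix.diagonal ℓ) (i : Fin d) : 2 ≤ |ℓ i| := by
  have hs : (ℓ i : ℂ) ∈ spectrum ℂ (θ.Q.map (Int.cast : ℤ → ℂ)) := by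
    rw [hQ, Matrix.diagonal_map (by simp), spectrum_diagonal]
    exact ⟨i, rfl⟩
  have := θ.expansive _ hs
  rw [Complex.norm_intCast] at this
  have h' : (1 : ℤ) < |ℓ i| := by exact_mod_cast this
  omega

/-- If a side of the digit box were longer than |ℓ i|, then the corner a and its translate by |ℓ i|
in direction i would be two digits congruent modulo Q. -/
theorem IsBlock.exists_isBlockWith (h : θ.IsBlock) : ∃ ℓ a, θ.IsBlockWith ℓ a := by
  obtain ⟨⟨ℓ, hQ⟩, a, b, hD⟩ := h
  refine ⟨ℓ, a, hQ, two_le_abs_of_Q_eq_diagonal hQ, fun n i => ?_⟩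
  have hr : ∀ m, (θ.rem m : Fin d → ℤ) ∈ Finset.Icc a b := fun m => hD ▸ (θ.rem m).2
  obtain ⟨h1, h2⟩ := Finset.mem_Icc.1 (hr n)
  refine ⟨h1 i, ?_⟩
  by_contra! hlt
  have hab : a ≤ b := h1.trans h2
  have hpos := two_le_abs_of_Q_eq_diagonal hQ i
  have ha : a ∈ θ.digits := by rw [hD]; exact Finset.mem_Icc.2 ⟨le_rfl, hab⟩
  have hc : a + Pi.single i |ℓ i| ∈ θ.digits := by
    rw [hD, Finset.mem_Icc]
    constructor
    · intro j
      by_cases hj : j = i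
      · subst hj; simp
      · simp [hj]
    · intro j
      by_cases hj : j = i
      · subst hj
        simp only [Pi.add_apply, Pi.single_eq_same]
        exact hlt.trans (h2 j)
      · simpa [hj] using hab j
  have key : a + Pi.single i |ℓ i| =
      θ.Q.mulVec (Pi.single i (ℓ i).sign) + a := by
    rw [hQ]
    funext j
    by_cases hj : j = i
    · subst hj
      simp [add_comm]
    · simp [hj]
  have e1 := θ.rem_mulVec_add 0 ⟨_, hc⟩
  have e2 := θ.rem_mulVec_add (Pi.single i (ℓ i).sign) ⟨a, ha⟩
  simp only [← key] at e2
  rw [Matrix.mulVec_zero, zero_add] at e1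
  have := congrFun (congrArg Subtype.val (e1.symm.trans e2)) i
  simp only [Pi.add_apply, Pi.single_eq_same] at this
  omega

theorem IsBlockWith.mulVec_apply (h : θ.IsBlockWith ℓ a) (m : Fin d → ℤ) (i : Fin d) :
    θ.Q.mulVec m i = ℓ i * m i := by
  rw [h.Q_eq, Matrix.mulVec_diagonal]

theorem IsBlockWith.pow_mulVec_apply (h : θ.IsBlockWith ℓ a) (k : ℕ) (m : Fin d → ℤ)
    (i : Fin d) : (θ.Q ^ k).mulVec m i = ℓ i ^ k * m i := by
  rw [h.Q_eq, Matrix.diagonal_pow, Matrix.mulVec_diagonal]; rfl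

theorem IsBlockWith.quot_bounds (h : θ.IsBlockWith ℓ a) (n : Fin d → ℤ) (i : Fin d) :
    a i ≤ n i - ℓ i * θ.quot n i ∧ n i - ℓ i * θ.quot n i < a i + |ℓ i| := by
  have h1 := congrFun (θ.mulVec_quot n) i
  rw [h.mulVec_apply] at h1
  rw [h1]
  simpa using h.rem_mem n i

/-- The supertile support of level `m` is a box with side lengths `|ℓ i| ^ m`. -/
theorem IsBlockWith.exists_box (h : θ.IsBlockWith ℓ a) (m : ℕ) :
    ∃ s : Fin d → ℤ, ∀ z, θ.quot^[m] z = 0 ↔ ∀ i, s i ≤ z i ∧ z i < s i + |ℓ i| ^ m := by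
  induction m with
  | zero =>
    refine ⟨0, fun z => ?_⟩
    simp only [Function.iterate_zero, id_eq, Pi.zero_apply, pow_zero, zero_add, funext_iff]
    exact forall_congr' fun i => ⟨fun h => by omega, fun h => by omega⟩
  | succ m ih =>
    obtain ⟨s, hs⟩ := ih
    -- A negative ℓ i reverses the direction, so the new lower corner comes from the old upper end s
    -- i + |ℓ i|^m - 1.
    refine ⟨fun i => if 0 < ℓ i then ℓ i * s i + a i else ℓ i * (s i + |ℓ i| ^ m - 1) + a i,
      fun z => ?_⟩
    rw [Function.iterate_succ_apply, hs]
    refine forall_congr' fun i => ?_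
    have hb := h.quot_bounds z i
    have h2 := h.two_le i
    have hp : 0 < |ℓ i| ^ m := pow_pos (by linarith) m
    rw [pow_succ']
    beta_reduce
    generalize θ.quot z i = q at hb ⊢
    generalize |ℓ i| ^ m = L at hp ⊢
    rcases lt_or_ge 0 (ℓ i) with hl | hl
    · rw [if_pos hl]
      rw [abs_of_pos hl] at hb h2 ⊢
      constructor
      · rintro ⟨h3, h4⟩
        constructor <;> nlinarith
      · rintro ⟨h3, h4⟩
        constructor
        · by_contra! hc
          nlinarith
        · by_contra! hc
          nlinarith
    · rw [if_neg (not_lt.2 hl)]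
      rw [abs_of_nonpos hl] at hb h2 ⊢
      constructor
      · rintro ⟨h3, h4⟩
        constructor <;> nlinarith
      · rintro ⟨h3, h4⟩
        constructor
        · by_contra! hc
          nlinarith
        · by_contra! hc
          nlinarith

theorem IsBlockWith.lt_of_quot_iterate_eq (h : θ.IsBlockWith ℓ a) (m : ℕ) {z w : Fin d → ℤ}
    (e : θ.quot^[m] z = θ.quot^[m] w) (i : Fin d) : |z i - w i| < |ℓ i| ^ m := by
  obtain ⟨s, hs⟩ := h.exists_box m
  have h1 : θ.quot^[m] (z + (θ.Q ^ m).mulVec (-θ.quot^[m] z)) = 0 := by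
    rw [quot_iterate_add]; abel
  have h2 : θ.quot^[m] (w + (θ.Q ^ m).mulVec (-θ.quot^[m] z)) = 0 := by
    rw [quot_iterate_add, e]; abel
  have h3 := (hs _).1 h1 i
  have h4 := (hs _).1 h2 i
  simp only [Pi.add_apply] at h3 h4
  rw [abs_lt]
  constructor <;> linarith

/-- One division changes the distance D to a value D' with |ℓ i| D' < D + |ℓ i|; hence D ≤ |ℓ
i|^(m+1) gives D' ≤ |ℓ i|^m. -/
theorem IsBlockWith.abs_quot_sub_le (h : θ.IsBlockWith ℓ a) (m : ℕ) {z w : Fin d → ℤ}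
    {i : Fin d} (e : |z i - w i| ≤ |ℓ i| ^ m) : |θ.quot^[m] z i - θ.quot^[m] w i| ≤ 1 := by
  induction m generalizing z w with
  | zero => simpa using e
  | succ m ih =>
    rw [Function.iterate_succ_apply, Function.iterate_succ_apply]
    apply ih
    have h1 := h.quot_bounds z i
    have h2 := h.quot_bounds w i
    have hp := h.two_le i
    have h3 : |ℓ i * (θ.quot z i - θ.quot w i)| < |ℓ i| ^ (m + 1) + |ℓ i| := by
      rw [mul_sub, abs_lt]
      rw [abs_le] at e
      constructor <;> linarith
    rw [abs_mul, pow_succ'] at h3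
    by_contra! hc
    nlinarith

/-- Supertile supports contain arbitrarily large balls. -/
theorem IsBlockWith.exists_ball (h : θ.IsBlockWith ℓ a) (r : ℤ) :
    ∃ k₀ : ℕ, ∀ k ≥ k₀, ∃ c : Fin d → ℤ, ∀ z : Fin d → ℤ, (∀ i, |z i| ≤ r) →
      θ.quot^[k] (z + c) = 0 := by
  refine ⟨(2 * r + 1).toNat, fun k hk => ?_⟩
  obtain ⟨s, hs⟩ := h.exists_box k
  refine ⟨fun i => s i + r, fun z hz => (hs _).2 fun i => ?_⟩
  have h1 := abs_le.1 (hz i)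
  have h2 : ((2 : ℤ) ^ k) ≤ |ℓ i| ^ k := pow_le_pow_left₀ (by norm_num) (h.two_le i) k
  have h3 : (k : ℤ) < 2 ^ k := by exact_mod_cast Nat.lt_two_pow_self
  simp only [Pi.add_apply]
  constructor
  · linarith
  · have : 2 * r + 1 ≤ (k : ℤ) := by omega
    linarith

/-- A common bound of the side lengths of the level-`m` supertiles. -/
theorem exists_abs_pow_le (ℓ : Fin d → ℤ) (m : ℕ) : ∃ r : ℤ, 0 ≤ r ∧ ∀ i, |ℓ i| ^ m ≤ r :=
  ⟨∑ i, |ℓ i| ^ m, Finset.sum_nonneg fun _ _ => pow_nonneg (abs_nonneg _) _,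
    fun i => Finset.single_le_sum (f := fun i => |ℓ i| ^ m)
      (fun _ _ => pow_nonneg (abs_nonneg _) _) (Finset.mem_univ i)⟩

end DigitSubstitution

/-- The box of all `z` with `|z i| ≤ r`. -/
noncomputable def latticeBox (d : ℕ) (r : ℤ) : Finset (Fin d → ℤ) :=
  Finset.Icc (fun _ => -r) (fun _ => r)

theorem mem_latticeBox {d : ℕ} {r : ℤ} {z : Fin d → ℤ} :
    z ∈ latticeBox d r ↔ ∀ i, |z i| ≤ r := by
  simp only [latticeBox, Finset.mem_Icc, Pi.le_def, abs_le, forall_and]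

theorem latticeBox_mono {d : ℕ} {r s : ℤ} (h : r ≤ s) : latticeBox d r ⊆ latticeBox d s :=
  fun _ hz => mem_latticeBox.2 fun i => (mem_latticeBox.1 hz i).trans h

theorem exists_subset_latticeBox {d : ℕ} (B : Finset (Fin d → ℤ)) :
    ∃ r : ℤ, 0 ≤ r ∧ B ⊆ latticeBox d r := by
  refine ⟨∑ b ∈ B, ∑ i, |b i|, Finset.sum_nonneg fun b _ => Finset.sum_nonneg fun _ _ =>
    abs_nonneg _, fun b hb => mem_latticeBox.2 fun i => ?_⟩
  calc |b i| ≤ ∑ i, |b i| :=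
        Finset.single_le_sum (f := fun i => |b i|) (fun _ _ => abs_nonneg _) (Finset.mem_univ i)
    _ ≤ _ := Finset.single_le_sum (f := fun b => ∑ i, |b i|)
        (fun _ _ => Finset.sum_nonneg fun _ _ => abs_nonneg _) hb

namespace DigitSubstitution

variable {d : ℕ} {A : Type*} {θ : DigitSubstitution d A} {ℓ a : Fin d → ℤ}
  [TopologicalSpace A] [DiscreteTopology A]

/-! ### Recurrence, minimality and desubstitution -/

theorem isClosed_setOf_isLegal (B : Finset (Fin d → ℤ)) :
    IsClosed {x : (Fin d → ℤ) → A | θ.IsLegal B x} := by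
  rw [← isOpen_compl_iff, isOpen_iff_forall_mem_open]
  intro x hx
  refine ⟨⋂ b ∈ B, (fun y => y b) ⁻¹' {x b}, ?_, ?_, by simp⟩
  · intro y hy hl
    obtain ⟨c, k, t, hk, h⟩ := hl
    simp only [Set.mem_iInter, Set.mem_preimage, Set.mem_singleton_iff] at hy
    exact hx ⟨c, k, t, hk, fun b hb => hy b hb ▸ h b hb⟩
  · exact isOpen_biInter_finset fun b _ =>
      (isOpen_discrete ({x b} : Set A)).preimage (continuous_apply b)

/-- Compactness: the configurations that are legal on growing boxes form a decreasing sequence of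
compact sets, nonempty because supertiles contain large balls. -/
theorem IsBlockWith.shiftSpace_nonempty [Finite A] [Nonempty A] (h : θ.IsBlockWith ℓ a) :
    θ.shiftSpace.carrier.Nonempty := by
  have hne := IsCompact.nonempty_iInter_of_sequence_nonempty_isCompact_isClosed
    (fun n : ℕ => {x : (Fin d → ℤ) → A | θ.IsLegal (latticeBox d n) x})
    (fun n x hx => IsLegal.mono hx (latticeBox_mono (by push_cast; linarith)))
    (fun n => ?_) (isClosed_setOf_isLegal _).isCompact (fun n => isClosed_setOf_isLegal _)
  · obtain ⟨x, hx⟩ := hne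
    refine ⟨x, fun B => ?_⟩
    obtain ⟨r, hr, hB⟩ := exists_subset_latticeBox B
    refine IsLegal.mono (Set.mem_iInter.1 hx r.toNat) ?_
    rwa [Int.toNat_of_nonneg hr]
  · obtain ⟨k₀, hk⟩ := h.exists_ball n
    obtain ⟨c, hc⟩ := hk (k₀ + 1) (by omega)
    let b : A := Classical.arbitrary A
    refine ⟨shiftMap c (θ.subst^[k₀ + 1] fun _ => b), ?_⟩
    rw [Set.mem_ofPred_eq, isLegal_iff]
    exact ⟨b, k₀ + 1, c, by omega, fun z hz => ⟨hc z (mem_latticeBox.1 hz), rfl⟩⟩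

/-- Every legal pattern occurs with bounded gaps in every configuration. -/
theorem IsLegal.exists_occurrence (hp : θ.IsPrimitive) (h : θ.IsBlockWith ℓ a)
    {B : Finset (Fin d → ℤ)} {P : (Fin d → ℤ) → A} (hP : θ.IsLegal B P) :
    ∃ r : ℤ, ∀ x ∈ θ.shiftSpace.carrier, ∀ n : Fin d → ℤ, ∃ s : Fin d → ℤ,
      (∀ b ∈ B, P b = x (b + s)) ∧ ∀ b ∈ B, ∀ i, |b i + s i - n i| ≤ r := by
  obtain ⟨K, hK⟩ := hP.eventually hp
  obtain ⟨r, hr0, hr⟩ := exists_abs_pow_le ℓ K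
  refine ⟨r, ?_⟩
  suffices H : ∀ x ∈ θ.shiftSpace.carrier, ∃ s : Fin d → ℤ,
      (∀ b ∈ B, P b = x (b + s)) ∧ ∀ b ∈ B, ∀ i, |b i + s i| ≤ r by
    intro x hx n
    obtain ⟨s, hs1, hs2⟩ := H _ (θ.shiftSpace.shift_mem n x hx)
    refine ⟨s + n, fun b hb => ?_, fun b hb i => ?_⟩
    · rw [hs1 b hb, shiftMap, add_assoc]
    · simpa [← add_assoc] using hs2 b hb i
  intro x hx
  obtain ⟨K', hK'⟩ := (hx (latticeBox d r)).eventually hp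
  -- The pattern of x on the box of radius r occurs in θ^(K+K')(x 0) at t. The level-K supertile
  -- through t contains a copy of P, and its sides are at most r, so this copy lies in the box.
  obtain ⟨t, ht⟩ := hK' (K + K') (by omega) (x 0)
  obtain ⟨t', ht'⟩ := hK K le_rfl (θ.subst^[K'] (fun _ => x 0) (θ.quot^[K] t))
  have hq : ∀ b ∈ B, θ.quot^[K] (b + t' + (θ.Q ^ K).mulVec (θ.quot^[K] t)) = θ.quot^[K] t :=
    fun b hb => by rw [quot_iterate_add, (ht' b hb).1, zero_add]
  have hbox : ∀ b ∈ B, ∀ i, |b i + (t' + (θ.Q ^ K).mulVec (θ.quot^[K] t) - t) i| ≤ r := by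
    intro b hb i
    have := (h.lt_of_quot_iterate_eq K (hq b hb) i).le.trans (hr i)
    simpa [add_assoc, add_sub_assoc] using this
  refine ⟨t' + (θ.Q ^ K).mulVec (θ.quot^[K] t) - t, fun b hb => ?_, hbox⟩
  have h1 := (ht (b + (t' + (θ.Q ^ K).mulVec (θ.quot^[K] t) - t))
    (mem_latticeBox.2 (hbox b hb))).2
  rw [h1, (ht' b hb).2, Function.iterate_add_apply]
  have h2 : b + (t' + (θ.Q ^ K).mulVec (θ.quot^[K] t) - t) + t =
      (b + t') + (θ.Q ^ K).mulVec (θ.quot^[K] t) := by abel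
  rw [h2]
  symm
  apply subst_iterate_congr_add
  rw [(ht' b hb).1, zero_add]

/-- The union of the sets σ_i θ(X) over the digits i is closed. It contains x because every pattern
of x is covered by the image under θ of a legal pattern, which occurs in a fixed configuration. -/
theorem exists_eq_shiftMap_subst [Finite A] [Nonempty A] (hp : θ.IsPrimitive)
    (h : θ.IsBlockWith ℓ a) {x : (Fin d → ℤ) → A} (hx : x ∈ θ.shiftSpace.carrier) :
    ∃ y ∈ θ.shiftSpace.carrier, ∃ t, x = shiftMap t (θ.subst y) := by
  classical
  let Z : Set ((Fin d → ℤ) → A) :=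
    ⋃ i ∈ θ.digits, (fun y => shiftMap i (θ.subst y)) '' θ.shiftSpace.carrier
  have hZ : IsClosed Z := by
    refine isClosed_biUnion_finset fun i _ => IsCompact.isClosed ?_
    exact θ.shiftSpace.isClosed_carrier.isCompact.image
      ((continuous_shiftMap i).comp θ.continuous_subst)
  have hxZ : x ∈ Z := by
    rw [← hZ.closure_eq, mem_closure_iff]
    intro o ho hxo
    obtain ⟨B, u, hu, hsub⟩ := isOpen_pi_iff.1 ho x hxo
    obtain ⟨K, hK⟩ := (hx B).eventually hp
    -- One level is used up by the outer application of θ; the remaining level K + 1 is positive, as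
    -- legality requires.
    obtain ⟨t, ht⟩ := hK (K + 2) (by omega) (x 0)
    have hl : θ.IsLegal ((B.image (· + t)).image θ.quot) (θ.subst^[K + 1] fun _ => x 0) := by
      rw [isLegal_iff]
      refine ⟨x 0, K + 1, 0, by omega, fun b hb => ?_⟩
      simp only [Finset.mem_image, exists_exists_and_eq_and] at hb
      obtain ⟨b, hb, rfl⟩ := hb
      rw [add_zero, ← Function.iterate_succ_apply]
      exact ⟨(ht b hb).1, rfl⟩
    obtain ⟨x₀, hx₀⟩ := h.shiftSpace_nonempty (A := A)
    obtain ⟨_, hr⟩ := hl.exists_occurrence hp h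
    obtain ⟨s, hs, -⟩ := hr x₀ hx₀ 0
    have e : θ.Q.mulVec (θ.quot (t + θ.Q.mulVec s)) + θ.rem (t + θ.Q.mulVec s) =
      t + θ.Q.mulVec s := θ.mulVec_quot_add_rem _
    refine ⟨shiftMap (t + θ.Q.mulVec s) (θ.subst x₀), hsub fun b hb => ?_,
      Set.mem_biUnion (θ.rem (t + θ.Q.mulVec s)).2
      ⟨shiftMap (θ.quot (t + θ.Q.mulVec s)) x₀, θ.shiftSpace.shift_mem _ _ hx₀, ?_⟩⟩
    · have hb' : x b = shiftMap (t + θ.Q.mulVec s) (θ.subst x₀) b := by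
        rw [(ht b hb).2, Function.iterate_succ_apply']
        simp only [shiftMap, subst]
        rw [← add_assoc, quot_add_mulVec, rem_add_mulVec, hs]
        exact Finset.mem_image_of_mem _ (Finset.mem_image_of_mem _ hb)
      rw [← hb']
      exact (hu b hb).2
    · simp only
      rw [subst_shiftMap, shiftMap_shiftMap, add_comm, e]
  simp only [Z, Set.mem_iUnion, Set.mem_image] at hxZ
  obtain ⟨i, -, y, hy, rfl⟩ := hxZ
  exact ⟨y, hy, i, rfl⟩

theorem exists_eq_shiftMap_subst_iterate [Finite A] [Nonempty A] (hp : θ.IsPrimitive)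
    (h : θ.IsBlockWith ℓ a) (n : ℕ) {x : (Fin d → ℤ) → A} (hx : x ∈ θ.shiftSpace.carrier) :
    ∃ y ∈ θ.shiftSpace.carrier, ∃ t, x = shiftMap t (θ.subst^[n] y) := by
  induction n generalizing x with
  | zero => exact ⟨x, hx, 0, by simp⟩
  | succ n ih =>
    obtain ⟨y, hy, t, rfl⟩ := ih hx
    obtain ⟨z, hz, s, rfl⟩ := exists_eq_shiftMap_subst hp h hy
    refine ⟨z, hz, t + (θ.Q ^ n).mulVec s, ?_⟩
    rw [subst_iterate_shiftMap, shiftMap_shiftMap, Function.iterate_succ_apply]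

end DigitSubstitution

/-! ### Subgroups coprime with the range of an endomorphism -/

theorem AddSubgroup.sup_range_eq_top_iff {G : Type*} [AddCommGroup G] (f : G →+ G)
    (Λ : AddSubgroup G) : Λ ⊔ f.range = ⊤ ↔ ∀ x, ∃ y, x - f y ∈ Λ := by
  constructor
  · intro h x
    have hx : x ∈ Λ ⊔ f.range := h ▸ AddSubgroup.mem_top x
    obtain ⟨u, hu, _, ⟨y, rfl⟩, rfl⟩ := AddSubgroup.mem_sup.1 hx
    exact ⟨y, by simpa using hu⟩
  · intro h
    refine eq_top_iff.2 fun x _ => ?_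
    obtain ⟨y, hy⟩ := h x
    exact AddSubgroup.mem_sup.2 ⟨_, hy, _, ⟨y, rfl⟩, by abel⟩

section FiniteGroup

variable {G : Type*} [AddCommGroup G] [Finite G] {f : G →+ G} {P : AddSubgroup G}

/-- The image of P under 1 + f is again coprime with the range of f, so it contains P; having at
most as many elements, it equals P. Thus f = (1 + f) - 1 preserves P. -/
theorem map_mem_of_isLeast (hP : IsLeast {Λ : AddSubgroup G | Λ ⊔ f.range = ⊤} P)
    {x : G} (hx : x ∈ P) : f x ∈ P := by
  let φ : G →+ G := AddMonoidHom.id G + f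
  have h1 : P.map φ ∈ {Λ : AddSubgroup G | Λ ⊔ f.range = ⊤} := by
    rw [Set.mem_ofPred_eq, AddSubgroup.sup_range_eq_top_iff]
    intro x
    obtain ⟨y, hy⟩ := (AddSubgroup.sup_range_eq_top_iff f P).1 hP.1 x
    exact ⟨y - (x - f y), x - f y, hy, by simp [φ]; abel⟩
  have h2 : (P : Set G) ⊆ φ '' P := hP.2 h1
  have h3 : (P : Set G) = φ '' P :=
    Set.eq_of_subset_of_ncard_le h2 (Set.ncard_image_le (Set.toFinite _)) (Set.toFinite _)
  have h4 : φ x ∈ (P : Set G) := h3 ▸ Set.mem_image_of_mem φ hx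
  have h5 : f x = φ x - x := by simp [φ]
  rw [h5]
  exact P.sub_mem h4 hx

/-- Coprimality makes the map induced by f on the finite group G/P surjective, hence injective. -/
theorem mem_of_map_mem_of_isLeast (hP : IsLeast {Λ : AddSubgroup G | Λ ⊔ f.range = ⊤} P)
    {x : G} (hx : f x ∈ P) : x ∈ P := by
  let g : G ⧸ P →+ G ⧸ P := QuotientAddGroup.map P P f fun _ h => map_mem_of_isLeast hP h
  have hs : Function.Surjective g := by
    intro y
    obtain ⟨y, rfl⟩ := QuotientAddGroup.mk_surjective y
    obtain ⟨z, hz⟩ := (AddSubgroup.sup_range_eq_top_iff f P).1 hP.1 y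
    refine ⟨z, ?_⟩
    change ((f z : G) : G ⧸ P) = y
    rw [QuotientAddGroup.eq]
    rwa [neg_add_eq_sub]
  have hi : Function.Injective g := Finite.injective_iff_surjective.2 hs
  have h0 : g x = 0 := by
    change ((f x : G) : G ⧸ P) = 0
    exact (QuotientAddGroup.eq_zero_iff _).2 hx
  exact (QuotientAddGroup.eq_zero_iff _).1 (hi (h0.trans (map_zero g).symm))

/-- By Fitting's lemma ker f^n + range f^n = G for large n. The kernel is then coprime with the
range of f, so it contains P. -/
theorem exists_iterate_eq_zero_of_isLeast
    (hP : IsLeast {Λ : AddSubgroup G | Λ ⊔ f.range = ⊤} P) : ∃ N, ∀ x ∈ P, f^[N] x = 0 := by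
  obtain ⟨N, hN⟩ := (LinearMap.eventually_codisjoint_ker_pow_range_pow
    (R := ℤ) f.toIntLinearMap).exists_forall_of_atTop
  have h1 := hN (N + 1) (by omega)
  have hpow : ∀ n x, (f.toIntLinearMap ^ n) x = f^[n] x := fun n x => by
    rw [Module.End.pow_apply]; rfl
  refine ⟨N + 1, fun x hx => ?_⟩
  have h2 : (LinearMap.ker (f.toIntLinearMap ^ (N + 1))).toAddSubgroup ∈
      {Λ : AddSubgroup G | Λ ⊔ f.range = ⊤} := by
    rw [Set.mem_ofPred_eq, AddSubgroup.sup_range_eq_top_iff]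
    intro x
    have hx : x ∈ LinearMap.ker (f.toIntLinearMap ^ (N + 1)) ⊔
        LinearMap.range (f.toIntLinearMap ^ (N + 1)) := by
      rw [codisjoint_iff.1 h1]; trivial
    obtain ⟨u, hu, _, ⟨y, rfl⟩, rfl⟩ := Submodule.mem_sup.1 hx
    refine ⟨f^[N] y, ?_⟩
    rw [hpow, Function.iterate_succ_apply', add_sub_cancel_right]
    exact hu
  have h3 := hP.2 h2 hx
  rw [← hpow]
  exact h3

end FiniteGroup

section Lattice

variable {G : Type*} [AddCommGroup G] {f : G →+ G} {R Γ : AddSubgroup G}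

/-- Minimality passes to G/R, so that the lemmas on finite groups apply as soon as R has finite
index. -/
theorem isLeast_map_mk (hR : R ≤ R.comap f)
    (hΓ : IsLeast {Λ : AddSubgroup G | R ≤ Λ ∧ Λ ⊔ f.range = ⊤} Γ) :
    IsLeast {Λ : AddSubgroup (G ⧸ R) | Λ ⊔ (QuotientAddGroup.map R R f hR).range = ⊤}
      (Γ.map (QuotientAddGroup.mk' R)) := by
  constructor
  · rw [Set.mem_ofPred_eq, AddSubgroup.sup_range_eq_top_iff]
    intro x
    obtain ⟨x, rfl⟩ := QuotientAddGroup.mk_surjective x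
    obtain ⟨y, hy⟩ := (AddSubgroup.sup_range_eq_top_iff f Γ).1 hΓ.1.2 x
    exact ⟨y, x - f y, hy, by simp⟩
  · intro Λ hΛ
    rw [AddSubgroup.map_le_iff_le_comap]
    refine hΓ.2 ⟨?_, ?_⟩
    · intro x hx
      rw [AddSubgroup.mem_comap, QuotientAddGroup.mk'_apply, (QuotientAddGroup.eq_zero_iff x).2 hx]
      exact Λ.zero_mem
    · rw [AddSubgroup.sup_range_eq_top_iff]
      intro x
      obtain ⟨y, hy⟩ := (AddSubgroup.sup_range_eq_top_iff _ Λ).1 hΛ x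
      obtain ⟨y, rfl⟩ := QuotientAddGroup.mk_surjective y
      exact ⟨y, by simpa using hy⟩

theorem mem_map_mk_iff (h : R ≤ Γ) {x : G} :
    (x : G ⧸ R) ∈ Γ.map (QuotientAddGroup.mk' R) ↔ x ∈ Γ := by
  constructor
  · rintro ⟨y, hy, e⟩
    rw [QuotientAddGroup.mk'_apply, QuotientAddGroup.eq] at e
    have := Γ.add_mem hy (h e)
    rwa [add_neg_cancel_left] at this
  · exact fun hx => ⟨x, hx, rfl⟩

theorem map_mem_iff_of_isLeast [Finite (G ⧸ R)] (hR : R ≤ R.comap f)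
    (hΓ : IsLeast {Λ : AddSubgroup G | R ≤ Λ ∧ Λ ⊔ f.range = ⊤} Γ) {x : G} :
    f x ∈ Γ ↔ x ∈ Γ := by
  rw [← mem_map_mk_iff hΓ.1.1, ← mem_map_mk_iff (x := x) hΓ.1.1]
  exact ⟨fun h => mem_of_map_mem_of_isLeast (isLeast_map_mk hR hΓ) (x := x) h,
    fun h => map_mem_of_isLeast (isLeast_map_mk hR hΓ) h⟩

theorem exists_iterate_mem_of_isLeast [Finite (G ⧸ R)] (hR : R ≤ R.comap f)
    (hΓ : IsLeast {Λ : AddSubgroup G | R ≤ Λ ∧ Λ ⊔ f.range = ⊤} Γ) :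
    ∃ N, ∀ x ∈ Γ, f^[N] x ∈ R := by
  obtain ⟨N, hN⟩ := exists_iterate_eq_zero_of_isLeast (isLeast_map_mk hR hΓ)
  refine ⟨N, fun x hx => ?_⟩
  have h := hN x ((mem_map_mk_iff hΓ.1.1).2 hx)
  have e : ∀ n, (QuotientAddGroup.map R R f hR)^[n] (x : G ⧸ R) = (f^[n] x : G) := by
    intro n
    induction n with
    | zero => rfl
    | succ n ih => rw [Function.iterate_succ_apply', ih, Function.iterate_succ_apply']; rfl
  rw [e] at h
  exact (QuotientAddGroup.eq_zero_iff _).1 h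

end Lattice

namespace DigitSubstitution

/-- Multiplication by the inflation matrix. -/
def QHom {d : ℕ} {A : Type*} (θ : DigitSubstitution d A) : (Fin d → ℤ) →+ (Fin d → ℤ) :=
  θ.Q.mulVecLin.toAddMonoidHom

@[simp] theorem QHom_apply {d : ℕ} {A : Type*} (θ : DigitSubstitution d A) (v : Fin d → ℤ) :
    θ.QHom v = θ.Q.mulVec v := rfl

theorem QHom_iterate {d : ℕ} {A : Type*} (θ : DigitSubstitution d A) (n : ℕ) (v : Fin d → ℤ) :
    θ.QHom^[n] v = (θ.Q ^ n).mulVec v := by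
  induction n with
  | zero => simp
  | succ n ih => rw [Function.iterate_succ_apply', ih, pow_succ_mulVec, QHom_apply]

variable {d : ℕ} {A : Type*} {θ : DigitSubstitution d A} {ℓ a : Fin d → ℤ}
  [TopologicalSpace A] [DiscreteTopology A] {Γ : AddSubgroup (Fin d → ℤ)}

/-! ### The return module and the height lattice -/

theorem exists_letter (hp : θ.IsPrimitive) (h : θ.IsBlockWith ℓ a) {x : (Fin d → ℤ) → A}
    (hx : x ∈ θ.shiftSpace.carrier) (b : A) : ∃ k, x k = b := by
  obtain ⟨r, hr⟩ := (isLegal_singleton hp b).exists_occurrence hp h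
  obtain ⟨s, hs, -⟩ := hr x hx 0
  exact ⟨s, by simpa using (hs 0 (by simp)).symm⟩

/-- Equal letters of x at displacement j produce equal supertiles of θ(x) at displacement Qj, so Q
maps return times to return times. -/
theorem returnModule_le_comap (θ : DigitSubstitution d A) :
    θ.shiftSpace.returnModule ≤ θ.shiftSpace.returnModule.comap θ.QHom := by
  refine (AddSubgroup.closure_le _).2 ?_
  rintro j ⟨x, k, hk⟩
  refine AddSubgroup.subset_closure ⟨⟨_, subst_mem x.2⟩, θ.Q.mulVec (k - θ.quot 0), ?_⟩
  have hq : θ.quot (θ.Q.mulVec (k - θ.quot 0)) = k := by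
    rw [← zero_add (θ.Q.mulVec _), quot_add_mulVec]; abel
  have h1 := θ.subst_iterate_congr_add 1 (x := x.1) (y := x.1)
    (n := θ.Q.mulVec (k - θ.quot 0)) (m := j)
  simp only [Function.iterate_one, pow_one, hq] at h1
  rw [add_comm]
  exact h1 (by rw [add_comm k, hk])

theorem mem_returnModule {x : (Fin d → ℤ) → A} (hx : x ∈ θ.shiftSpace.carrier)
    {j k : Fin d → ℤ} (h : x j = x k) : j - k ∈ θ.shiftSpace.returnModule :=
  AddSubgroup.subset_closure ⟨⟨x, hx⟩, k, by simpa using h⟩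

/-- In a fixed x the letter x 0 recurs near every position, and all its positions lie in the return
module, so a finite box meets every class. -/
theorem finite_quotient_returnModule [Finite A] [Nonempty A] (hp : θ.IsPrimitive)
    (h : θ.IsBlockWith ℓ a) : Finite ((Fin d → ℤ) ⧸ θ.shiftSpace.returnModule) := by
  obtain ⟨x, hx⟩ := h.shiftSpace_nonempty (A := A)
  obtain ⟨r, hr⟩ := (isLegal_singleton hp (x 0)).exists_occurrence hp h
  refine Finite.of_surjective (fun z : latticeBox d r =>
    ((-z.1 : Fin d → ℤ) : (Fin d → ℤ) ⧸ θ.shiftSpace.returnModule)) fun y => ?_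
  obtain ⟨n, rfl⟩ := QuotientAddGroup.mk_surjective y
  obtain ⟨s, hs, hs'⟩ := hr x hx n
  have h1 := hs 0 (by simp)
  have h2 := hs' 0 (by simp)
  simp only [Pi.zero_apply, zero_add] at h1 h2
  refine ⟨⟨s - n, mem_latticeBox.2 h2⟩, ?_⟩
  rw [QuotientAddGroup.eq]
  have := mem_returnModule hx h1.symm
  simpa using this

theorem IsHeightLattice.isLeast (hΓ : θ.IsHeightLattice Γ) :
    IsLeast {Λ : AddSubgroup (Fin d → ℤ) | θ.shiftSpace.returnModule ≤ Λ ∧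
      Λ ⊔ θ.QHom.range = ⊤} Γ := hΓ

theorem IsHeightLattice.mulVec_mem_iff [Finite A] [Nonempty A] (hΓ : θ.IsHeightLattice Γ)
    (hp : θ.IsPrimitive) (h : θ.IsBlockWith ℓ a) {v : Fin d → ℤ} :
    θ.Q.mulVec v ∈ Γ ↔ v ∈ Γ := by
  have := finite_quotient_returnModule hp h
  exact map_mem_iff_of_isLeast θ.returnModule_le_comap hΓ.isLeast

theorem IsHeightLattice.pow_mulVec_mem_iff [Finite A] [Nonempty A] (hΓ : θ.IsHeightLattice Γ)
    (hp : θ.IsPrimitive) (h : θ.IsBlockWith ℓ a) (n : ℕ) {v : Fin d → ℤ} :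
    (θ.Q ^ n).mulVec v ∈ Γ ↔ v ∈ Γ := by
  induction n with
  | zero => simp
  | succ n ih => rw [pow_succ_mulVec, hΓ.mulVec_mem_iff hp h, ih]

theorem IsHeightLattice.exists_pow_mulVec_mem [Finite A] [Nonempty A]
    (hΓ : θ.IsHeightLattice Γ) (hp : θ.IsPrimitive) (h : θ.IsBlockWith ℓ a) :
    ∃ N, ∀ v ∈ Γ, (θ.Q ^ N).mulVec v ∈ θ.shiftSpace.returnModule := by
  have := finite_quotient_returnModule hp h
  obtain ⟨N, hN⟩ := exists_iterate_mem_of_isLeast θ.returnModule_le_comap hΓ.isLeast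
  exact ⟨N, fun v hv => by rw [← QHom_iterate]; exact hN v hv⟩

theorem IsHeightLattice.finite_quotient [Finite A] [Nonempty A] (hΓ : θ.IsHeightLattice Γ)
    (hp : θ.IsPrimitive) (h : θ.IsBlockWith ℓ a) : Finite ((Fin d → ℤ) ⧸ Γ) := by
  have := finite_quotient_returnModule hp h
  refine Finite.of_surjective (QuotientAddGroup.map θ.shiftSpace.returnModule Γ
    (AddMonoidHom.id _) hΓ.1.1) fun y => ?_
  obtain ⟨n, rfl⟩ := QuotientAddGroup.mk_surjective y
  exact ⟨n, rfl⟩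

/-! ### The class of a configuration modulo the height lattice -/

/-- `τ` assigns classes modulo `Γ` to the letters in such a way that the positions at which a
letter occurs in a configuration lie in one class, and `x₀` has class `0`. -/
structure IsClassMap (θ : DigitSubstitution d A) (Γ : AddSubgroup (Fin d → ℤ))
    (τ : A → (Fin d → ℤ) ⧸ Γ) (x₀ : (Fin d → ℤ) → A) : Prop where
  mem : x₀ ∈ θ.shiftSpace.carrier
  zero : τ (x₀ 0) = 0
  apply : ∀ x ∈ θ.shiftSpace.carrier, ∀ m : Fin d → ℤ, τ (x m) = τ (x 0) + (m : (Fin d → ℤ) ⧸ Γ)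

/-- The class of a letter is the position of any of its occurrences in a fixed x₀. For another x,
the pattern on {0, m} occurs in x₀ and the classes can be compared there. -/
theorem exists_isClassMap [Finite A] [Nonempty A] (hp : θ.IsPrimitive) (h : θ.IsBlockWith ℓ a)
    (hΓ : θ.shiftSpace.returnModule ≤ Γ) : ∃ τ x₀, θ.IsClassMap Γ τ x₀ := by
  classical
  obtain ⟨x₀, hx₀⟩ := h.shiftSpace_nonempty (A := A)
  choose k hk using exists_letter hp h hx₀
  have key : ∀ m, ((k (x₀ m) : Fin d → ℤ) : (Fin d → ℤ) ⧸ Γ) = m := fun m => by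
    rw [QuotientAddGroup.eq, neg_add_eq_sub]
    exact hΓ (mem_returnModule hx₀ (hk (x₀ m)).symm)
  refine ⟨fun b => k b, x₀, hx₀, by simp only [key]; rfl, fun x hx m => ?_⟩
  obtain ⟨_, hr⟩ := (hx {0, m}).exists_occurrence hp h
  obtain ⟨s, hs, -⟩ := hr x₀ hx₀ 0
  have h0 := hs 0 (by simp)
  have hm := hs m (by simp)
  rw [h0, hm, key, key, zero_add, add_comm m s]
  rfl

theorem IsClassMap.shiftMap {τ : A → (Fin d → ℤ) ⧸ Γ} {x₀ : (Fin d → ℤ) → A}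
    (hτ : θ.IsClassMap Γ τ x₀) {x : (Fin d → ℤ) → A} (hx : x ∈ θ.shiftSpace.carrier)
    (m : Fin d → ℤ) : τ (shiftMap m x 0) = τ (x 0) + (m : (Fin d → ℤ) ⧸ Γ) := by
  rw [← hτ.apply x hx]
  simp [_root_.shiftMap]

/-- The letter of x at c, the level-n quotient of 0, also occurs in x₀ at some k ≡ m + c. Hence the
letter of θ^n(x) at 0 occurs in θ^n(x₀) at Q^n(k - c), so the offset s can be read off θ^n(x₀). -/
theorem IsClassMap.exists_subst {τ : A → (Fin d → ℤ) ⧸ Γ} {x₀ : (Fin d → ℤ) → A}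
    (hτ : θ.IsClassMap Γ τ x₀) (hp : θ.IsPrimitive) (h : θ.IsBlockWith ℓ a)
    (n : ℕ) (hΓ : ∀ v ∈ Γ, (θ.Q ^ n).mulVec v ∈ Γ) :
    ∃ s : Fin d → ℤ, ∀ x ∈ θ.shiftSpace.carrier, ∀ m : Fin d → ℤ, τ (x 0) = m →
      τ (θ.subst^[n] x 0) = ((θ.Q ^ n).mulVec m + s : Fin d → ℤ) := by
  obtain ⟨s, hs⟩ := QuotientAddGroup.mk_surjective (τ (θ.subst^[n] x₀ 0))
  refine ⟨s, fun x hx m hm => ?_⟩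
  set c := θ.quot^[n] 0 with hc
  obtain ⟨k, hk⟩ := exists_letter hp h hτ.mem (x c)
  have h1 : θ.subst^[n] x₀ (0 + (θ.Q ^ n).mulVec (k - c)) = θ.subst^[n] x 0 := by
    apply subst_iterate_congr_add
    rw [← hc, ← hk]; congr 1; abel
  rw [← h1, hτ.apply _ (subst_iterate_mem hτ.mem n), ← hs, ← QuotientAddGroup.mk_add,
    QuotientAddGroup.eq]
  have h2 : ((k : Fin d → ℤ) : (Fin d → ℤ) ⧸ Γ) = (m + c : Fin d → ℤ) := by
    have e1 := hτ.apply _ hτ.mem k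
    rw [hk, hτ.apply x hx, hτ.zero, zero_add, hm] at e1
    exact e1.symm
  rw [QuotientAddGroup.eq] at h2
  have h3 := hΓ _ h2
  rw [zero_add]
  have e : -(s + (θ.Q ^ n).mulVec (k - c)) + ((θ.Q ^ n).mulVec m + s) =
      (θ.Q ^ n).mulVec (-k + (m + c)) := by
    simp only [Matrix.mulVec_add, Matrix.mulVec_sub, Matrix.mulVec_neg]; abel
  rwa [e]

end DigitSubstitution

/-! ### Uniform recurrence -/

/-- Only the pattern on B matters and there are finitely many of these, so bounds for single
configurations have a common maximum. -/
theorem exists_forall_mem_of_eqOn {G A : Type*} [Finite A] {X : Set (G → A)} (B : Finset G)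
    {p : (G → A) → ℕ → Prop} (hmono : ∀ x m n, m ≤ n → p x m → p x n)
    (hcongr : ∀ x y, (∀ b ∈ B, x b = y b) → ∀ n, p x n → p y n)
    (h : ∀ x ∈ X, ∃ n, p x n) : ∃ n, ∀ x ∈ X, p x n := by
  have h1 : ∀ f : B → A, ∃ n, ∀ x ∈ X, (fun b : B => x b) = f → p x n := by
    intro f
    by_cases hf : ∃ x ∈ X, (fun b : B => x b) = f
    · obtain ⟨x, hx, rfl⟩ := hf
      obtain ⟨n, hn⟩ := h x hx
      exact ⟨n, fun y _ hy => hcongr x y (fun b hb => (congrFun hy ⟨b, hb⟩).symm) n hn⟩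
    · exact ⟨0, fun y hy e => (hf ⟨y, hy, e⟩).elim⟩
  choose N hN using h1
  obtain ⟨n, hn⟩ := (Set.finite_range N).bddAbove
  exact ⟨n, fun x hx => hmono x _ _ (hn ⟨_, rfl⟩) (hN _ x hx rfl)⟩

namespace DigitSubstitution

variable {d : ℕ} {A : Type*} {θ : DigitSubstitution d A} {ℓ a : Fin d → ℤ}
  [TopologicalSpace A] [DiscreteTopology A] {Γ : AddSubgroup (Fin d → ℤ)}

/-- All patterns with support `B` occur in all supertiles of sufficiently high level. -/
theorem exists_forall_mem_supertile [Finite A] (hp : θ.IsPrimitive) (B : Finset (Fin d → ℤ)) :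
    ∃ K : ℕ, ∀ x ∈ θ.shiftSpace.carrier, ∀ n ≥ K, ∀ c : A, ∃ t, ∀ b ∈ B,
      θ.quot^[n] (b + t) = 0 ∧ x b = θ.subst^[n] (fun _ => c) (b + t) := by
  refine exists_forall_mem_of_eqOn B (fun x m n hmn hx l hl => hx l (hmn.trans hl)) ?_
    fun x hx => (hx B).eventually hp
  intro x y e n hx l hl c
  obtain ⟨t, ht⟩ := hx l hl c
  exact ⟨t, fun b hb => ⟨(ht b hb).1, (e b hb) ▸ (ht b hb).2⟩⟩

/-- All patterns with support `B` occur in all configurations with uniformly bounded gaps. -/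
theorem exists_forall_occurrence [Finite A] (hp : θ.IsPrimitive) (h : θ.IsBlockWith ℓ a)
    (B : Finset (Fin d → ℤ)) :
    ∃ r : ℕ, ∀ y ∈ θ.shiftSpace.carrier, ∀ x ∈ θ.shiftSpace.carrier, ∀ n : Fin d → ℤ,
      ∃ s : Fin d → ℤ, (∀ b ∈ B, y b = x (b + s)) ∧ ∀ b ∈ B, ∀ i, |b i + s i - n i| ≤ r := by
  refine exists_forall_mem_of_eqOn B ?_ ?_ ?_
  · intro y m n hmn hy x hx k
    obtain ⟨s, hs, hs'⟩ := hy x hx k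
    exact ⟨s, hs, fun b hb i => (hs' b hb i).trans (by exact_mod_cast hmn)⟩
  · intro x y e n hy z hz k
    obtain ⟨s, hs, hs'⟩ := hy z hz k
    exact ⟨s, fun b hb => (e b hb).symm.trans (hs b hb), hs'⟩
  · intro y hy
    obtain ⟨r, hr⟩ := (hy B).exists_occurrence hp h
    refine ⟨r.toNat, fun x hx n => ?_⟩
    obtain ⟨s, hs, hs'⟩ := hr x hx n
    exact ⟨s, hs, fun b hb i => (hs' b hb i).trans (Int.self_le_toNat r)⟩

/-- Orbits under `Γ` are dense in the set of configurations of the same class. -/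
theorem IsClassMap.mem_of_isClosed {τ : A → (Fin d → ℤ) ⧸ Γ} {x₀ : (Fin d → ℤ) → A}
    (hτ : θ.IsClassMap Γ τ x₀) (hp : θ.IsPrimitive) (h : θ.IsBlockWith ℓ a)
    {C : Set ((Fin d → ℤ) → A)} (hC : IsClosed C) {x z : (Fin d → ℤ) → A}
    (hx : x ∈ θ.shiftSpace.carrier) (hz : z ∈ θ.shiftSpace.carrier) (hxz : τ (x 0) = τ (z 0))
    (hxC : ∀ m ∈ Γ, _root_.shiftMap m x ∈ C) : z ∈ C := by
  classical
  rw [← hC.closure_eq, mem_closure_iff]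
  intro o ho hzo
  obtain ⟨B, u, hu, hsub⟩ := isOpen_pi_iff.1 ho z hzo
  -- Including 0 in the window makes the classes at 0 comparable, which forces the displacement s
  -- into Γ.
  obtain ⟨_, hr⟩ := (hz (insert 0 B)).exists_occurrence hp h
  obtain ⟨s, hs, -⟩ := hr x hx 0
  refine ⟨_root_.shiftMap s x, hsub fun b hb => ?_, hxC s ?_⟩
  · rw [_root_.shiftMap, ← hs b (Finset.mem_insert_of_mem hb)]
    exact (hu b hb).2
  · have h0 := hs 0 (Finset.mem_insert_self _ _)
    rw [zero_add] at h0
    rw [h0, hτ.apply x hx s, left_eq_add] at hxz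
    exact (QuotientAddGroup.eq_zero_iff s).1 hxz

/-- Minimality of `𝕏_θ`. -/
theorem mem_of_isClosed (hp : θ.IsPrimitive) (h : θ.IsBlockWith ℓ a)
    {C : Set ((Fin d → ℤ) → A)} (hC : IsClosed C) {x z : (Fin d → ℤ) → A}
    (hx : x ∈ θ.shiftSpace.carrier) (hz : z ∈ θ.shiftSpace.carrier)
    (hxC : ∀ m, _root_.shiftMap m x ∈ C) : z ∈ C := by
  have hτ : θ.IsClassMap ⊤ (fun _ => 0) x := ⟨hx, rfl, fun y _ m => by
    rw [(QuotientAddGroup.eq_zero_iff m).2 (AddSubgroup.mem_top m), add_zero]⟩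
  exact hτ.mem_of_isClosed hp h hC hx hz rfl fun m _ => hxC m

/-! ### The stabilizers of the sets of supertile configurations -/

/-- The set of z with θ^n(z) ∈ σ_t θ^n(X) is closed and contains the orbit of x, so by minimality
one coincidence suffices. -/
theorem exists_eq_shiftMap_of_eq [Finite A] (hp : θ.IsPrimitive) (h : θ.IsBlockWith ℓ a) {n : ℕ}
    {x y : (Fin d → ℤ) → A} (hx : x ∈ θ.shiftSpace.carrier) (hy : y ∈ θ.shiftSpace.carrier)
    {t : Fin d → ℤ} (e : θ.subst^[n] x = shiftMap t (θ.subst^[n] y))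
    {z : (Fin d → ℤ) → A} (hz : z ∈ θ.shiftSpace.carrier) :
    ∃ w ∈ θ.shiftSpace.carrier, θ.subst^[n] z = shiftMap t (θ.subst^[n] w) := by
  let C : Set ((Fin d → ℤ) → A) := θ.subst^[n] ⁻¹'
    ((fun w => shiftMap t (θ.subst^[n] w)) '' θ.shiftSpace.carrier)
  have hC : IsClosed C := by
    refine IsClosed.preimage (θ.continuous_subst_iterate n) (IsCompact.isClosed ?_)
    exact θ.shiftSpace.isClosed_carrier.isCompact.image
      ((continuous_shiftMap t).comp (θ.continuous_subst_iterate n))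
  obtain ⟨w, hw, e'⟩ : z ∈ C := mem_of_isClosed hp h hC hx hz fun m => by
    refine ⟨shiftMap m y, θ.shiftSpace.shift_mem m y hy, ?_⟩
    simp only
    rw [subst_iterate_shiftMap, subst_iterate_shiftMap, e, shiftMap_shiftMap, shiftMap_shiftMap,
      add_comm]
  exact ⟨w, hw, e'.symm⟩

/-- The group of all `t` such that `σ_t` maps `θ^n(𝕏_θ)` onto itself. -/
def supertileGroup (θ : DigitSubstitution d A) (n : ℕ) : AddSubgroup (Fin d → ℤ) where
  carrier := {t | (∀ x ∈ θ.shiftSpace.carrier, ∃ y ∈ θ.shiftSpace.carrier,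
      θ.subst^[n] x = shiftMap t (θ.subst^[n] y)) ∧
    ∀ x ∈ θ.shiftSpace.carrier, ∃ y ∈ θ.shiftSpace.carrier,
      θ.subst^[n] x = shiftMap (-t) (θ.subst^[n] y)}
  zero_mem' := ⟨fun x hx => ⟨x, hx, by simp⟩, fun x hx => ⟨x, hx, by simp⟩⟩
  add_mem' := by
    rintro s t ⟨hs, hs'⟩ ⟨ht, ht'⟩
    refine ⟨fun x hx => ?_, fun x hx => ?_⟩
    · obtain ⟨y, hy, e⟩ := hs x hx
      obtain ⟨z, hz, e'⟩ := ht y hy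
      exact ⟨z, hz, by rw [e, e', shiftMap_shiftMap]⟩
    · obtain ⟨y, hy, e⟩ := hs' x hx
      obtain ⟨z, hz, e'⟩ := ht' y hy
      exact ⟨z, hz, by rw [e, e', shiftMap_shiftMap, neg_add]⟩
  neg_mem' := by
    rintro s ⟨hs, hs'⟩
    exact ⟨hs', by rwa [neg_neg]⟩

theorem mem_supertileGroup [Finite A] (hp : θ.IsPrimitive) (h : θ.IsBlockWith ℓ a) {n : ℕ}
    {x y : (Fin d → ℤ) → A} (hx : x ∈ θ.shiftSpace.carrier) (hy : y ∈ θ.shiftSpace.carrier)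
    {t : Fin d → ℤ} (e : θ.subst^[n] x = shiftMap t (θ.subst^[n] y)) :
    t ∈ θ.supertileGroup n := by
  refine ⟨fun z hz => exists_eq_shiftMap_of_eq hp h hx hy e hz, fun z hz =>
    exists_eq_shiftMap_of_eq hp h hy hx ?_ hz⟩
  rw [e, shiftMap_shiftMap, neg_add_cancel, shiftMap_zero]

theorem pow_mulVec_mem_supertileGroup (θ : DigitSubstitution d A) (n : ℕ) (v : Fin d → ℤ) :
    (θ.Q ^ n).mulVec v ∈ θ.supertileGroup n := by
  refine ⟨fun x hx => ⟨_, θ.shiftSpace.shift_mem (-v) x hx, ?_⟩,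
    fun x hx => ⟨_, θ.shiftSpace.shift_mem v x hx, ?_⟩⟩ <;>
  simp [subst_iterate_shiftMap, shiftMap_shiftMap, Matrix.mulVec_neg]

theorem mulVec_mem_supertileGroup [Finite A] [Nonempty A] (hp : θ.IsPrimitive)
    (h : θ.IsBlockWith ℓ a) {n : ℕ} {t : Fin d → ℤ} (ht : t ∈ θ.supertileGroup n) :
    θ.Q.mulVec t ∈ θ.supertileGroup (n + 1) := by
  obtain ⟨x, hx⟩ := h.shiftSpace_nonempty (A := A)
  obtain ⟨y, hy, e⟩ := ht.1 x hx
  refine mem_supertileGroup hp h hx hy ?_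
  rw [Function.iterate_succ_apply', e, subst_shiftMap, Function.iterate_succ_apply']

/-- If `t` stabilizes `θ^n(𝕏_θ)`, then a small multiple of `t` is a period of a supertile. -/
theorem exists_period_of_mem_supertileGroup [Finite A] {n : ℕ} {t : Fin d → ℤ}
    (ht : t ∈ θ.supertileGroup n) {x : (Fin d → ℤ) → A} (hx : x ∈ θ.shiftSpace.carrier) :
    ∃ s : ℕ, 0 < s ∧ s ≤ Nat.card A ∧ ∃ c : A, ∀ j : Fin d → ℤ, θ.quot^[n] j = 0 →
      θ.quot^[n] (j + s • t) = 0 →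
        θ.subst^[n] (fun _ => c) j = θ.subst^[n] (fun _ => c) (j + s • t) := by
  choose f hf using ht.1
  -- The sequence starts with x and satisfies θ^n(y_k) = σ_t θ^n(y_(k+1)).
  let y : ℕ → θ.shiftSpace.carrier := fun k => k.rec ⟨x, hx⟩ fun _ z => ⟨f z.1 z.2, (hf z.1 z.2).1⟩
  have hy : ∀ k, θ.subst^[n] (y k).1 = shiftMap t (θ.subst^[n] (y (k + 1)).1) :=
    fun k => (hf (y k).1 (y k).2).2
  have hy' : ∀ k s, θ.subst^[n] (y k).1 = shiftMap (s • t) (θ.subst^[n] (y (k + s)).1) := by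
    intro k s
    induction s with
    | zero => simp
    | succ s ih => rw [ih, hy, shiftMap_shiftMap, succ_nsmul, add_assoc]
  have := Fintype.ofFinite A
  -- Two of the |A| + 1 configurations y_0, …, y_|A| have the same letter at 0, so their level-n
  -- supertiles there agree, and (l - k)t is a period.
  obtain ⟨k, l, hkl, e⟩ : ∃ k l : Fin (Nat.card A + 1), k < l ∧ (y k).1 0 = (y l).1 0 := by
    obtain ⟨k, l, hne, e⟩ := Fintype.exists_ne_map_eq_of_card_lt
      (fun k : Fin (Nat.card A + 1) => (y k).1 0) (by simp)
    rcases lt_or_gt_of_ne hne with hlt | hlt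
    · exact ⟨k, l, hlt, e⟩
    · exact ⟨l, k, hlt, e.symm⟩
  have hkl' : (k : ℕ) < l := hkl
  refine ⟨l - k, by omega, by omega, (y k).1 0, fun j hj hj' => ?_⟩
  have e1 := hy' k (l - k)
  rw [Nat.add_sub_cancel' hkl'.le] at e1
  have e2 := congrFun e1 j
  rw [θ.subst_iterate_congr n (x := fun _ => (y k).1 0) (y := (y k).1) (by rw [hj]), e2, shiftMap]
  exact θ.subst_iterate_congr n (by rw [hj', e])

/-- Short stabilizing vectors contradict aperiodicity. -/
theorem exists_eq_zero_of_mem_supertileGroup [Finite A] [Nonempty A] (hp : θ.IsPrimitive)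
    (h : θ.IsBlockWith ℓ a) (haper : θ.shiftSpace.IsAperiodic) :
    ∃ m₀ : ℕ, ∀ m : ℕ, ∀ t ∈ θ.supertileGroup (m₀ + m),
      (∀ i, Nat.card A * |t i| ≤ |ℓ i| ^ m) → t = 0 := by
  -- With this m₀ every θ^(m₀)(c) contains all patterns of side 3, so θ^(m₀+m)(c) contains all
  -- blocks of neighbouring level-m supertiles. A displacement u with |u i| ≤ |ℓ i|^m stays within
  -- such a block, so a period u of θ^(m₀+m)(c) is a period of x.
  obtain ⟨m₀, hm₀⟩ := exists_forall_mem_supertile hp (latticeBox d 1)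
  refine ⟨m₀, fun m t ht hsmall => ?_⟩
  obtain ⟨x, hx⟩ := h.shiftSpace_nonempty (A := A)
  obtain ⟨s, hs0, hs, c, hc⟩ := exists_period_of_mem_supertileGroup ht hx
  set u := s • t with hu
  have hu' : ∀ i, |u i| ≤ |ℓ i| ^ m := fun i => by
    refine le_trans ?_ (hsmall i)
    rw [hu, Pi.smul_apply, nsmul_eq_mul, abs_mul, Nat.abs_cast]
    exact mul_le_mul_of_nonneg_right (by exact_mod_cast hs) (abs_nonneg _)
  have hper : shiftMap u x = x := by
    funext z
    obtain ⟨w, hw, r, rfl⟩ := exists_eq_shiftMap_subst_iterate hp h m hx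
    obtain ⟨k', hk'⟩ := hm₀ _ (θ.shiftSpace.shift_mem (θ.quot^[m] (z + r)) w hw) m₀ le_rfl c
    set k := θ.quot^[m] (z + r) with hk
    have key : ∀ z' e, e ∈ latticeBox d 1 → θ.quot^[m] z' = k + e →
        θ.quot^[m₀ + m] (z' + (θ.Q ^ m).mulVec (k' - k)) = 0 ∧
        θ.subst^[m] w z' =
          θ.subst^[m₀ + m] (fun _ => c) (z' + (θ.Q ^ m).mulVec (k' - k)) := by
      intro z' e he hz'
      obtain ⟨h1, h2⟩ := hk' e he
      have h3 : k + e + (k' - k) = e + k' := by abel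
      constructor
      · rw [Function.iterate_add_apply, quot_iterate_add, hz', h3, h1]
      · rw [add_comm m₀, Function.iterate_add_apply]
        symm
        apply subst_iterate_congr_add
        rw [hz', h3, ← h2, shiftMap, add_comm]
    obtain ⟨h1, h2⟩ := key (z + r) 0 (mem_latticeBox.2 (by simp)) (by simp [hk])
    obtain ⟨h3, h4⟩ := key (z + u + r) (θ.quot^[m] (z + u + r) - k)
      (mem_latticeBox.2 fun i => h.abs_quot_sub_le m (by
        have : (z + u + r) i - (z + r) i = u i := by simp only [Pi.add_apply]; ring
        rw [this]; exact hu' i)) (by abel)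
    have e : z + u + r + (θ.Q ^ m).mulVec (k' - k) = z + r + (θ.Q ^ m).mulVec (k' - k) + u := by
      abel
    rw [e] at h3 h4
    simp only [shiftMap]
    rw [h2, h4]
    exact (hc _ h1 h3).symm
  have hu0 : u = 0 := haper ⟨x, hx⟩ u (Subtype.ext hper)
  rw [hu] at hu0
  exact (smul_eq_zero.1 hu0).resolve_left hs0.ne'

/-- Modulo Q^n, with n = m₀ + m, the stabilizer is represented in a box with sides |ℓ i|^n. Cut this
box into cells with sides |ℓ i|^m / |A|: two representatives in one cell coincide by
`exists_eq_zero_of_mem_supertileGroup`, and the number of cells is bounded independently of n. -/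
theorem exists_relIndex_supertileGroup_le [Finite A] [Nonempty A] (hp : θ.IsPrimitive)
    (h : θ.IsBlockWith ℓ a) (haper : θ.shiftSpace.IsAperiodic) :
    ∃ m₀ C : ℕ, ∀ n ≥ m₀, (columnLattice (θ.Q ^ n)).relIndex (θ.supertileGroup n) ≠ 0 ∧
      (columnLattice (θ.Q ^ n)).relIndex (θ.supertileGroup n) ≤ C := by
  obtain ⟨m₀, hm₀⟩ := exists_eq_zero_of_mem_supertileGroup hp h haper
  let N : ℤ := Nat.card A
  let S : Finset (Fin d → ℤ) := Finset.Icc 0 fun i => N * |ℓ i| ^ m₀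
  refine ⟨m₀, Nat.card S, fun n hn => ?_⟩
  obtain ⟨m, rfl⟩ := Nat.exists_eq_add_of_le hn
  have hN : 0 < N := Nat.cast_pos.2 Nat.card_pos
  have hpos : ∀ i k, 0 < |ℓ i| ^ k := fun i k => pow_pos (by linarith [h.two_le i]) k
  obtain ⟨s, hs⟩ := h.exists_box (m₀ + m)
  let red : (Fin d → ℤ) → Fin d → ℤ := fun t =>
    t - (θ.Q ^ (m₀ + m)).mulVec (θ.quot^[m₀ + m] t)
  have hred : ∀ t i, s i ≤ red t i ∧ red t i < s i + |ℓ i| ^ (m₀ + m) := by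
    intro t
    rw [← hs]
    simp only [red]
    rw [sub_eq_add_neg, ← Matrix.mulVec_neg, quot_iterate_add]
    abel
  let g : (Fin d → ℤ) → Fin d → ℤ := fun t i => ((red t i - s i) * N) / |ℓ i| ^ m
  have hgS : ∀ t, g t ∈ S := by
    intro t
    refine Finset.mem_Icc.2 ⟨fun i => ?_, fun i => ?_⟩
    · exact Int.ediv_nonneg (mul_nonneg (by linarith [(hred t i).1]) hN.le) (hpos i m).le
    · apply Int.le_of_lt_add_one
      refine Int.ediv_lt_of_lt_mul (hpos i m) ?_
      have h1 := (hred t i).2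
      rw [pow_add] at h1
      have h2 := hpos i m
      nlinarith
  have hg : ∀ t ∈ θ.supertileGroup (m₀ + m), ∀ t' ∈ θ.supertileGroup (m₀ + m), g t = g t' →
      -t + t' ∈ columnLattice (θ.Q ^ (m₀ + m)) := by
    intro t ht t' ht' e
    have h1 : red t - red t' = 0 := by
      refine hm₀ m _ (AddSubgroup.sub_mem _
        (AddSubgroup.sub_mem _ ht (θ.pow_mulVec_mem_supertileGroup _ _))
        (AddSubgroup.sub_mem _ ht' (θ.pow_mulVec_mem_supertileGroup _ _))) fun i => ?_
      have h2 := congrFun e i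
      simp only [g] at h2
      have h3 := Int.ediv_mul_le ((red t i - s i) * N) (hpos i m).ne'
      have h4 := Int.lt_ediv_add_one_mul_self ((red t i - s i) * N) (hpos i m)
      have h5 := Int.ediv_mul_le ((red t' i - s i) * N) (hpos i m).ne'
      have h6 := Int.lt_ediv_add_one_mul_self ((red t' i - s i) * N) (hpos i m)
      rw [h2] at h3 h4
      change N * |red t i - red t' i| ≤ _
      have h7 : N * |red t i - red t' i| = |N * (red t i - red t' i)| := by
        rw [abs_mul, abs_of_pos hN]
      rw [h7, abs_le]
      constructor <;> linarith
    refine ⟨θ.quot^[m₀ + m] t' - θ.quot^[m₀ + m] t, ?_⟩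
    simp only [red] at h1
    change (θ.Q ^ (m₀ + m)).mulVec _ = _
    rw [Matrix.mulVec_sub]
    generalize (θ.Q ^ (m₀ + m)).mulVec (θ.quot^[m₀ + m] t) = u at h1 ⊢
    have h2 := sub_eq_zero.1 h1
    rw [sub_eq_iff_eq_add] at h2
    rw [h2]
    abel
  let φ : θ.supertileGroup (m₀ + m) ⧸
      (columnLattice (θ.Q ^ (m₀ + m))).addSubgroupOf (θ.supertileGroup (m₀ + m)) → S :=
    fun q => ⟨g q.out, hgS _⟩
  have hφ : Function.Injective φ := by
    intro q q' e
    rw [← q.out_eq', ← q'.out_eq', QuotientAddGroup.eq]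
    exact hg _ q.out.2 _ q'.out.2 (congrArg Subtype.val e)
  have hfin : Finite (θ.supertileGroup (m₀ + m) ⧸
      (columnLattice (θ.Q ^ (m₀ + m))).addSubgroupOf (θ.supertileGroup (m₀ + m))) :=
    Finite.of_injective φ hφ
  exact ⟨Nat.card_pos.ne', Nat.card_le_card_of_injective φ hφ⟩

/-- From some level on, the stabilizers are obtained by multiplication by `Q`. -/
theorem exists_supertileGroup_succ [Finite A] [Nonempty A] (hp : θ.IsPrimitive)
    (h : θ.IsBlockWith ℓ a) (haper : θ.shiftSpace.IsAperiodic) :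
    ∃ n₀ : ℕ, ∀ n ≥ n₀, ∀ t ∈ θ.supertileGroup (n + 1), ∃ s ∈ θ.supertileGroup n,
      θ.Q.mulVec s = t := by
  obtain ⟨m₀, C, hC⟩ := exists_relIndex_supertileGroup_le hp h haper
  set c : ℕ → ℕ := fun n => (columnLattice (θ.Q ^ n)).relIndex (θ.supertileGroup n) with hc
  -- Multiplicativity of the index in Q^(n+1)ℤ^d ≤ Q L_n ≤ L_(n+1), with L_n the stabilizer of level
  -- n; Q is injective.
  have hstep : ∀ n, c (n + 1) =
      c n * ((θ.supertileGroup n).map θ.QHom).relIndex (θ.supertileGroup (n + 1)) := by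
    intro n
    have h1 : columnLattice (θ.Q ^ (n + 1)) = (columnLattice (θ.Q ^ n)).map θ.QHom := by
      ext v
      constructor
      · rintro ⟨w, rfl⟩
        exact ⟨_, ⟨w, rfl⟩, (pow_succ_mulVec n w).symm⟩
      · rintro ⟨_, ⟨w, rfl⟩, rfl⟩
        exact ⟨w, pow_succ_mulVec n w⟩
    have h2 : c n = ((columnLattice (θ.Q ^ n)).map θ.QHom).relIndex
        ((θ.supertileGroup n).map θ.QHom) :=
      (AddSubgroup.relIndex_map_map_of_injective _ _ θ.mulVec_injective).symm
    rw [h2, hc]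
    simp only
    rw [h1]
    refine (AddSubgroup.relIndex_mul_relIndex _ _ _ (AddSubgroup.map_mono ?_) ?_).symm
    · rintro _ ⟨w, rfl⟩
      exact θ.pow_mulVec_mem_supertileGroup n w
    · rintro _ ⟨t, ht, rfl⟩
      exact mulVec_mem_supertileGroup hp h ht
  -- The indices are bounded, hence attain a maximum, and they do not decrease; from n₀ on they are
  -- constant, so Q L_n has index 1 in L_(n+1).
  obtain ⟨n₀, hn₀, hmax⟩ : ∃ n₀ ≥ m₀, ∀ n ≥ m₀, c n ≤ c n₀ := by
    have hfin : (c '' Set.Ici m₀).Finite :=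
      (Set.finite_Iic C).subset (by rintro _ ⟨n, hn, rfl⟩; exact (hC n hn).2)
    obtain ⟨_, ⟨n₀, hn₀, rfl⟩, hmax⟩ :=
      Set.exists_max_image _ id hfin ⟨_, m₀, Set.mem_Ici.2 le_rfl, rfl⟩
    exact ⟨n₀, hn₀, fun n hn => hmax _ ⟨n, hn, rfl⟩⟩
  have hmono : ∀ k, c n₀ ≤ c (n₀ + k) := by
    intro k
    induction k with
    | zero => exact le_rfl
    | succ k ih =>
      refine ih.trans ?_
      have h1 := hstep (n₀ + k)
      have h2 := (hC (n₀ + k + 1) (by omega)).1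
      change c (n₀ + k + 1) ≠ 0 at h2
      rw [h1] at h2
      rw [← add_assoc, h1]
      exact Nat.le_mul_of_pos_right _ (Nat.pos_of_ne_zero (right_ne_zero_of_mul h2))
  refine ⟨n₀, fun n hn t ht => ?_⟩
  obtain ⟨k, rfl⟩ := Nat.exists_eq_add_of_le hn
  have h1 := hstep (n₀ + k)
  have h2 : c (n₀ + k + 1) = c (n₀ + k) :=
    le_antisymm ((hmax _ (by omega)).trans (hmono k)) ((hmax _ (by omega)).trans (hmono (k + 1)))
  rw [h2] at h1
  have h3 : 0 < c (n₀ + k) := Nat.pos_of_ne_zero (hC _ (by omega)).1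
  have h4 := (AddSubgroup.relIndex_eq_one.1 (Nat.eq_of_mul_eq_mul_left h3
    (h1.symm.trans (mul_one _).symm))) ht
  obtain ⟨s, hs, e⟩ := h4
  exact ⟨s, hs, e⟩

/-- A weak form of recognizability: the stabilizers are eventually contained in `Q^n ℤ^d`. -/
theorem exists_supertileGroup_le [Finite A] [Nonempty A] (hp : θ.IsPrimitive)
    (h : θ.IsBlockWith ℓ a) (haper : θ.shiftSpace.IsAperiodic) :
    ∃ n₀ : ℕ, ∀ n, ∀ t ∈ θ.supertileGroup (n₀ + n), ∃ s, (θ.Q ^ n).mulVec s = t := by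
  obtain ⟨n₀, hn₀⟩ := exists_supertileGroup_succ hp h haper
  refine ⟨n₀, fun n => ?_⟩
  suffices H : ∀ t ∈ θ.supertileGroup (n₀ + n), ∃ s ∈ θ.supertileGroup n₀,
      (θ.Q ^ n).mulVec s = t from fun t ht => (H t ht).imp fun s hs => hs.2
  induction n with
  | zero => exact fun t ht => ⟨t, ht, by simp⟩
  | succ n ih =>
    intro t ht
    obtain ⟨s, hs, rfl⟩ := hn₀ (n₀ + n) (by omega) t ht
    obtain ⟨r, hr, rfl⟩ := ih s hs
    exact ⟨r, hr, pow_succ_mulVec n r⟩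

end DigitSubstitution

/-! ### Block codes along a lattice -/

section LatticeCode

variable {d : ℕ} {A : Type*} {X₀ : Set ((Fin d → ℤ) → A)} {H : Matrix (Fin d) (Fin d) ℤ}

/-- The patterns with support `W` of the configurations in `X₀`. -/
def patternSet (X₀ : Set ((Fin d → ℤ) → A)) (W : Finset (Fin d → ℤ)) : Set (W → A) :=
  (fun x (w : W) => x w) '' X₀

variable [Finite A]

/-- The block code that reads off the patterns with support `H q + W`. -/
noncomputable def latticeCode (W : Finset (Fin d → ℤ))
    (hinv : ∀ x ∈ X₀, ∀ q, shiftMap (H.mulVec q) x ∈ X₀) (x : X₀) (q : Fin d → ℤ) :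
    Fin (Nat.card (patternSet X₀ W)) :=
  Finite.equivFin _ ⟨fun w => shiftMap (H.mulVec q) x.1 w, _, hinv x.1 x.2 q, rfl⟩

variable (W : Finset (Fin d → ℤ)) (hinv : ∀ x ∈ X₀, ∀ q, shiftMap (H.mulVec q) x ∈ X₀)

theorem latticeCode_eq_iff (x y : X₀) (p q : Fin d → ℤ) :
    latticeCode W hinv x p = latticeCode W hinv y q ↔
      ∀ w ∈ W, x.1 (w + H.mulVec p) = y.1 (w + H.mulVec q) := by
  refine (EmbeddingLike.apply_eq_iff_eq _).trans
    (Subtype.ext_iff.trans (funext_iff.trans ?_))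
  simp [shiftMap]

/-- The alphabet contains only patterns that occur, so each letter is realised by some
configuration; the induced substitution is defined through such representatives. -/
theorem exists_latticeCode_eq (c : Fin (Nat.card (patternSet X₀ W))) :
    ∃ x : X₀, latticeCode W hinv x 0 = c := by
  obtain ⟨⟨_, x, hx, rfl⟩, rfl⟩ := (Finite.equivFin (patternSet X₀ W)).surjective c
  refine ⟨⟨x, hx⟩, ?_⟩
  rw [latticeCode]
  congr 2
  simp

theorem latticeCode_shiftMap (x : X₀) (q : Fin d → ℤ) :
    latticeCode W hinv ⟨shiftMap (H.mulVec q) x.1, hinv x.1 x.2 q⟩ =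
      shiftMap q (latticeCode W hinv x) := by
  funext p
  rw [shiftMap, latticeCode_eq_iff]
  intro w _
  simp only [shiftMap, Matrix.mulVec_add, add_assoc]

theorem latticeCode_injective (hW : ∀ m, ∃ w ∈ W, ∃ q, w + H.mulVec q = m) :
    Function.Injective (latticeCode W hinv) := by
  intro x y e
  apply Subtype.ext
  funext m
  obtain ⟨w, hw, q, rfl⟩ := hW m
  exact (latticeCode_eq_iff W hinv x y q q).1 (congrFun e q) w hw

variable [TopologicalSpace A] [DiscreteTopology A]

theorem continuous_latticeCode : Continuous (latticeCode W hinv) := by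
  refine continuous_pi fun q => ?_
  refine (IsLocallyConstant.iff_exists_open _).2 (fun x => ?_) |>.continuous
  refine ⟨Subtype.val ⁻¹' ⋂ w ∈ W, (fun y => y (w + H.mulVec q)) ⁻¹' {x.1 (w + H.mulVec q)},
    ?_, by simp, ?_⟩
  · exact (isOpen_biInter_finset fun w _ =>
      (isOpen_discrete _).preimage (continuous_apply (w + H.mulVec q))).preimage
        continuous_subtype_val
  · intro y hy
    simp only [Set.mem_preimage, Set.mem_iInter, Set.mem_singleton_iff] at hy
    exact (latticeCode_eq_iff W hinv y x q q).2 hy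

/-- The subshift of all codes. -/
noncomputable def latticeSubshift (hX₀ : IsClosed X₀) :
    Subshift d (Fin (Nat.card (patternSet X₀ W))) where
  carrier := Set.range (latticeCode W hinv)
  isClosed_carrier := by
    have : CompactSpace X₀ := isCompact_iff_compactSpace.1 hX₀.isCompact
    exact (isCompact_range (continuous_latticeCode W hinv)).isClosed
  shift_mem := by
    rintro n _ ⟨x, rfl⟩
    exact ⟨_, latticeCode_shiftMap W hinv x n⟩

/-- The block code as a homeomorphism. -/
noncomputable def latticeHomeo (hX₀ : IsClosed X₀)
    (hW : ∀ m, ∃ w ∈ W, ∃ q, w + H.mulVec q = m) :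
    X₀ ≃ₜ latticeSubshift W hinv hX₀ :=
  haveI : CompactSpace X₀ := isCompact_iff_compactSpace.1 hX₀.isCompact
  Continuous.homeoOfEquivCompactToT2
    (f := Equiv.ofInjective _ (latticeCode_injective W hinv hW))
    ((continuous_latticeCode W hinv).subtype_mk _)

theorem act_latticeHomeo (hX₀ : IsClosed X₀) (hW : ∀ m, ∃ w ∈ W, ∃ q, w + H.mulVec q = m)
    (x : X₀) (q : Fin d → ℤ) :
    (latticeSubshift W hinv hX₀).act q (latticeHomeo W hinv hX₀ hW x) =
      latticeHomeo W hinv hX₀ hW ⟨shiftMap (H.mulVec q) x.1, hinv x.1 x.2 q⟩ :=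
  Subtype.ext (latticeCode_shiftMap W hinv x q).symm

end LatticeCode

/-! ### Fundamental domains -/

theorem IsFundamentalDomain.sub_rep_mem {d : ℕ} {Γ : AddSubgroup (Fin d → ℤ)}
    {F : Set (Fin d → ℤ)} (hF : IsFundamentalDomain Γ F) (m : Fin d → ℤ) :
    m - hF.rep m ∈ Γ :=
  (hF m).choose_spec.1.2

theorem IsFundamentalDomain.eq_of_sub_mem {d : ℕ} {Γ : AddSubgroup (Fin d → ℤ)}
    {F : Set (Fin d → ℤ)} (hF : IsFundamentalDomain Γ F) {i j : F}
    (h : (i : Fin d → ℤ) - j ∈ Γ) : i = j := by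
  obtain ⟨k, -, hk⟩ := hF i
  exact Subtype.ext ((hk i ⟨i.2, by simp⟩).trans (hk j ⟨j.2, h⟩).symm)

theorem IsFundamentalDomain.finite {d : ℕ} {Γ : AddSubgroup (Fin d → ℤ)}
    {F : Set (Fin d → ℤ)} (hF : IsFundamentalDomain Γ F) [Finite ((Fin d → ℤ) ⧸ Γ)] :
    Finite F := by
  refine Finite.of_injective (fun j : F => ((j : Fin d → ℤ) : (Fin d → ℤ) ⧸ Γ)) fun i j e => ?_
  apply hF.eq_of_sub_mem
  rw [← neg_sub]
  refine Γ.neg_mem ?_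
  rw [← neg_add_eq_sub]
  exact QuotientAddGroup.eq.1 e

theorem mulVec_latticeCoord {d : ℕ} {H : Matrix (Fin d) (Fin d) ℤ} {v : Fin d → ℤ}
    (hv : v ∈ columnLattice H) : H.mulVec (latticeCoord H v) = v :=
  Function.invFun_eq (f := fun q : Fin d → ℤ => H.mulVec q) hv

/-- The order of the quotient annihilates it, so H has a right inverse up to this nonzero integer.
-/
theorem det_ne_zero_of_finite_quotient {d : ℕ} {H : Matrix (Fin d) (Fin d) ℤ}
    [Finite ((Fin d → ℤ) ⧸ columnLattice H)] : H.det ≠ 0 := by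
  have h1 : ∀ i : Fin d, ∃ v, H.mulVec v =
      Nat.card ((Fin d → ℤ) ⧸ columnLattice H) • Pi.single i 1 := by
    intro i
    have h2 : Nat.card ((Fin d → ℤ) ⧸ columnLattice H) •
        ((Pi.single i 1 : Fin d → ℤ) : (Fin d → ℤ) ⧸ columnLattice H) = 0 := card_nsmul_eq_zero'
    rw [← QuotientAddGroup.mk_nsmul, QuotientAddGroup.eq_zero_iff] at h2
    exact h2
  choose v hv using h1
  have h3 : H * (Matrix.of fun i j => v j i) =
      Matrix.diagonal fun _ => (Nat.card ((Fin d → ℤ) ⧸ columnLattice H) : ℤ) := by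
    ext i j
    have h4 := congrFun (hv j) i
    rw [Matrix.mulVec, dotProduct] at h4
    rw [Matrix.mul_apply]
    simp only [Matrix.of_apply]
    rw [h4]
    by_cases hij : i = j
    · subst hij; simp
    · simp [hij]
  have h5 := congrArg Matrix.det h3
  rw [Matrix.det_mul, Matrix.det_diagonal] at h5
  intro h0
  rw [h0, zero_mul] at h5
  exact (Finset.prod_ne_zero_iff.2 fun _ _ => by exact_mod_cast Nat.card_pos.ne') h5.symm

/-! ### The suspension structure of `𝕏_θ` -/

namespace DigitSubstitution

variable {d : ℕ} {A : Type*} {θ : DigitSubstitution d A} {ℓ a : Fin d → ℤ}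
  [TopologicalSpace A] [DiscreteTopology A] {Γ : AddSubgroup (Fin d → ℤ)}
  {τ : A → (Fin d → ℤ) ⧸ Γ} {x₀ : (Fin d → ℤ) → A}

/-- The configurations of class `0`. -/
def zeroClass (θ : DigitSubstitution d A) (τ : A → (Fin d → ℤ) ⧸ Γ) :
    Set ((Fin d → ℤ) → A) :=
  {x | x ∈ θ.shiftSpace.carrier ∧ τ (x 0) = 0}

theorem isClosed_zeroClass : IsClosed (θ.zeroClass τ) := by
  have e : θ.zeroClass τ = θ.shiftSpace.carrier ∩ (fun x => x 0) ⁻¹' {b | τ b = 0} := rfl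
  rw [e]
  exact θ.shiftSpace.isClosed_carrier.inter
    ((isClosed_discrete {b | τ b = 0}).preimage (continuous_apply 0))

theorem IsClassMap.shiftMap_mem_zeroClass (hτ : θ.IsClassMap Γ τ x₀) {x : (Fin d → ℤ) → A}
    (hx : x ∈ θ.shiftSpace.carrier) {m : Fin d → ℤ}
    (h : τ (x 0) = (-m : Fin d → ℤ)) : _root_.shiftMap m x ∈ θ.zeroClass τ := by
  refine ⟨θ.shiftSpace.shift_mem m x hx, ?_⟩
  rw [hτ.shiftMap hx, h, ← QuotientAddGroup.mk_add, neg_add_cancel]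
  rfl

theorem IsClassMap.shiftMap_mem_zeroClass_of_mem (hτ : θ.IsClassMap Γ τ x₀)
    {x : (Fin d → ℤ) → A} (hx : x ∈ θ.zeroClass τ) {m : Fin d → ℤ} (hm : m ∈ Γ) :
    _root_.shiftMap m x ∈ θ.zeroClass τ :=
  hτ.shiftMap_mem_zeroClass hx.1
    (hx.2.trans ((QuotientAddGroup.eq_zero_iff _).2 (Γ.neg_mem hm)).symm)

/-- The homeomorphism `(x, j) ↦ σ_j x`. -/
noncomputable def IsClassMap.prodHomeo [Finite A] (hτ : θ.IsClassMap Γ τ x₀)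
    [Finite ((Fin d → ℤ) ⧸ Γ)] {F : Set (Fin d → ℤ)} (hF : IsFundamentalDomain Γ F) :
    θ.zeroClass τ × F ≃ₜ θ.shiftSpace :=
  haveI : CompactSpace (θ.zeroClass τ) := isCompact_iff_compactSpace.1 isClosed_zeroClass.isCompact
  haveI : Finite F := hF.finite
  Continuous.homeoOfEquivCompactToT2
    (f := Equiv.ofBijective
      (fun p => ⟨_root_.shiftMap p.2.1 p.1.1, θ.shiftSpace.shift_mem _ _ p.1.2.1⟩) <| by
        constructor
        · rintro ⟨x, i⟩ ⟨y, j⟩ e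
          have e' := congrArg Subtype.val e
          simp only at e'
          -- For x of class 0 the class of σ_i x is that of i, so the image determines the
          -- representative.
          have h1 := hτ.shiftMap x.2.1 i
          have h2 := hτ.shiftMap y.2.1 j
          rw [e', h2, x.2.2, y.2.2, zero_add, zero_add, QuotientAddGroup.eq, neg_add_eq_sub] at h1
          obtain rfl := hF.eq_of_sub_mem h1
          have h3 := congrArg (_root_.shiftMap (-i.1)) e'
          rw [shiftMap_shiftMap, shiftMap_shiftMap, neg_add_cancel, shiftMap_zero,
            shiftMap_zero] at h3
          rw [Subtype.ext h3]
        · intro x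
          obtain ⟨m, hm⟩ := QuotientAddGroup.mk_surjective (τ (x.1 0))
          refine ⟨(⟨_root_.shiftMap (-(hF.rep m).1) x.1,
            hτ.shiftMap_mem_zeroClass x.2 ?_⟩, hF.rep m), ?_⟩
          · rw [neg_neg, ← hm, QuotientAddGroup.eq, ← neg_mem_iff, neg_add_rev, neg_neg,
              neg_add_eq_sub]
            exact hF.sub_rep_mem m
          · apply Subtype.ext
            simp [shiftMap_shiftMap])
    (by
      refine Continuous.subtype_mk ?_ _
      refine continuous_prod_of_discrete_right.2 fun j => ?_
      exact (continuous_shiftMap j.1).comp continuous_subtype_val)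

theorem IsClassMap.coe_prodHomeo [Finite A] (hτ : θ.IsClassMap Γ τ x₀)
    [Finite ((Fin d → ℤ) ⧸ Γ)] {F : Set (Fin d → ℤ)} (hF : IsFundamentalDomain Γ F)
    (p : θ.zeroClass τ × F) : (hτ.prodHomeo hF p).1 = _root_.shiftMap p.2.1 p.1.1 := rfl

/-- Automorphisms translate the class of all configurations by the same amount. -/
theorem IsClassMap.automorphism_apply [Finite A] (hτ : θ.IsClassMap Γ τ x₀)
    (hp : θ.IsPrimitive) (h : θ.IsBlockWith ℓ a) {Φ : θ.shiftSpace ≃ₜ θ.shiftSpace}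
    (hΦ : θ.shiftSpace.IsAutomorphism Φ) (x : θ.shiftSpace) :
    τ ((Φ x).1 0) = τ (x.1 0) + τ ((Φ ⟨x₀, hτ.mem⟩).1 0) := by
  let c := τ ((Φ ⟨x₀, hτ.mem⟩).1 0)
  let C : Set ((Fin d → ℤ) → A) :=
    Subtype.val '' {x : θ.shiftSpace | τ ((Φ x).1 0) = τ (x.1 0) + c}
  have hC : IsClosed C := by
    refine θ.shiftSpace.isClosed_carrier.isClosedEmbedding_subtypeVal.isClosedMap _ ?_
    have hc : Continuous fun x : θ.shiftSpace => ((Φ x).1 0, x.1 0) :=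
      ((continuous_apply 0).comp (continuous_subtype_val.comp Φ.continuous)).prodMk
        ((continuous_apply 0).comp continuous_subtype_val)
    exact (isClosed_discrete {p : A × A | τ p.1 = τ p.2 + c}).preimage hc
  -- The relation is closed and holds along the orbit of x₀, hence everywhere by minimality.
  obtain ⟨y, hy, e⟩ : x.1 ∈ C := DigitSubstitution.mem_of_isClosed hp h hC hτ.mem x.2 fun m => by
    refine ⟨θ.shiftSpace.act m ⟨x₀, hτ.mem⟩, ?_, rfl⟩
    rw [Set.mem_ofPred_eq, hΦ]
    change τ (_root_.shiftMap m (Φ ⟨x₀, hτ.mem⟩).1 0) = τ (_root_.shiftMap m x₀ 0) + c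
    rw [hτ.shiftMap (Φ ⟨x₀, hτ.mem⟩).2, hτ.shiftMap hτ.mem, hτ.zero, zero_add, add_comm]
  rw [← Subtype.ext e]
  exact hy

/-- The restriction of `σ_{-i} ∘ Φ` to the configurations of class `0`. -/
theorem IsClassMap.exists_restrict [Finite A] (hτ : θ.IsClassMap Γ τ x₀)
    (hp : θ.IsPrimitive) (h : θ.IsBlockWith ℓ a) {Φ : θ.shiftSpace ≃ₜ θ.shiftSpace}
    (hΦ : θ.shiftSpace.IsAutomorphism Φ) {i : Fin d → ℤ}
    (hi : τ ((Φ ⟨x₀, hτ.mem⟩).1 0) = (i : (Fin d → ℤ) ⧸ Γ)) :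
    ∃ Φ₀ : θ.zeroClass τ ≃ₜ θ.zeroClass τ, ∀ x : θ.zeroClass τ,
      Φ ⟨x.1, x.2.1⟩ = θ.shiftSpace.act i ⟨(Φ₀ x).1, (Φ₀ x).2.1⟩ := by
  have hact : ∀ (m n : Fin d → ℤ) (x : θ.shiftSpace),
      θ.shiftSpace.act m (θ.shiftSpace.act n x) = θ.shiftSpace.act (m + n) x :=
    fun m n x => Subtype.ext (shiftMap_shiftMap m n x.1)
  have hact0 : ∀ x : θ.shiftSpace, θ.shiftSpace.act 0 x = x :=
    fun x => Subtype.ext (shiftMap_zero x.1)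
  have hcont : ∀ m, Continuous (θ.shiftSpace.act m) := fun m =>
    ((continuous_shiftMap m).comp continuous_subtype_val).subtype_mk _
  have h1 : ∀ x : θ.zeroClass τ,
      (θ.shiftSpace.act (-i) (Φ ⟨x.1, x.2.1⟩)).1 ∈ θ.zeroClass τ := fun x =>
    hτ.shiftMap_mem_zeroClass (Φ ⟨x.1, x.2.1⟩).2 (by
      rw [hτ.automorphism_apply hp h hΦ, x.2.2, hi, zero_add, neg_neg])
  have h2 : ∀ x : θ.zeroClass τ,
      (Φ.symm (θ.shiftSpace.act i ⟨x.1, x.2.1⟩)).1 ∈ θ.zeroClass τ := fun x => by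
    refine ⟨(Φ.symm _).2, ?_⟩
    have e := hτ.automorphism_apply hp h hΦ (Φ.symm (θ.shiftSpace.act i ⟨x.1, x.2.1⟩))
    rw [Φ.apply_symm_apply, hi] at e
    change τ (_root_.shiftMap i x.1 0) = _ at e
    exact (add_right_cancel ((hτ.shiftMap x.2.1 i).symm.trans e)).symm.trans x.2.2
  refine ⟨{ toFun := fun x => ⟨_, h1 x⟩
            invFun := fun x => ⟨_, h2 x⟩
            left_inv := fun x => ?_
            right_inv := fun x => ?_
            continuous_toFun := ?_
            continuous_invFun := ?_ }, fun x => ?_⟩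
  · apply Subtype.ext
    have e : θ.shiftSpace.act i (θ.shiftSpace.act (-i) (Φ ⟨x.1, x.2.1⟩)) = Φ ⟨x.1, x.2.1⟩ := by
      rw [hact, add_neg_cancel, hact0]
    change (Φ.symm (θ.shiftSpace.act i (θ.shiftSpace.act (-i) (Φ ⟨x.1, x.2.1⟩)))).1 = x.1
    rw [e, Φ.symm_apply_apply]
  · apply Subtype.ext
    change (θ.shiftSpace.act (-i) (Φ (Φ.symm (θ.shiftSpace.act i ⟨x.1, x.2.1⟩)))).1 = x.1
    rw [Φ.apply_symm_apply, hact, neg_add_cancel, hact0]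
  · exact (continuous_subtype_val.comp ((hcont (-i)).comp (Φ.continuous.comp
      (continuous_subtype_val.subtype_mk _)))).subtype_mk _
  · exact (continuous_subtype_val.comp (Φ.symm.continuous.comp ((hcont i).comp
      (continuous_subtype_val.subtype_mk _)))).subtype_mk _
  · change Φ ⟨x.1, x.2.1⟩ = θ.shiftSpace.act i (θ.shiftSpace.act (-i) (Φ ⟨x.1, x.2.1⟩))
    rw [hact, add_neg_cancel, hact0]

end DigitSubstitution

/-! ### Equicontinuous factors do not separate proximal points -/

open Topology Uniformity in
/-- A continuous map on a compact set of configurations depends up to `U` on finitely many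
coordinates. -/
theorem exists_latticeBox_forall_mem {d : ℕ} {A W : Type*} [Finite A] [TopologicalSpace A]
    [DiscreteTopology A] [UniformSpace W] {X₀ : Set ((Fin d → ℤ) → A)} (hX₀ : IsClosed X₀)
    {P : ((Fin d → ℤ) → A) → W} (hP : ContinuousOn P X₀) {U : Set (W × W)} (hU : U ∈ 𝓤 W) :
    ∃ r : ℤ, 0 ≤ r ∧ ∀ x ∈ X₀, ∀ y ∈ X₀, (∀ z ∈ latticeBox d r, x z = y z) → (P x, P y) ∈ U := by
  classical
  obtain ⟨V, hV, hVs, hVU⟩ := comp_symm_mem_uniformity_sets hU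
  have h1 : ∀ x ∈ X₀, ∃ B : Finset (Fin d → ℤ), ∀ y ∈ X₀, (∀ b ∈ B, y b = x b) →
      (P x, P y) ∈ V := by
    intro x hx
    have h2 := hP x hx (UniformSpace.ball_mem_nhds (P x) hV)
    rw [Filter.mem_map, mem_nhdsWithin] at h2
    obtain ⟨o, ho, hxo, hsub⟩ := h2
    obtain ⟨B, u, hu, hB⟩ := isOpen_pi_iff.1 ho x hxo
    exact ⟨B, fun y hy e => hsub ⟨hB fun b hb => (e b hb) ▸ (hu b hb).2, hy⟩⟩
  choose! B hB using h1
  obtain ⟨t, ht⟩ := hX₀.isCompact.elim_nhds_subcover'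
    (fun x _ => ⋂ b ∈ B x, (fun y => y b) ⁻¹' {x b}) (fun x _ => by
      refine IsOpen.mem_nhds ?_ (by simp)
      exact isOpen_biInter_finset fun b _ => (isOpen_discrete _).preimage (continuous_apply b))
  obtain ⟨r, hr0, hr⟩ := exists_subset_latticeBox (t.biUnion fun x => B x)
  refine ⟨r, hr0, fun x hx y hy e => hVU ?_⟩
  obtain ⟨w, hw, hxw⟩ := Set.mem_iUnion₂.1 (ht hx)
  simp only [Set.mem_iInter, Set.mem_preimage, Set.mem_singleton_iff] at hxw
  have hbox : ∀ b ∈ B w, b ∈ latticeBox d r := fun b hb =>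
    hr (Finset.mem_biUnion.2 ⟨w, hw, hb⟩)
  refine ⟨P w, hVs.symm _ _ (hB w.1 w.2 x hx hxw), hB w.1 w.2 y hy fun b hb => ?_⟩
  rw [← e b (hbox b hb), hxw b hb]

/-- Supplies bounded corrections that move a configuration into class 0, or a translation vector
into Γ. -/
theorem exists_latticeBox_add_mem {d : ℕ} (Γ : AddSubgroup (Fin d → ℤ))
    [Finite ((Fin d → ℤ) ⧸ Γ)] :
    ∃ ρ : ℤ, 0 ≤ ρ ∧ ∀ v : (Fin d → ℤ) ⧸ Γ, ∃ f ∈ latticeBox d ρ,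
      v + (f : (Fin d → ℤ) ⧸ Γ) = 0 := by
  classical
  have := Fintype.ofFinite ((Fin d → ℤ) ⧸ Γ)
  obtain ⟨ρ, hρ, hs⟩ := exists_subset_latticeBox
    (Finset.univ.image fun q : (Fin d → ℤ) ⧸ Γ => (-q).out)
  refine ⟨ρ, hρ, fun v => ⟨(-v).out, hs (Finset.mem_image_of_mem _ (Finset.mem_univ v)), ?_⟩⟩
  rw [QuotientAddGroup.out_eq', add_neg_cancel]

theorem latticeBox_add {d : ℕ} {r s : ℤ} {z w : Fin d → ℤ} (hz : z ∈ latticeBox d r)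
    (hw : w ∈ latticeBox d s) : z + w ∈ latticeBox d (r + s) :=
  mem_latticeBox.2 fun i => (abs_add_le _ _).trans
    (add_le_add (mem_latticeBox.1 hz i) (mem_latticeBox.1 hw i))

namespace DigitSubstitution

variable {d : ℕ} {A : Type*} {θ : DigitSubstitution d A} {ℓ a : Fin d → ℤ}
  [TopologicalSpace A] [DiscreteTopology A] {Γ : AddSubgroup (Fin d → ℤ)}
  {τ : A → (Fin d → ℤ) ⧸ Γ} {x₀ : (Fin d → ℤ) → A}

open Topology Uniformity

/-- The images of return times under `Q^n` are return times of large patterns. -/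
theorem exists_zeroClass_eqOn (h : θ.IsBlockWith ℓ a) (hτ : θ.IsClassMap Γ τ x₀)
    [Finite ((Fin d → ℤ) ⧸ Γ)] (r : ℤ) :
    ∃ n₀, ∀ n ≥ n₀, ∀ j ∈ θ.shiftSpace.returnTimes, ∃ w ∈ θ.zeroClass τ,
      ∀ b ∈ latticeBox d r, w (b + (θ.Q ^ n).mulVec j) = w b := by
  obtain ⟨ρ, hρ0, hρ⟩ := exists_latticeBox_add_mem Γ
  -- Equal letters of x at displacement j give equal level-n supertiles of θ^n(x) at displacement
  -- Q^n j. A ball of radius r + ρ in them leaves room for the shift f that restores class 0.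
  obtain ⟨n₀, hn₀⟩ := h.exists_ball (r + ρ)
  refine ⟨n₀, fun n hn j ⟨x, k, hk⟩ => ?_⟩
  obtain ⟨c, hc⟩ := hn₀ n hn
  set y := shiftMap (c + (θ.Q ^ n).mulVec k) (θ.subst^[n] x.1) with hy
  have hyX : y ∈ θ.shiftSpace.carrier := θ.shiftSpace.shift_mem _ _ (subst_iterate_mem x.2 n)
  obtain ⟨f, hf, hf0⟩ := hρ (τ (y 0))
  refine ⟨shiftMap f y, ⟨θ.shiftSpace.shift_mem _ _ hyX, by rw [hτ.shiftMap hyX, hf0]⟩,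
    fun b hb => ?_⟩
  have hq : θ.quot^[n] (b + f + c + (θ.Q ^ n).mulVec k) = k := by
    rw [quot_iterate_add, hc (b + f) (mem_latticeBox.1 (latticeBox_add hb hf)), zero_add]
  have e : b + (θ.Q ^ n).mulVec j + f + (c + (θ.Q ^ n).mulVec k) =
    b + f + c + (θ.Q ^ n).mulVec k + (θ.Q ^ n).mulVec j := by abel
  have e' : b + f + (c + (θ.Q ^ n).mulVec k) = b + f + c + (θ.Q ^ n).mulVec k := by abel
  simp only [hy, shiftMap]
  rw [e, e']
  apply subst_iterate_congr_add
  rw [hq, add_comm, hk]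

section Proximal

variable {W : Type*} [UniformSpace W] {H : Matrix (Fin d) (Fin d) ℤ}
  {P : ((Fin d → ℤ) → A) → W} {R : (Fin d → ℤ) → W → W}

theorem exists_forall_translate_mem (hUE : UniformEquicontinuous R)
    (hH : columnLattice H = Γ)
    (hPR : ∀ x ∈ θ.zeroClass τ, ∀ q, P (shiftMap (H.mulVec q) x) = R q (P x))
    {U : Set (W × W)} (hU : U ∈ 𝓤 W) :
    ∃ V ∈ 𝓤 W, ∀ x ∈ θ.zeroClass τ, ∀ y ∈ θ.zeroClass τ, (P x, P y) ∈ V → ∀ m ∈ Γ,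
      (P (shiftMap m x), P (shiftMap m y)) ∈ U := by
  refine ⟨_, hUE U hU, fun x hx y hy hxy m hm => ?_⟩
  subst hH
  obtain ⟨q, rfl⟩ := hm
  have := hxy q
  rw [← hPR x hx, ← hPR y hy] at this
  exact this

/-- The vectors `v` in `Γ` such that translation by `Q^n v` converges to the identity in the
factor. -/
def asymptoticGroup (hτ : θ.IsClassMap Γ τ x₀) (hΓQ : ∀ n, ∀ v ∈ Γ, (θ.Q ^ n).mulVec v ∈ Γ)
    (P : ((Fin d → ℤ) → A) → W) : AddSubgroup (Fin d → ℤ) where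
  carrier := {v | v ∈ Γ ∧ ∀ U ∈ 𝓤 W, ∃ n₀, ∀ n ≥ n₀, ∀ z ∈ θ.zeroClass τ,
    (P (shiftMap ((θ.Q ^ n).mulVec v) z), P z) ∈ U}
  zero_mem' := ⟨Γ.zero_mem, fun U hU => ⟨0, fun n _ z _ => by
    rw [Matrix.mulVec_zero, shiftMap_zero]
    exact mem_uniformity_of_eq hU rfl⟩⟩
  add_mem' := by
    rintro v w ⟨hv, hv'⟩ ⟨hw, hw'⟩
    refine ⟨Γ.add_mem hv hw, fun U hU => ?_⟩
    obtain ⟨V, hV, hVU⟩ := comp_mem_uniformity_sets hU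
    obtain ⟨n₁, h₁⟩ := hv' V hV
    obtain ⟨n₂, h₂⟩ := hw' V hV
    refine ⟨max n₁ n₂, fun n hn z hz => hVU ⟨P (shiftMap ((θ.Q ^ n).mulVec w) z), ?_,
      h₂ n (le_of_max_le_right hn) z hz⟩⟩
    rw [Matrix.mulVec_add, ← shiftMap_shiftMap]
    exact h₁ n (le_of_max_le_left hn) _ (hτ.shiftMap_mem_zeroClass_of_mem hz (hΓQ n w hw))
  neg_mem' := by
    rintro v ⟨hv, hv'⟩
    refine ⟨Γ.neg_mem hv, fun U hU => ?_⟩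
    obtain ⟨V, hV, hVs, hVU⟩ := symm_of_uniformity hU
    obtain ⟨n₁, h₁⟩ := hv' V hV
    refine ⟨n₁, fun n hn z hz => hVU (hVs.symm _ _ ?_)⟩
    have h2 := h₁ n hn _ (hτ.shiftMap_mem_zeroClass_of_mem hz (hΓQ n _ (Γ.neg_mem hv)))
    rw [Matrix.mulVec_neg] at h2 ⊢
    rwa [shiftMap_shiftMap, add_neg_cancel, shiftMap_zero] at h2

/-- For a return time j some w of class 0 agrees with σ_(Q^n j) w on a large box, so their images
are close, and by equicontinuity they stay close along the Γ-orbit of w. This orbit is dense in the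
zero class. -/
theorem returnModule_le_asymptoticGroup [Finite A] (hp : θ.IsPrimitive)
    (h : θ.IsBlockWith ℓ a) (hτ : θ.IsClassMap Γ τ x₀)
    (hΓQ : ∀ n, ∀ v ∈ Γ, (θ.Q ^ n).mulVec v ∈ Γ) (hΓ : θ.shiftSpace.returnModule ≤ Γ)
    [Finite ((Fin d → ℤ) ⧸ Γ)] (hH : columnLattice H = Γ) (hUE : UniformEquicontinuous R)
    (hP : ContinuousOn P (θ.zeroClass τ))
    (hPR : ∀ x ∈ θ.zeroClass τ, ∀ q, P (shiftMap (H.mulVec q) x) = R q (P x)) :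
    θ.shiftSpace.returnModule ≤ asymptoticGroup hτ hΓQ P := by
  refine (AddSubgroup.closure_le _).2 ?_
  intro j hj
  have hjΓ : j ∈ Γ := hΓ (AddSubgroup.subset_closure hj)
  obtain ⟨x, k, hk⟩ := hj
  refine ⟨hjΓ, fun U hU => ?_⟩
  -- A closed entourage, so that closeness passes from the orbit of w to its closure.
  obtain ⟨V, ⟨hV, hVc⟩, hVU⟩ := uniformity_hasBasis_closed.mem_iff.1 hU
  simp only [id] at hVU
  obtain ⟨V', hV', hVV'⟩ := exists_forall_translate_mem hUE hH hPR hV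
  obtain ⟨r, hr0, hr⟩ := exists_latticeBox_forall_mem isClosed_zeroClass hP hV'
  obtain ⟨n₀, hn₀⟩ := exists_zeroClass_eqOn h hτ r
  refine ⟨n₀, fun n hn z hz => hVU ?_⟩
  obtain ⟨w, hw, hclose⟩ := hn₀ n hn j ⟨x, k, hk⟩
  have hQj := hΓQ n j hjΓ
  have hw' := hτ.shiftMap_mem_zeroClass_of_mem hw hQj
  have hV1 := hr _ hw' _ hw hclose
  have hV2 := hVV' _ hw' _ hw hV1
  let C : Set ((Fin d → ℤ) → A) :=
    {z | z ∈ θ.zeroClass τ ∧ (P (shiftMap ((θ.Q ^ n).mulVec j) z), P z) ∈ V}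
  have hC : IsClosed C := by
    have hcont : ContinuousOn (fun z => (P (shiftMap ((θ.Q ^ n).mulVec j) z), P z))
        (θ.zeroClass τ) :=
      (hP.comp (continuous_shiftMap _).continuousOn fun z hz =>
        hτ.shiftMap_mem_zeroClass_of_mem hz hQj).prodMk hP
    exact hcont.preimage_isClosed_of_isClosed isClosed_zeroClass hVc
  have hzC : z ∈ C := hτ.mem_of_isClosed hp h hC hw.1 hz.1 (hw.2.trans hz.2.symm) fun m hm =>
    ⟨hτ.shiftMap_mem_zeroClass_of_mem hw hm, by
      have := hV2 m hm
      rwa [shiftMap_shiftMap, add_comm, ← shiftMap_shiftMap] at this⟩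
  exact hzC.2

/-- Write x = σ_t θ^n(y) and x' = σ_t θ^n(y'). The letter y 0 occurs in y' at some bounded s, which
lies in Γ. Then x and σ_(Q^n s) x' share a level-n supertile, so by equicontinuity their images are
close, while σ_(Q^n s) hardly moves the image of x' because Q^N Γ lies in the return module. -/
theorem eq_of_forall_exists_eq_shiftMap [Finite A] [Nonempty A] [CompactSpace W] [T2Space W]
    (hp : θ.IsPrimitive) (h : θ.IsBlockWith ℓ a) (hΓ : θ.IsHeightLattice Γ)
    (hτ : θ.IsClassMap Γ τ x₀) (hH : columnLattice H = Γ) (hR : Equicontinuous R)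
    (hP : ContinuousOn P (θ.zeroClass τ))
    (hPR : ∀ x ∈ θ.zeroClass τ, ∀ q, P (shiftMap (H.mulVec q) x) = R q (P x))
    {x x' : (Fin d → ℤ) → A} (hx : x ∈ θ.zeroClass τ) (hx' : x' ∈ θ.zeroClass τ)
    (hxx' : ∀ n, ∃ t, ∃ y ∈ θ.shiftSpace.carrier, ∃ y' ∈ θ.shiftSpace.carrier,
      x = shiftMap t (θ.subst^[n] y) ∧ x' = shiftMap t (θ.subst^[n] y')) : P x = P x' := by
  have hUE := CompactSpace.uniformEquicontinuous_of_equicontinuous hR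
  have hΓQ : ∀ n, ∀ v ∈ Γ, (θ.Q ^ n).mulVec v ∈ Γ :=
    fun n v hv => (hΓ.pow_mulVec_mem_iff hp h n).2 hv
  have hfin := hΓ.finite_quotient hp h
  have hasym : ∀ v ∈ Γ, ∀ U ∈ 𝓤 W, ∃ n₀, ∀ n ≥ n₀, ∀ z ∈ θ.zeroClass τ,
      (P (shiftMap ((θ.Q ^ n).mulVec v) z), P z) ∈ U := by
    intro v hv U hU
    obtain ⟨N, hN⟩ := hΓ.exists_pow_mulVec_mem hp h
    obtain ⟨n₀, hn₀⟩ :=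
      (returnModule_le_asymptoticGroup hp h hτ hΓQ hΓ.1.1 hH hUE hP hPR (hN v hv)).2 U hU
    refine ⟨n₀ + N, fun n hn z hz => ?_⟩
    obtain ⟨m, rfl⟩ : ∃ m, n = m + N := ⟨n - N, by omega⟩
    rw [pow_add_mulVec]
    exact hn₀ m (by omega) z hz
  refine eq_of_uniformity fun {U} hU => ?_
  obtain ⟨V, hV, hVU⟩ := comp_mem_uniformity_sets hU
  obtain ⟨V', hV', hVV'⟩ := exists_forall_translate_mem hUE hH hPR hV
  obtain ⟨r, hr0, hr⟩ := exists_latticeBox_forall_mem isClosed_zeroClass hP hV'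
  obtain ⟨ρ, hρ0, hρ⟩ := exists_latticeBox_add_mem Γ
  obtain ⟨r₀, hr₀⟩ := exists_forall_occurrence hp h {0}
  obtain ⟨n₁, hn₁⟩ := h.exists_ball (r + ρ)
  -- Only finitely many vectors s can occur, so one level serves all of them.
  obtain ⟨n₂, hn₂⟩ : ∃ n₂, ∀ v ∈ latticeBox d r₀, v ∈ Γ → ∀ n ≥ n₂, ∀ z ∈ θ.zeroClass τ,
      (P (shiftMap ((θ.Q ^ n).mulVec v) z), P z) ∈ V := by
    have h1 : ∀ v, ∃ n₀, v ∈ Γ → ∀ n ≥ n₀, ∀ z ∈ θ.zeroClass τ,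
        (P (shiftMap ((θ.Q ^ n).mulVec v) z), P z) ∈ V := fun v => by
      by_cases hv : v ∈ Γ
      · obtain ⟨n₀, hn₀⟩ := hasym v hv V hV
        exact ⟨n₀, fun _ => hn₀⟩
      · exact ⟨0, fun hv' => (hv hv').elim⟩
    choose N hN using h1
    exact ⟨(latticeBox d r₀).sup N, fun v hv hv' n hn =>
      hN v hv' n ((Finset.le_sup hv).trans hn)⟩
  set n := max n₁ n₂
  obtain ⟨t, y, hy, y', hy', rfl, rfl⟩ := hxx' n
  obtain ⟨c, hc⟩ := hn₁ n (le_max_left _ _)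
  obtain ⟨s, hs, hs'⟩ := hr₀ y hy y' hy' 0
  have hs1 : y 0 = y' s := by simpa using hs 0 (by simp)
  have hs2 : s ∈ latticeBox d r₀ := mem_latticeBox.2 fun i => by simpa using hs' 0 (by simp) i
  -- Both points have class 0, so Q^n maps the difference of the classes of y and y' into Γ; since
  -- Q^n v ∈ Γ implies v ∈ Γ, these classes agree.
  have hsΓ : s ∈ Γ := by
    obtain ⟨u, hu⟩ := hτ.exists_subst hp h n (hΓQ n)
    obtain ⟨m, hm⟩ := QuotientAddGroup.mk_surjective (τ (y 0))
    obtain ⟨m', hm'⟩ := QuotientAddGroup.mk_surjective (τ (y' 0))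
    have e1 := hx.2
    have e2 := hx'.2
    rw [hτ.shiftMap (subst_iterate_mem hy n), hu y hy m hm.symm] at e1
    rw [hτ.shiftMap (subst_iterate_mem hy' n), hu y' hy' m' hm'.symm] at e2
    have e3 := add_right_cancel (e1.trans e2.symm)
    rw [QuotientAddGroup.eq] at e3
    have e4 : -((θ.Q ^ n).mulVec m + u) + ((θ.Q ^ n).mulVec m' + u) =
        (θ.Q ^ n).mulVec (-m + m') := by
      rw [Matrix.mulVec_add, Matrix.mulVec_neg]; abel
    rw [e4, hΓ.pow_mulVec_mem_iff hp h, ← QuotientAddGroup.eq, hm, hm', hs1,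
      hτ.apply y' hy' s, add_eq_left] at e3
    exact (QuotientAddGroup.eq_zero_iff s).1 e3
  obtain ⟨f, hf, hf0⟩ := hρ ((c - t : Fin d → ℤ) : (Fin d → ℤ) ⧸ Γ)
  have hm : c - t + f ∈ Γ := (QuotientAddGroup.eq_zero_iff _).1 hf0
  have hQs := hΓQ n s hsΓ
  have hx'' := hτ.shiftMap_mem_zeroClass_of_mem hx' hQs
  have hclose : (P (shiftMap (c - t + f) (shiftMap t (θ.subst^[n] y))),
      P (shiftMap (c - t + f) (shiftMap ((θ.Q ^ n).mulVec s) (shiftMap t (θ.subst^[n] y'))))) ∈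
        V' := by
    refine hr _ (hτ.shiftMap_mem_zeroClass_of_mem hx hm) _
      (hτ.shiftMap_mem_zeroClass_of_mem hx'' hm) fun b hb => ?_
    simp only [shiftMap]
    have e1 : b + (c - t + f) + t = b + f + c := by abel
    have e2 : b + (c - t + f) + (θ.Q ^ n).mulVec s + t = b + f + c + (θ.Q ^ n).mulVec s := by abel
    rw [e1, e2]
    symm
    apply subst_iterate_congr_add
    rw [hc (b + f) (mem_latticeBox.1 (latticeBox_add hb hf)), zero_add, hs1]
  have h1 := hVV' _ (hτ.shiftMap_mem_zeroClass_of_mem hx hm) _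
    (hτ.shiftMap_mem_zeroClass_of_mem hx'' hm) hclose _ (Γ.neg_mem hm)
  rw [shiftMap_shiftMap, neg_add_cancel, shiftMap_zero, shiftMap_shiftMap, neg_add_cancel,
    shiftMap_zero] at h1
  exact hVU ⟨_, h1, hn₂ s hs2 hsΓ n (le_max_right _ _) _ hx'⟩

end Proximal

end DigitSubstitution

/-! ### The maximal equicontinuous factor -/

/-- If p divides l, it cancels against one of the m + 1 factors; otherwise it is coprime to l^(m+1).
-/
theorem pow_dvd_of_pow_succ_dvd_prime_mul {p : ℕ} (hp : p.Prime) {l v : ℤ} (hl : l ≠ 0) {m : ℕ}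
    (h : l ^ (m + 1) ∣ p * v) : l ^ m ∣ v := by
  have hp' : Prime (p : ℤ) := Nat.prime_iff_prime_int.1 hp
  by_cases hpl : (p : ℤ) ∣ l
  · obtain ⟨e, rfl⟩ := hpl
    have h1 : (p : ℤ) * ((p * e) ^ m * e) ∣ p * v := by
      convert h using 1; ring
    exact (dvd_mul_right _ _).trans ((mul_dvd_mul_iff_left hp'.ne_zero).1 h1)
  · have h1 : IsCoprime (p : ℤ) l := (Prime.coprime_iff_not_dvd hp').2 hpl
    exact (pow_dvd_pow l (Nat.le_succ m)).trans ((h1.pow_right (n := m + 1)).symm.dvd_of_dvd_mul_left h)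

namespace DigitSubstitution

variable {d : ℕ} {A : Type*} {θ : DigitSubstitution d A} {ℓ a : Fin d → ℤ}
  [TopologicalSpace A] [DiscreteTopology A] {Γ : AddSubgroup (Fin d → ℤ)}
  {τ : A → (Fin d → ℤ) ⧸ Γ} {x₀ : (Fin d → ℤ) → A}

open Topology Uniformity

theorem finite_quotient_supertileGroup (h : θ.IsBlockWith ℓ a) (n : ℕ) :
    Finite ((Fin d → ℤ) ⧸ θ.supertileGroup n) := by
  obtain ⟨s, hs⟩ := h.exists_box n
  let S : Finset (Fin d → ℤ) := Finset.Icc s fun i => s i + |ℓ i| ^ n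
  refine Finite.of_surjective
    (fun z : S => ((z : Fin d → ℤ) : (Fin d → ℤ) ⧸ θ.supertileGroup n)) fun q => ?_
  obtain ⟨m, rfl⟩ := QuotientAddGroup.mk_surjective q
  have h1 : θ.quot^[n] (m + (θ.Q ^ n).mulVec (-θ.quot^[n] m)) = 0 := by
    rw [quot_iterate_add, add_neg_cancel]
  rw [hs] at h1
  refine ⟨⟨m + (θ.Q ^ n).mulVec (-θ.quot^[n] m), Finset.mem_Icc.2
    ⟨fun i => (h1 i).1, fun i => (h1 i).2.le⟩⟩, ?_⟩
  rw [QuotientAddGroup.eq]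
  have := (θ.supertileGroup n).neg_mem
    (θ.pow_mulVec_mem_supertileGroup n (-θ.quot^[n] m))
  convert this using 1
  simp only
  abel

/-- The class of x is the t with x ∈ σ_t θ^n(X), unique modulo the stabilizer. There are finitely
many fibres and all are closed, hence continuity. -/
theorem exists_supertileClass [Finite A] [Nonempty A] (hp : θ.IsPrimitive)
    (h : θ.IsBlockWith ℓ a) (n : ℕ) :
    ∃ f : θ.shiftSpace → (Fin d → ℤ) ⧸ θ.supertileGroup n, Continuous f ∧
      (∀ x m, f (θ.shiftSpace.act m x) = f x + (m : (Fin d → ℤ) ⧸ θ.supertileGroup n)) ∧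
      ∀ x (t : Fin d → ℤ), f x = t →
        ∃ y ∈ θ.shiftSpace.carrier, x.1 = shiftMap t (θ.subst^[n] y) := by
  choose y hy t ht using fun x : θ.shiftSpace => exists_eq_shiftMap_subst_iterate hp h n x.2
  let f : θ.shiftSpace → (Fin d → ℤ) ⧸ θ.supertileGroup n := fun x => t x
  have h1 : ∀ (x : θ.shiftSpace) (s : Fin d → ℤ), (∃ z ∈ θ.shiftSpace.carrier,
      x.1 = shiftMap s (θ.subst^[n] z)) ↔ f x = s := by
    intro x s
    constructor
    · rintro ⟨z, hz, e⟩
      rw [QuotientAddGroup.eq]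
      refine mem_supertileGroup hp h (hy x) hz ?_
      have e1 := congrArg (shiftMap (-t x)) ((ht x).symm.trans e)
      rwa [shiftMap_shiftMap, neg_add_cancel, shiftMap_zero, shiftMap_shiftMap] at e1
    · intro e
      rw [QuotientAddGroup.eq] at e
      obtain ⟨z, hz, e'⟩ := e.1 (y x) (hy x)
      refine ⟨z, hz, ?_⟩
      rw [ht x, e', shiftMap_shiftMap, add_neg_cancel_left]
  have := finite_quotient_supertileGroup h n
  have : DiscreteTopology ((Fin d → ℤ) ⧸ θ.supertileGroup n) :=
    QuotientAddGroup.discreteTopology (isOpen_discrete _)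
  refine ⟨f, ?_, fun x m => ?_, fun x s => (h1 x s).2⟩
  · rw [continuous_iff_isClosed]
    intro S _
    rw [← Set.biUnion_preimage_singleton]
    refine (Set.toFinite S).isClosed_biUnion fun q _ => ?_
    obtain ⟨s, rfl⟩ := QuotientAddGroup.mk_surjective q
    have e : f ⁻¹' {(s : (Fin d → ℤ) ⧸ θ.supertileGroup n)} = Subtype.val ⁻¹'
        ((fun w => shiftMap s (θ.subst^[n] w)) '' θ.shiftSpace.carrier) := by
      ext x
      rw [Set.mem_preimage, Set.mem_singleton_iff, ← h1]
      simp only [Set.mem_preimage, Set.mem_image]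
      exact exists_congr fun z => and_congr_right fun _ => eq_comm
    rw [e]
    refine IsClosed.preimage continuous_subtype_val (IsCompact.isClosed ?_)
    exact θ.shiftSpace.isClosed_carrier.isCompact.image
      ((continuous_shiftMap s).comp (θ.continuous_subst_iterate n))
  · change _ = ((t x : Fin d → ℤ) : (Fin d → ℤ) ⧸ θ.supertileGroup n) + m
    rw [← QuotientAddGroup.mk_add, ← h1]
    refine ⟨y x, hy x, ?_⟩
    change shiftMap m x.1 = _
    rw [ht x, shiftMap_shiftMap, add_comm]

/-- The odometer `lim ℤ^d / L_n` of the supertile groups, as the closure of the image of `Γ`. -/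
def odometer (θ : DigitSubstitution d A) (Γ : AddSubgroup (Fin d → ℤ)) :
    AddSubgroup (∀ n, (Fin d → ℤ) ⧸ θ.supertileGroup n) :=
  (Γ.map (AddMonoidHom.pi fun n => QuotientAddGroup.mk' (θ.supertileGroup n))).topologicalClosure

/-- It is enough to exclude prime torsion. If pc = 0, let v ∈ Γ represent c at the levels n and n₀ +
n + 1. Then pv ∈ Q^(n+1)ℤ^d by weak recognizability, so v ∈ Q^n ℤ^d and c n = 0; the extra level is
spent on p. -/
theorem isAddTorsionFree_odometer [Finite A] [Nonempty A] (hp : θ.IsPrimitive)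
    (h : θ.IsBlockWith ℓ a) (haper : θ.shiftSpace.IsAperiodic) :
    IsAddTorsionFree (θ.odometer Γ) := by
  obtain ⟨n₀, hn₀⟩ := exists_supertileGroup_le hp h haper
  have hdisc : ∀ n, DiscreteTopology ((Fin d → ℤ) ⧸ θ.supertileGroup n) := fun n =>
    QuotientAddGroup.discreteTopology (isOpen_discrete _)
  have hprime : ∀ p : ℕ, p.Prime → ∀ c : θ.odometer Γ, p • c = 0 → c = 0 := by
    rintro p hpp ⟨c, hc⟩ h0
    have h0' : p • c = 0 := congrArg Subtype.val h0
    apply Subtype.ext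
    funext n
    change c n = 0
    have ho : IsOpen (({n, n₀ + (n + 1)} : Set ℕ).pi fun k =>
        ({c k} : Set ((Fin d → ℤ) ⧸ θ.supertileGroup k))) :=
      isOpen_set_pi (Set.toFinite _) fun k _ => isOpen_discrete _
    obtain ⟨_, hb, v, -, rfl⟩ := mem_closure_iff.1 hc _ ho fun k _ => rfl
    have e1 : ((v : Fin d → ℤ) : (Fin d → ℤ) ⧸ θ.supertileGroup n) = c n := hb n (by simp)
    have e2 : ((v : Fin d → ℤ) : (Fin d → ℤ) ⧸ θ.supertileGroup (n₀ + (n + 1))) =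
      c (n₀ + (n + 1)) := hb _ (by simp)
    have e3 := congrFun h0' (n₀ + (n + 1))
    rw [Pi.smul_apply, Pi.zero_apply, ← e2, ← QuotientAddGroup.mk_nsmul,
      QuotientAddGroup.eq_zero_iff] at e3
    obtain ⟨s, hs⟩ := hn₀ (n + 1) _ e3
    rw [← e1, QuotientAddGroup.eq_zero_iff]
    have hdvd : ∀ i, ∃ q, v i = ℓ i ^ n * q := by
      intro i
      have e4 := congrFun hs i
      rw [h.pow_mulVec_apply, Pi.smul_apply, nsmul_eq_mul] at e4
      have := h.two_le i
      exact pow_dvd_of_pow_succ_dvd_prime_mul hpp (by rintro h0; simp [h0] at this)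
        ⟨s i, e4.symm⟩
    choose q hq using hdvd
    have e5 : v = (θ.Q ^ n).mulVec q := funext fun i => by rw [h.pow_mulVec_apply, hq]
    rw [e5]
    exact θ.pow_mulVec_mem_supertileGroup n q
  have hall : ∀ k : ℕ, k ≠ 0 → ∀ c : θ.odometer Γ, k • c = 0 → c = 0 := by
    intro k
    induction k using induction_on_primes with
    | zero => exact fun h => (h rfl).elim
    | one => exact fun _ c hc => by simpa using hc
    | prime_mul p k hpp ih =>
      intro hpk c hc
      exact ih (right_ne_zero_of_mul hpk) c (hprime p hpp _ (by rwa [← mul_nsmul']))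
  refine ⟨fun k hk c c' e => ?_⟩
  simp only at e
  rw [← sub_eq_zero, ← nsmul_sub] at e
  exact sub_eq_zero.1 (hall k hk _ e)

/-- The factor map π records the classes of the cuts at all levels relative to x₀. Points with the
same image have the same cuts, so every equicontinuous factor is constant on the fibres of π and
descends along this quotient map. -/
theorem hasTorsionFreeMEF_latticeSubshift [Finite A] [Nonempty A] (hp : θ.IsPrimitive)
    (h : θ.IsBlockWith ℓ a) (haper : θ.shiftSpace.IsAperiodic) (hΓ : θ.IsHeightLattice Γ)
    (hτ : θ.IsClassMap Γ τ x₀) {H : Matrix (Fin d) (Fin d) ℤ} (hH : columnLattice H = Γ)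
    (W : Finset (Fin d → ℤ))
    (hinv : ∀ x ∈ θ.zeroClass τ, ∀ q, shiftMap (H.mulVec q) x ∈ θ.zeroClass τ)
    (hW : ∀ m, ∃ w ∈ W, ∃ q, w + H.mulVec q = m) :
    HasTorsionFreeMEF (latticeSubshift W hinv isClosed_zeroClass).act := by
  classical
  have hdisc : ∀ n, DiscreteTopology ((Fin d → ℤ) ⧸ θ.supertileGroup n) := fun n =>
    QuotientAddGroup.discreteTopology (isOpen_discrete _)
  have hfin := finite_quotient_supertileGroup h
  set Y := latticeSubshift W hinv isClosed_zeroClass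
  set e : θ.zeroClass τ ≃ₜ Y := latticeHomeo W hinv isClosed_zeroClass hW
  have he : ∀ x q, Y.act q (e x) = e ⟨shiftMap (H.mulVec q) x.1, hinv x.1 x.2 q⟩ :=
    act_latticeHomeo W hinv isClosed_zeroClass hW
  have hes : ∀ y q, (e.symm (Y.act q y)).1 = shiftMap (H.mulVec q) (e.symm y).1 := by
    intro y q
    obtain ⟨x, rfl⟩ := e.surjective y
    rw [he, e.symm_apply_apply, e.symm_apply_apply]
  choose f hfc hfa hf using exists_supertileClass hp h
  let x₁ : θ.shiftSpace := ⟨x₀, hτ.mem⟩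
  let K := θ.odometer Γ
  let β : (Fin d → ℤ) →+ ∀ n, (Fin d → ℤ) ⧸ θ.supertileGroup n :=
    AddMonoidHom.pi fun n => QuotientAddGroup.mk' (θ.supertileGroup n)
  have hβK : ∀ v ∈ Γ, β v ∈ K := fun v hv => AddSubgroup.le_topologicalClosure _ ⟨v, hv, rfl⟩
  have hKc : IsClosed (K : Set (∀ n, (Fin d → ℤ) ⧸ θ.supertileGroup n)) :=
    AddSubgroup.isClosed_topologicalClosure _
  let p : θ.shiftSpace → ∀ n, (Fin d → ℤ) ⧸ θ.supertileGroup n := fun x n => f n x - f n x₁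
  have hpc : Continuous p := continuous_pi fun n => (hfc n).sub continuous_const
  have hpa : ∀ x m, p (θ.shiftSpace.act m x) = p x + β m := by
    intro x m
    funext n
    change f n (θ.shiftSpace.act m x) - f n x₁ = f n x - f n x₁ + m
    rw [hfa, add_sub_right_comm]
  have hp0 : p x₁ = 0 := funext fun n => sub_self _
  have hpK : ∀ x : θ.zeroClass τ, p ⟨x.1, x.2.1⟩ ∈ K := by
    intro x
    let C : Set ((Fin d → ℤ) → A) := Subtype.val '' (p ⁻¹' (K : Set _))
    have hC : IsClosed C :=
      θ.shiftSpace.isClosed_carrier.isClosedEmbedding_subtypeVal.isClosedMap _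
        (hKc.preimage hpc)
    obtain ⟨y, hy, e⟩ : x.1 ∈ C :=
      hτ.mem_of_isClosed hp h hC hτ.mem x.2.1 (hτ.zero.trans x.2.2.symm) fun m hm => by
        refine ⟨θ.shiftSpace.act m x₁, ?_, rfl⟩
        rw [Set.mem_preimage, hpa, hp0, zero_add]
        exact hβK m hm
    have e' : y = ⟨x.1, x.2.1⟩ := Subtype.ext e
    rw [← e']
    exact hy
  have hHΓ : ∀ q, H.mulVec q ∈ Γ := fun q => hH ▸ ⟨q, rfl⟩
  let α : (Fin d → ℤ) →+ K := (β.comp H.mulVecLin.toAddMonoidHom).codRestrict K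
    fun q => hβK _ (hHΓ q)
  let π : Y → K := fun y => ⟨p ⟨(e.symm y).1, (e.symm y).2.1⟩, hpK _⟩
  have hπc : Continuous π := by
    refine Continuous.subtype_mk (hpc.comp ?_) _
    exact (continuous_subtype_val.comp e.symm.continuous).subtype_mk _
  have hπa : ∀ q y, π (Y.act q y) = α q + π y := by
    intro q y
    apply Subtype.ext
    change p _ = β (H.mulVec q) + p ⟨(e.symm y).1, (e.symm y).2.1⟩
    rw [add_comm, ← hpa]
    congr 1
    exact Subtype.ext (hes y q)
  have hYc : CompactSpace Y := isCompact_iff_compactSpace.1 Y.isClosed_carrier.isCompact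
  have hπs : Function.Surjective π := by
    have h1 : (K : Set (∀ n, (Fin d → ℤ) ⧸ θ.supertileGroup n)) ⊆
        Set.range fun y => (π y).1 := by
      refine closure_minimal ?_ (isCompact_range (continuous_subtype_val.comp hπc)).isClosed
      rintro _ ⟨v, hv, rfl⟩
      obtain ⟨q, rfl⟩ : ∃ q, H.mulVec q = v := by rw [← hH] at hv; exact hv
      refine ⟨Y.act q (e ⟨x₀, hτ.mem, hτ.zero⟩), ?_⟩
      change p _ = β (H.mulVec q)
      have h2 : (⟨(e.symm (Y.act q (e ⟨x₀, hτ.mem, hτ.zero⟩))).1,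
          (e.symm (Y.act q (e ⟨x₀, hτ.mem, hτ.zero⟩))).2.1⟩ : θ.shiftSpace) =
          θ.shiftSpace.act (H.mulVec q) x₁ := by
        apply Subtype.ext
        change (e.symm (Y.act q (e ⟨x₀, hτ.mem, hτ.zero⟩))).1 = shiftMap (H.mulVec q) x₀
        rw [hes, e.symm_apply_apply]
      rw [h2, hpa, hp0, zero_add]
    rintro ⟨c, hc⟩
    obtain ⟨y, hy⟩ := h1 hc
    exact ⟨y, Subtype.ext hy⟩
  let _ : UniformSpace K := IsTopologicalAddGroup.rightUniformSpace K
  have : IsUniformAddGroup K := isUniformAddGroup_of_addCommGroup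
  have hKcomp : CompactSpace K := isCompact_iff_compactSpace.1 hKc.isCompact
  refine ⟨K, inferInstance, inferInstance, inferInstance, hKcomp, inferInstance, α, π,
    ⟨⟨hπc, hπs, hπa, ?_⟩, ?_⟩, isAddTorsionFree_odometer hp h haper⟩
  · refine UniformEquicontinuous.equicontinuous fun U hU => ?_
    rw [uniformity_eq_comap_nhds_zero K] at hU ⊢
    obtain ⟨V, hV, hVU⟩ := hU
    refine ⟨V, hV, fun x hx g => hVU ?_⟩
    change α g + x.2 - (α g + x.1) ∈ V
    rw [add_sub_add_left_eq_sub]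
    exact hx
  · intro Z _ _ _ R q hq
    have hquot : IsQuotientMap π := hπc.isClosedMap.isQuotientMap hπc hπs
    -- The value outside the zero class is arbitrary and plays no role.
    let P : ((Fin d → ℤ) → A) → Z := fun x =>
      if hx : x ∈ θ.zeroClass τ then q (e ⟨x, hx⟩) else q (e ⟨x₀, hτ.mem, hτ.zero⟩)
    have hP : ∀ x : θ.zeroClass τ, P x.1 = q (e x) := fun x => dif_pos x.2
    have hPc : ContinuousOn P (θ.zeroClass τ) := by
      rw [continuousOn_iff_continuous_domRestrict]
      convert hq.continuous.comp e.continuous using 1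
      exact funext hP
    have hPR : ∀ x ∈ θ.zeroClass τ, ∀ v, P (shiftMap (H.mulVec v) x) = R v (P x) := by
      intro x hx v
      have h1 := hP ⟨x, hx⟩
      have h2 := hP ⟨_, hinv x hx v⟩
      rw [h1, h2, ← he ⟨x, hx⟩, hq.equivariant]
    have hfac : Function.FactorsThrough q π := by
      intro y y' hyy'
      have h1 := eq_of_forall_exists_eq_shiftMap hp h hΓ hτ hH hq.equicontinuous hPc hPR
        (e.symm y).2 (e.symm y').2 fun n => ?_
      · rwa [hP, hP, e.apply_symm_apply, e.apply_symm_apply] at h1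
      · obtain ⟨t, ht⟩ := QuotientAddGroup.mk_surjective (f n ⟨(e.symm y).1, (e.symm y).2.1⟩)
        have h2 : f n ⟨(e.symm y).1, (e.symm y).2.1⟩ = f n ⟨(e.symm y').1, (e.symm y').2.1⟩ :=
          sub_left_injective (congrFun (congrArg Subtype.val hyy') n)
        obtain ⟨z, hz, hz'⟩ := hf n _ t ht.symm
        obtain ⟨w, hw, hw'⟩ := hf n _ t (h2.symm.trans ht.symm)
        exact ⟨t, z, hz, w, hw, hz', hw'⟩
    exact ⟨hquot.lift (f := ⟨π, hπc⟩) ⟨q, hq.continuous⟩ hfac, ContinuousMap.continuous _,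
      funext fun y => (DFunLike.congr_fun
        (hquot.lift_comp (f := ⟨π, hπc⟩) ⟨q, hq.continuous⟩ hfac) y).symm⟩

end DigitSubstitution

/-! ### Boxes as fundamental domains of lattices -/

/-- The diagonal entries of a triangular basis of `Λ`. -/
structure IsTriangular {d : ℕ} (Λ : AddSubgroup (Fin d → ℤ)) (h : Fin d → ℤ) : Prop where
  pos : ∀ i, 0 < h i
  dvd : ∀ g ∈ Λ, ∀ i, (∀ j < i, g j = 0) → h i ∣ g i
  exists_eq : ∀ i, ∃ b ∈ Λ, (∀ j < i, b j = 0) ∧ b i = h i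

/-- Take for h i the positive generator of the group of i-th coordinates of vectors of Λ whose
earlier coordinates vanish; it is nonzero because the index of Λ belongs to this group. -/
theorem exists_isTriangular {d : ℕ} (Λ : AddSubgroup (Fin d → ℤ)) [Finite ((Fin d → ℤ) ⧸ Λ)] :
    ∃ h, IsTriangular Λ h := by
  have key : ∀ i : Fin d, ∃ h : ℤ, 0 < h ∧ (∀ g ∈ Λ, (∀ j < i, g j = 0) → h ∣ g i) ∧
      ∃ b ∈ Λ, (∀ j < i, b j = 0) ∧ b i = h := by
    intro i
    let S : AddSubgroup ℤ :=
      { carrier := {z | ∃ g ∈ Λ, (∀ j < i, g j = 0) ∧ g i = z}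
        zero_mem' := ⟨0, Λ.zero_mem, fun _ _ => rfl, rfl⟩
        add_mem' := by
          rintro _ _ ⟨g, hg, hg', rfl⟩ ⟨g', h1, h2, rfl⟩
          exact ⟨g + g', Λ.add_mem hg h1, fun j hj => by simp [hg' j hj, h2 j hj], rfl⟩
        neg_mem' := by
          rintro _ ⟨g, hg, hg', rfl⟩
          exact ⟨-g, Λ.neg_mem hg, fun j hj => by simp [hg' j hj], rfl⟩ }
    have hN : Nat.card ((Fin d → ℤ) ⧸ Λ) • (Pi.single i 1 : Fin d → ℤ) ∈ Λ := by
      rw [← QuotientAddGroup.eq_zero_iff, QuotientAddGroup.mk_nsmul]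
      exact card_nsmul_eq_zero'
    have hNS : (Nat.card ((Fin d → ℤ) ⧸ Λ) : ℤ) ∈ S :=
      ⟨_, hN, fun j hj => by simp [hj.ne], by simp⟩
    obtain ⟨n, hn⟩ := Int.subgroup_cyclic S
    have hS : ∀ z, z ∈ S ↔ |n| ∣ z := fun z => by
      rw [hn, ← AddSubgroup.zmultiples_eq_closure, Int.mem_zmultiples_iff, abs_dvd]
    have hn0 : n ≠ 0 := by
      rintro rfl
      rw [hS, abs_zero, zero_dvd_iff] at hNS
      exact Nat.card_pos.ne' (by exact_mod_cast hNS)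
    exact ⟨|n|, abs_pos.2 hn0, fun g hg hg' => (hS _).1 ⟨g, hg, hg', rfl⟩,
      (hS |n|).2 dvd_rfl⟩
  choose h h1 h2 h3 using key
  exact ⟨h, h1, fun g hg i => h2 i g hg, h3⟩

namespace IsTriangular

variable {d : ℕ} {Λ : AddSubgroup (Fin d → ℤ)} {h : Fin d → ℤ}

/-- The uniqueness half of the fact that a box with sides h i is a fundamental domain;
`exists_sub_mem_box` is the existence half. -/
theorem eq_zero (hh : IsTriangular Λ h) {g : Fin d → ℤ} (hg : g ∈ Λ) (hlt : ∀ i, |g i| < h i) :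
    g = 0 := by
  funext i
  induction i using WellFoundedLT.induction with
  | ind i ih => exact Int.eq_zero_of_abs_lt_dvd (hh.dvd g hg i ih) (hlt i)

theorem exists_sub_mem_box (hh : IsTriangular Λ h) (m : Fin d → ℤ) :
    ∃ g ∈ Λ, ∀ i, 0 ≤ m i - g i ∧ m i - g i < h i := by
  suffices H : ∀ n : ℕ, ∃ g ∈ Λ, ∀ i : Fin d, i.1 < n → 0 ≤ m i - g i ∧ m i - g i < h i by
    obtain ⟨g, hg, hg'⟩ := H d
    exact ⟨g, hg, fun i => hg' i i.2⟩
  intro n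
  induction n with
  | zero => exact ⟨0, Λ.zero_mem, fun i hi => (Nat.not_lt_zero _ hi).elim⟩
  | succ n ih =>
    obtain ⟨g, hg, hg'⟩ := ih
    by_cases hn : n < d
    · obtain ⟨b, hb, hb0, hbn⟩ := hh.exists_eq ⟨n, hn⟩
      refine ⟨g + ((m ⟨n, hn⟩ - g ⟨n, hn⟩) / h ⟨n, hn⟩) • b,
        Λ.add_mem hg (Λ.zsmul_mem hb _), fun i hi => ?_⟩
      rcases Nat.lt_succ_iff_lt_or_eq.1 hi with hlt | heq
      · have := hb0 i hlt
        simpa [this] using hg' i hlt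
      · obtain rfl : i = ⟨n, hn⟩ := Fin.ext heq
        have e : m ⟨n, hn⟩ - (g + ((m ⟨n, hn⟩ - g ⟨n, hn⟩) / h ⟨n, hn⟩) • b) ⟨n, hn⟩ =
            (m ⟨n, hn⟩ - g ⟨n, hn⟩) % h ⟨n, hn⟩ := by
          rw [Pi.add_apply, Pi.smul_apply, hbn, smul_eq_mul, Int.emod_def]; ring
        rw [e]
        exact ⟨Int.emod_nonneg _ (hh.pos _).ne', Int.emod_lt_of_pos _ (hh.pos _)⟩
    · exact ⟨g, hg, fun i _ => hg' i (by omega)⟩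

end IsTriangular

/-! ### Division with remainder in one dimension -/

/-- A potential that decreases under division by an integer of modulus at least `2`. -/
def divPotential (n : ℤ) : ℕ := 2 * n.natAbs + if n < 0 then 1 else 0

/-- For l > 0 the number -1 is its own quotient, hence the sign condition. For l < 0 the quotient of
-1 is 1, so the modulus alone need not decrease; the extra unit for negative numbers repairs this.
-/
theorem divPotential_lt {l n q : ℤ} (hl : 2 ≤ |l|) (hn : 0 ≤ n ∨ l < 0) (h0 : 0 ≤ n - l * q)
    (h1 : n - l * q < |l|) :
    (0 ≤ q ∨ l < 0) ∧ (n = 0 → q = 0) ∧ (n ≠ 0 → divPotential q < divPotential n) := by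
  rcases lt_or_ge l 0 with hneg | hpos
  · rw [abs_of_neg hneg] at hl h1
    refine ⟨Or.inr hneg, ?_, ?_⟩
    · rintro rfl
      have h2 : q < 1 := by nlinarith
      have h3 : -1 < q := by nlinarith
      omega
    · intro hn0
      rcases lt_or_gt_of_ne hn0 with hlt | hgt
      · have h2 : 0 < q := by nlinarith
        have h3 : 2 * (q - 1) ≤ -l * (q - 1) := by nlinarith
        have h4 : 2 * (q - 1) < -n := by linarith
        unfold divPotential
        rw [if_pos hlt, if_neg (by omega)]
        omega
      · have h2 : q < 1 := by nlinarith
        have h3 : 2 * (-q) ≤ -l * (-q) := by nlinarith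
        have h4 : 2 * (-q) ≤ n := by linarith
        unfold divPotential
        rw [if_neg (not_lt.2 hgt.le)]
        split_ifs <;> omega
  · rw [abs_of_nonneg hpos] at hl h1
    have hn' : 0 ≤ n := hn.resolve_right (not_lt.2 hpos)
    have h2 : -1 < q := by nlinarith
    have h3 : 2 * q ≤ l * q := by nlinarith
    refine ⟨Or.inl (by omega), fun _ => by omega, fun _ => ?_⟩
    unfold divPotential
    rw [if_neg (by omega), if_neg (by omega)]
    omega

theorem eq_zero_of_divPotential_le {l : ℤ} (hl : 2 ≤ |l|) {ν : ℕ → ℤ}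
    (hν : ∀ k, 0 ≤ ν k - l * ν (k + 1) ∧ ν k - l * ν (k + 1) < |l|) (h0 : 0 ≤ ν 0 ∨ l < 0)
    {k : ℕ} (hk : divPotential (ν 0) ≤ k) : ν k = 0 := by
  have h1 : ∀ k, (0 ≤ ν k ∨ l < 0) ∧ (ν k = 0 ∨ divPotential (ν k) + k ≤ divPotential (ν 0)) := by
    intro k
    induction k with
    | zero => exact ⟨h0, Or.inr le_rfl⟩
    | succ k ih =>
      obtain ⟨h2, h3, h4⟩ := divPotential_lt hl ih.1 (hν k).1 (hν k).2
      refine ⟨h2, ?_⟩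
      by_cases hz : ν k = 0
      · exact Or.inl (h3 hz)
      · have := h4 hz
        have := ih.2.resolve_left hz
        exact Or.inr (by omega)
  rcases (h1 k).2 with h2 | h2
  · exact h2
  · have h3 : divPotential (ν k) = 0 := by omega
    unfold divPotential at h3
    omega

/-- Division in a lattice with remainders in a box: starting from the points of a suitable ball,
iterated quotients eventually vanish. -/
theorem exists_ball_iterate_eq_zero {d : ℕ} {Λ : AddSubgroup (Fin d → ℤ)} {h ℓ : Fin d → ℤ}
    (hh : IsTriangular Λ h) (hℓ : ∀ i, 2 ≤ |ℓ i|) {p : (Fin d → ℤ) → Fin d → ℤ}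
    (hp : ∀ g ∈ Λ, p g ∈ Λ) (hp' : ∀ g ∈ Λ, ∀ i, 0 ≤ g i - ℓ i * p g i ∧
      g i - ℓ i * p g i < h i * |ℓ i|) (r : ℤ) (hr : 0 ≤ r) :
    ∃ (c : Fin d → ℤ) (k₀ : ℕ), ∀ g ∈ Λ, (∀ i, c i ≤ g i ∧ g i ≤ c i + r) →
      ∀ k ≥ k₀, p^[k] g = 0 := by
  have hmem : ∀ g ∈ Λ, ∀ k, p^[k] g ∈ Λ := by
    intro g hg k
    induction k with
    | zero => exact hg
    | succ k ih => rw [Function.iterate_succ_apply']; exact hp _ ih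
  suffices H : ∀ n : ℕ, ∃ (c : Fin d → ℤ) (k₀ : ℕ), ∀ g ∈ Λ,
      (∀ i : Fin d, i.1 < n → c i ≤ g i ∧ g i ≤ c i + r) →
        ∀ k ≥ k₀, ∀ i : Fin d, i.1 < n → p^[k] g i = 0 by
    obtain ⟨c, k₀, hc⟩ := H d
    exact ⟨c, k₀, fun g hg hg' k hk => funext fun i => hc g hg (fun i _ => hg' i) k hk i i.2⟩
  intro n
  induction n with
  | zero => exact ⟨0, 0, fun g _ _ k _ i hi => (Nat.not_lt_zero _ hi).elim⟩
  | succ n ih =>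
    obtain ⟨c, k₀, hc⟩ := ih
    by_cases hn : n < d
    swap
    · exact ⟨c, k₀, fun g hg hg' k hk i _ =>
        hc g hg (fun i _ => hg' i (by omega)) k hk i (by omega)⟩
    set j : Fin d := ⟨n, hn⟩
    have hhj := hh.pos j
    have hlj := hℓ j
    -- the bounds that keep the coordinate nonnegative during the first `k₀` steps
    let M : ℕ → ℤ := fun k => k.rec 0 fun _ m => ℓ j * (m + h j)
    have hM : ∀ k, M (k + 1) = ℓ j * (M k + h j) := fun k => rfl
    have hlow : 0 < ℓ j → ∀ k, ∀ g ∈ Λ, M k ≤ g j → 0 ≤ p^[k] g j := by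
      intro hpos k
      induction k with
      | zero => exact fun g _ hg' => hg'
      | succ k ih =>
        intro g hg hg'
        rw [Function.iterate_succ_apply]
        refine ih _ (hp g hg) ?_
        have h1 := (hp' g hg j).2
        rw [abs_of_pos hpos] at h1
        rw [hM] at hg'
        by_contra! hlt
        nlinarith
    have hup : ∀ k, ∀ g ∈ Λ, |p^[k] g j| ≤ |g j| + k * h j := by
      intro k
      induction k with
      | zero => intro g _; simp
      | succ k ih =>
        intro g hg
        rw [Function.iterate_succ_apply']
        refine le_trans ?_ (add_le_add_left (ih g hg) (h j) |>.trans (by push_cast; linarith))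
        obtain ⟨h1, h2⟩ := hp' _ (hmem g hg k) j
        set u := p^[k] g
        have h3 : |ℓ j| * |p u j| ≤ |u j| + h j * |ℓ j| := by
          rw [← abs_mul]
          have h4 : ℓ j * p u j = u j - (u j - ℓ j * p u j) := by ring
          rw [h4]
          refine (abs_sub _ _).trans ?_
          rw [abs_of_nonneg h1]
          linarith
        by_contra! hlt
        nlinarith [abs_nonneg (u j), abs_nonneg (p u j)]
    let B : ℤ := |M k₀| + r + k₀ * h j
    -- After k₀ steps the earlier coordinates vanish, so coordinate j is divisible by h j and the
    -- quotients ν follow one-dimensional division by ℓ j. Starting above M k₀ makes ν 0 nonnegative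
    -- if ℓ j > 0, and 2B + 1 bounds its potential.
    refine ⟨fun i => if i = j then M k₀ else c i, k₀ + (2 * B.toNat + 1), ?_⟩
    intro g hg hg' k hk i hi
    beta_reduce at hg'
    have hg1 : ∀ i : Fin d, i.1 < n → c i ≤ g i ∧ g i ≤ c i + r := fun i hi => by
      have := hg' i (by omega)
      rwa [if_neg (by rintro rfl; exact lt_irrefl _ hi)] at this
    have hzero := hc g hg hg1
    rcases Nat.lt_succ_iff_lt_or_eq.1 hi with hlt | heq
    · exact hzero k (by omega) i hlt
    obtain rfl : i = j := Fin.ext heq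
    have hgj := hg' j hi
    rw [if_pos rfl] at hgj
    have hdvd : ∀ m, h j ∣ p^[k₀ + m] g j := fun m =>
      hh.dvd _ (hmem g hg _) j fun j' hi' => hzero _ (by omega) j' (by
        have : j'.1 < j.1 := hi'
        omega)
    choose ν hν using hdvd
    have hstep : ∀ m, 0 ≤ ν m - ℓ j * ν (m + 1) ∧ ν m - ℓ j * ν (m + 1) < |ℓ j| := by
      intro m
      have h1 := hp' _ (hmem g hg (k₀ + m)) j
      rw [← Function.iterate_succ_apply' p, hν, Nat.succ_eq_add_one, add_assoc k₀, hν] at h1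
      have e : h j * ν m - ℓ j * (h j * ν (m + 1)) = h j * (ν m - ℓ j * ν (m + 1)) := by ring
      rw [e] at h1
      exact ⟨nonneg_of_mul_nonneg_right h1.1 hhj, lt_of_mul_lt_mul_left h1.2 hhj.le⟩
    have hstart : 0 ≤ ν 0 ∨ ℓ j < 0 := by
      rcases lt_or_ge (ℓ j) 0 with hneg | hpos
      · exact Or.inr hneg
      · left
        have hpos' : 0 < ℓ j := lt_of_le_of_ne hpos (by rintro h0; rw [← h0] at hlj; simp at hlj)
        have h1 := hlow hpos' k₀ g hg hgj.1
        rw [← add_zero k₀, hν] at h1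
        exact nonneg_of_mul_nonneg_right h1 hhj
    have hpot : divPotential (ν 0) ≤ 2 * B.toNat + 1 := by
      have h1 := hup k₀ g hg
      have h2 : |g j| ≤ |M k₀| + r := by
        rw [abs_le]
        constructor
        · linarith [neg_abs_le (M k₀)]
        · linarith [le_abs_self (M k₀)]
      have h3 : |h j * ν 0| ≤ B := by
        rw [← hν, add_zero]
        exact h1.trans (by simp only [B]; linarith)
      have h4 : |ν 0| ≤ B := by
        rw [abs_mul, abs_of_pos hhj] at h3
        nlinarith [abs_nonneg (ν 0)]
      rw [Int.abs_eq_natAbs] at h4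
      have h5 : (ν 0).natAbs ≤ B.toNat := by omega
      unfold divPotential
      split_ifs <;> omega
    obtain ⟨m, rfl⟩ : ∃ m, k = k₀ + m := ⟨k - k₀, by omega⟩
    rw [hν, eq_zero_of_divPotential_le hlj hstep hstart (k := m) (by omega), mul_zero]

/-! ### Coprime sublattices for diagonal matrices -/

theorem AddSubgroup.mem_of_zsmul_mem_of_isCoprime {G : Type*} [AddCommGroup G]
    {M : AddSubgroup G} {k p : ℤ} (hkp : IsCoprime k p) {z : G} (hk : k • z ∈ M)
    (hp : p • z ∈ M) : z ∈ M := by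
  obtain ⟨u, v, e⟩ := hkp
  have h1 := M.add_mem (M.zsmul_mem hk u) (M.zsmul_mem hp v)
  rwa [← mul_zsmul', ← mul_zsmul', ← add_zsmul, mul_comm k, mul_comm p, e, one_zsmul] at h1

section Coprime

variable {d : ℕ} {Γ M₀ : AddSubgroup (Fin d → ℤ)} {ℓ : Fin d → ℤ}

/-- Let p divide ℓ i. If the order of the i-th unit vector modulo Γ were pm, then ℓ would map its
m-fold multiple into Γ, so this multiple would lie in Γ already. Hence the order is prime to p; K is
a product of such orders. -/
theorem exists_isCoprime_single_mem [Finite ((Fin d → ℤ) ⧸ Γ)]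
    (hΓ : ∀ v : Fin d → ℤ, ℓ * v ∈ Γ → v ∈ Γ) {p : ℤ} (hp : Prime p) :
    ∃ K : ℤ, IsCoprime K p ∧ ∀ i, p ∣ ℓ i → Pi.single i K ∈ Γ := by
  have h1 : ∀ i : Fin d, ∃ k : ℤ, IsCoprime k p ∧ (p ∣ ℓ i → Pi.single i k ∈ Γ) := by
    intro i
    by_cases hi : p ∣ ℓ i
    swap
    · exact ⟨1, isCoprime_one_left, fun h => (hi h).elim⟩
    have hpos : 0 < addOrderOf ((Pi.single i 1 : Fin d → ℤ) : (Fin d → ℤ) ⧸ Γ) :=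
      addOrderOf_pos _
    set n := addOrderOf ((Pi.single i 1 : Fin d → ℤ) : (Fin d → ℤ) ⧸ Γ) with hn
    have hmem : ∀ k : ℤ, Pi.single i k ∈ Γ ↔ (n : ℤ) ∣ k := by
      intro k
      rw [hn, addOrderOf_dvd_iff_zsmul_eq_zero, ← QuotientAddGroup.mk_zsmul,
        QuotientAddGroup.eq_zero_iff]
      have e : k • (Pi.single i 1 : Fin d → ℤ) = Pi.single i k := by
        rw [← Pi.single_smul]; simp
      rw [e]
    refine ⟨n, ?_, fun _ => (hmem n).2 dvd_rfl⟩
    refine ((Prime.coprime_iff_not_dvd hp).2 ?_).symm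
    rintro ⟨m, hm⟩
    obtain ⟨e, he⟩ := hi
    have h2 : Pi.single i m ∈ Γ := by
      refine hΓ _ ?_
      have e1 : ℓ * Pi.single i m = Pi.single i (ℓ i * m) := by
        funext j
        by_cases hj : j = i
        · subst hj; simp
        · simp [hj]
      rw [e1, hmem, he, hm]
      exact ⟨e, by ring⟩
    rw [hmem] at h2
    have hm0 : m ≠ 0 := by rintro rfl; simp at hm; omega
    have h3 : p * m ∣ 1 * m := by rw [← hm, one_mul]; exact h2
    exact hp.not_isUnit (isUnit_of_dvd_one ((mul_dvd_mul_iff_right hm0).1 h3))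
  choose k hk hk' using h1
  refine ⟨∏ i, k i, IsCoprime.prod_left fun i _ => hk i, fun i hi => ?_⟩
  obtain ⟨c, hc⟩ := Finset.dvd_prod_of_mem k (Finset.mem_univ i)
  have e : (Pi.single i (∏ i, k i) : Fin d → ℤ) = c • Pi.single i (k i) := by
    rw [← Pi.single_smul, hc, smul_eq_mul, mul_comm]
  rw [e]
  exact Γ.zsmul_mem (hk' i hi) c

/-- Coordinates with p ∣ ℓ i contribute to pΓ, after multiplication by K. On the others ℓ is
invertible modulo p, so up to a factor prime to p their part lies in ℓ^m Γ ⊆ M₀. Since pℓg ∈ pΓ as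
well, the factor can be removed. -/
theorem mul_mem_sup_of_prime [Finite ((Fin d → ℤ) ⧸ Γ)]
    (hΓ : ∀ v : Fin d → ℤ, ℓ * v ∈ Γ ↔ v ∈ Γ) {m : ℕ} (hm : ∀ v ∈ Γ, ℓ ^ m * v ∈ M₀)
    {p : ℤ} (hp : Prime p) {g : Fin d → ℤ} (hg : g ∈ Γ) :
    ∃ v ∈ Γ, ℓ * g - p • v ∈ M₀ := by
  classical
  obtain ⟨K, hKp, hK⟩ := exists_isCoprime_single_mem (fun v => (hΓ v).1) hp
  let M : AddSubgroup (Fin d → ℤ) := M₀ ⊔ Γ.map (zsmulAddGroupHom p)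
  suffices H : ℓ * g ∈ M by
    obtain ⟨u, hu, _, ⟨v, hv, rfl⟩, e⟩ := AddSubgroup.mem_sup.1 H
    refine ⟨v, hv, ?_⟩
    rw [← e]
    simpa using hu
  have hpM : ∀ v ∈ Γ, p • v ∈ M := fun v hv => (le_sup_right : _ ≤ M) ⟨v, hv, rfl⟩
  have hM₀ : ∀ v ∈ M₀, v ∈ M := fun v hv => (le_sup_left : _ ≤ M) hv
  -- the projection to the coordinates with `p ∣ ℓ i`, multiplied by `K`
  have hS : ∀ v : Fin d → ℤ, (fun i => if p ∣ ℓ i then K * v i else 0) ∈ Γ := by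
    intro v
    have e : (fun i => if p ∣ ℓ i then K * v i else 0) =
        ∑ i, if p ∣ ℓ i then v i • (Pi.single i K : Fin d → ℤ) else 0 := by
      funext j
      rw [Finset.sum_apply, Finset.sum_eq_single j]
      · split_ifs <;> simp [mul_comm]
      · intro i _ hij
        split_ifs <;> simp [hij.symm]
      · simp
    rw [e]
    refine Γ.sum_mem fun i _ => ?_
    split_ifs with hi
    · exact Γ.zsmul_mem (hK i hi) _
    · exact Γ.zero_mem
  have hf : ∃ f : ℤ, IsCoprime f p ∧ ∀ i, ¬ p ∣ ℓ i → ℓ i ∣ f := by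
    refine ⟨∏ i, if p ∣ ℓ i then 1 else ℓ i, IsCoprime.prod_left fun i _ => ?_, fun i hi => ?_⟩
    · split_ifs with hi
      · exact isCoprime_one_left
      · exact ((Prime.coprime_iff_not_dvd hp).2 hi).symm
    · have := Finset.dvd_prod_of_mem (fun i => if p ∣ ℓ i then 1 else ℓ i) (Finset.mem_univ i)
      simpa only [if_neg hi] using this
  obtain ⟨f, hfp, hf⟩ := hf
  have hc : ∀ i, ∃ c, ¬ p ∣ ℓ i → f = ℓ i * c := fun i => by
    by_cases hi : p ∣ ℓ i
    · exact ⟨0, fun h => (h hi).elim⟩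
    · obtain ⟨c, hc⟩ := hf i hi
      exact ⟨c, fun _ => hc⟩
  have he : ∀ i, ∃ e, p ∣ ℓ i → ℓ i = p * e := fun i => by
    by_cases hi : p ∣ ℓ i
    · obtain ⟨c, hc⟩ := hi
      exact ⟨c, fun _ => hc⟩
    · exact ⟨0, fun h => (hi h).elim⟩
  choose c hc using hc
  choose e he using he
  have hpow : ∀ n, ∀ v : Fin d → ℤ, ℓ ^ n * v ∈ Γ ↔ v ∈ Γ := by
    intro n
    induction n with
    | zero => simp
    | succ n ih => intro v; rw [pow_succ', mul_assoc, hΓ, ih]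
  set w : Fin d → ℤ := fun i => if p ∣ ℓ i then 0 else K * g i with hw
  have hwΓ : w ∈ Γ := by
    have e1 : w = K • g - fun i => if p ∣ ℓ i then K * g i else 0 := by
      funext i
      simp only [hw, Pi.sub_apply, Pi.smul_apply, smul_eq_mul]
      split_ifs <;> ring
    rw [e1]
    exact Γ.sub_mem (Γ.zsmul_mem hg K) (hS g)
  -- This is ℓ^(-m) f^m w, integral because ℓ i divides f wherever w i may be nonzero; it lies in Γ
  -- because ℓ^m z does.
  set z : Fin d → ℤ := fun i => if p ∣ ℓ i then 0 else K * g i * c i ^ m with hz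
  have hzw : ℓ ^ m * z = f ^ m • w := by
    funext i
    simp only [hz, hw, Pi.mul_apply, Pi.pow_apply, Pi.smul_apply, smul_eq_mul]
    split_ifs with hi
    · simp
    · rw [hc i hi]; ring
  have hzΓ : z ∈ Γ := by
    rw [← hpow m, hzw]
    exact Γ.zsmul_mem hwΓ _
  refine AddSubgroup.mem_of_zsmul_mem_of_isCoprime
    (k := f ^ m * K) ((hfp.pow_left (m := m)).mul_left hKp) ?_ (hpM _ ((hΓ g).2 hg))
  have key : (f ^ m * K) • (ℓ * g) =
      ℓ ^ m * (ℓ * z) + f ^ m • p • fun i => if p ∣ ℓ i then K * (e i * g i) else 0 := by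
    funext i
    simp only [hz, Pi.mul_apply, Pi.pow_apply, Pi.smul_apply, Pi.add_apply, smul_eq_mul]
    split_ifs with hi
    · rw [he i hi]; ring
    · rw [hc i hi]; ring
  rw [key]
  exact M.add_mem (hM₀ _ (hm _ ((hΓ z).2 hzΓ)))
    (M.zsmul_mem (hpM _ (hS fun i => e i * g i)) _)

/-- For ℓ-invariant M₀ one would iterate the last hypothesis. In general `mul_mem_sup_of_prime`
gives Γ ⊆ M₀ + pΓ for every prime p, hence Γ ⊆ M₀ + nΓ for every n ≠ 0; with f the product of the ℓ
i and n = |f^m|, the second summand lies in ℓ^m Γ ⊆ M₀. -/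
theorem le_of_sub_mul_mem [Finite ((Fin d → ℤ) ⧸ Γ)] (hℓ : ∀ i, ℓ i ≠ 0)
    (hΓ : ∀ v : Fin d → ℤ, ℓ * v ∈ Γ ↔ v ∈ Γ) {m : ℕ} (hm : ∀ v ∈ Γ, ℓ ^ m * v ∈ M₀)
    (hsup : ∀ g ∈ Γ, ∃ v ∈ Γ, g - ℓ * v ∈ M₀) : Γ ≤ M₀ := by
  have hprime : ∀ p : ℕ, p.Prime → ∀ g ∈ Γ, ∃ v ∈ Γ, g - p • v ∈ M₀ := by
    intro p hp g hg
    obtain ⟨v, hv, hgv⟩ := hsup g hg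
    obtain ⟨u, hu, huv⟩ := mul_mem_sup_of_prime hΓ hm (Nat.prime_iff_prime_int.1 hp) hv
    refine ⟨u, hu, ?_⟩
    have := M₀.add_mem hgv huv
    rwa [sub_add_sub_cancel, natCast_zsmul] at this
  have hall : ∀ n : ℕ, n ≠ 0 → ∀ g ∈ Γ, ∃ v ∈ Γ, g - n • v ∈ M₀ := by
    intro n
    induction n using induction_on_primes with
    | zero => exact fun h => (h rfl).elim
    | one => exact fun _ g hg => ⟨g, hg, by simp⟩
    | prime_mul p n hp ih =>
      intro hpn g hg
      obtain ⟨v, hv, hgv⟩ := ih (right_ne_zero_of_mul hpn) g hg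
      obtain ⟨u, hu, huv⟩ := hprime p hp v hv
      refine ⟨u, hu, ?_⟩
      have := M₀.add_mem hgv (M₀.nsmul_mem huv n)
      rwa [nsmul_sub, sub_add_sub_cancel, ← mul_nsmul] at this
  intro g hg
  set f : ℤ := ∏ i, ℓ i with hf
  have hf0 : f ≠ 0 := Finset.prod_ne_zero_iff.2 fun i _ => hℓ i
  obtain ⟨v, hv, hgv⟩ := hall (f ^ m).natAbs (by simpa using pow_ne_zero m hf0) g hg
  have hfv : f ^ m • v ∈ M₀ := by
    have hdvd : ∀ i, ∃ c, f = ℓ i * c := fun i => Finset.dvd_prod_of_mem ℓ (Finset.mem_univ i)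
    choose c hc using hdvd
    have e : f ^ m • v = ℓ ^ m * (c ^ m * v) := by
      funext i
      simp only [Pi.smul_apply, Pi.mul_apply, Pi.pow_apply, smul_eq_mul]
      rw [hc i]; ring
    rw [e]
    refine hm _ ?_
    have hpow : ∀ n, ∀ v : Fin d → ℤ, ℓ ^ n * v ∈ Γ ↔ v ∈ Γ := by
      intro n
      induction n with
      | zero => simp
      | succ n ih => intro v; rw [pow_succ', mul_assoc, hΓ, ih]
    rw [← hpow m, ← e]
    exact Γ.zsmul_mem hv _
  have hfv' : (f ^ m).natAbs • v ∈ M₀ := by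
    rw [← natCast_zsmul]
    rcases Int.natAbs_eq (f ^ m) with h | h
    · rwa [← h]
    · rw [h, neg_smul, neg_mem_iff] at hfv
      exact hfv
  simpa using M₀.add_mem hgv hfv'

end Coprime

/-! ### Digits in a lattice -/

theorem IsTriangular.mul {d : ℕ} {Λ : AddSubgroup (Fin d → ℤ)} {h ℓ : Fin d → ℤ}
    (hh : IsTriangular Λ h) (hℓ : ∀ i, ℓ i ≠ 0) :
    IsTriangular (Λ.map (AddMonoidHom.mulLeft ℓ)) fun i => h i * |ℓ i| where
  pos i := mul_pos (hh.pos i) (abs_pos.2 (hℓ i))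
  dvd := by
    rintro _ ⟨v, hv, rfl⟩ i hi
    have h1 : h i ∣ v i := hh.dvd v hv i fun j hj =>
      (mul_eq_zero.1 (hi j hj)).resolve_left (hℓ j)
    rw [mul_comm]
    exact mul_dvd_mul ((abs_dvd _ _).2 dvd_rfl) h1
  exists_eq i := by
    obtain ⟨b, hb, hb0, hbi⟩ := hh.exists_eq i
    rcases abs_choice (ℓ i) with e | e
    · exact ⟨_, ⟨b, hb, rfl⟩, fun j hj => by simp [hb0 j hj], by simp [hbi, e, mul_comm]⟩
    · exact ⟨_, ⟨-b, Λ.neg_mem hb, rfl⟩, fun j hj => by simp [hb0 j hj],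
        by simp [hbi, e, mul_comm]⟩

section LatticeDigits

variable {d : ℕ} {H Q' : Matrix (Fin d) (Fin d) ℤ} {h ℓ : Fin d → ℤ}

/-- The points `q` for which `H q` lies in the box with side lengths `h i * |ℓ i|`. -/
noncomputable def latticeDigits (hH : Function.Injective H.mulVec) (h ℓ : Fin d → ℤ) :
    Finset (Fin d → ℤ) :=
  (Finset.Icc 0 fun i => h i * |ℓ i| - 1).preimage H.mulVec hH.injOn

theorem mem_latticeDigits {hH : Function.Injective H.mulVec} {q : Fin d → ℤ} :
    q ∈ latticeDigits hH h ℓ ↔ ∀ i, 0 ≤ H.mulVec q i ∧ H.mulVec q i < h i * |ℓ i| := by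
  simp only [latticeDigits, Finset.mem_preimage, Finset.mem_Icc, Pi.le_def, Pi.zero_apply,
    Int.le_sub_one_iff, forall_and]

/-- The map H carries Q'ℤ^d to ℓ · Hℤ^d, a lattice with triangular diagonal h i * |ℓ i|, for which
the box is a fundamental domain. -/
theorem existsUnique_latticeDigits (hH : Function.Injective H.mulVec)
    (hh : IsTriangular (columnLattice H) h) (hℓ : ∀ i, ℓ i ≠ 0)
    (hQ' : ∀ v, ℓ * H.mulVec v = H.mulVec (Q'.mulVec v)) (n : Fin d → ℤ) :
    ∃! i, i ∈ latticeDigits hH h ℓ ∧ n - i ∈ columnLattice Q' := by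
  have hmul := hh.mul hℓ
  obtain ⟨_, ⟨_, ⟨v, rfl⟩, rfl⟩, hg⟩ := hmul.exists_sub_mem_box (H.mulVec n)
  have e : ℓ * H.mulVec v = H.mulVec (Q'.mulVec v) := hQ' v
  refine ⟨n - Q'.mulVec v, ⟨mem_latticeDigits.2 fun i => ?_, v, by simp⟩, ?_⟩
  · rw [Matrix.mulVec_sub, ← e]
    exact hg i
  · rintro j ⟨hj, w, hw⟩
    have hw' : Q'.mulVec w = n - j := hw
    apply hH
    refine sub_eq_zero.1 (hmul.eq_zero ⟨_, ⟨v - w, rfl⟩, ?_⟩ fun i => ?_)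
    · change ℓ * H.mulVec (v - w) = _
      rw [hQ', ← Matrix.mulVec_sub, Matrix.mulVec_sub, hw']
      congr 1
      abel
    · have h1 := mem_latticeDigits.1 hj i
      have h2 := hg i
      change 0 ≤ H.mulVec n i - (ℓ * H.mulVec v) i ∧ H.mulVec n i - (ℓ * H.mulVec v) i < _ at h2
      rw [Matrix.mulVec_sub, ← e, abs_lt]
      simp only [Pi.sub_apply] at h2 ⊢
      constructor <;> linarith

end LatticeDigits

theorem norm_gt_one_of_mul_eq_mul {d : ℕ} {Q Q' H : Matrix (Fin d) (Fin d) ℤ} (hH : H.det ≠ 0)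
    (hQ : Q * H = H * Q') (h : ∀ z ∈ spectrum ℂ (Q.map (Int.cast : ℤ → ℂ)), 1 < ‖z‖) :
    ∀ z ∈ spectrum ℂ (Q'.map (Int.cast : ℤ → ℂ)), 1 < ‖z‖ := by
  have hu : IsUnit (H.map (Int.cast : ℤ → ℂ)) := by
    rw [Matrix.isUnit_iff_isUnit_det, isUnit_iff_ne_zero]
    have := (Int.castRingHom ℂ).map_det H
    change ((Int.castRingHom ℂ).mapMatrix H).det ≠ 0
    rw [← this]
    simpa using hH
  obtain ⟨u, hu⟩ := hu
  have e : Q.map (Int.cast : ℤ → ℂ) * u = u * Q'.map (Int.cast : ℤ → ℂ) := by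
    have := congrArg (Int.castRingHom ℂ).mapMatrix hQ
    rw [map_mul, map_mul] at this
    rw [hu]
    exact this
  have e' : Q'.map (Int.cast : ℤ → ℂ) =
      (↑u⁻¹ : Matrix (Fin d) (Fin d) ℂ) * Q.map (Int.cast : ℤ → ℂ) * u := by
    rw [mul_assoc, e, Units.inv_mul_cancel_left]
  rw [e', spectrum.units_conjugate']
  exact h

namespace DigitSubstitution

variable {d : ℕ} {A : Type*} {θ : DigitSubstitution d A} {ℓ a h : Fin d → ℤ}
  {H : Matrix (Fin d) (Fin d) ℤ}
  {Γ : AddSubgroup (Fin d → ℤ)}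
  {τ : A → (Fin d → ℤ) ⧸ Γ} {x₀ : (Fin d → ℤ) → A}

/-! ### The induced substitution -/

theorem IsBlockWith.two_mul_abs_quot_le (hb : θ.IsBlockWith ℓ a) (z : Fin d → ℤ) (i : Fin d) :
    2 * |θ.quot z i| ≤ |z i| + |a i| + 2 := by
  have h1 := hb.quot_bounds z i
  have h2 := hb.two_le i
  have h3 : |ℓ i| * |θ.quot z i| ≤ |z i| + |a i| + |ℓ i| := by
    rw [← abs_mul]
    refine abs_le.2 ⟨?_, ?_⟩ <;>
      linarith [le_abs_self (z i), neg_abs_le (z i), le_abs_self (a i), neg_abs_le (a i)]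
  nlinarith [abs_nonneg (θ.quot z i), abs_nonneg (z i), abs_nonneg (a i)]

/-- There is a window that determines its own image under the substitution, and whose translates
by `Γ` cover everything. -/
theorem IsBlockWith.exists_window (hb : θ.IsBlockWith ℓ a)
    [Finite ((Fin d → ℤ) ⧸ columnLattice H)] (D : Finset (Fin d → ℤ)) (s : Fin d → ℤ) :
    ∃ W : Finset (Fin d → ℤ), (∀ m, ∃ w ∈ W, ∃ q, w + H.mulVec q = m) ∧
      ∀ i ∈ D, ∀ w ∈ W, θ.quot (w + H.mulVec i - s) ∈ W := by
  classical
  obtain ⟨ρ, hρ0, hρ⟩ := exists_latticeBox_add_mem (columnLattice H)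
  obtain ⟨C, hC0, hC⟩ := exists_subset_latticeBox (D.image fun i => H.mulVec i - s)
  obtain ⟨E, hE0, hE⟩ := exists_subset_latticeBox {a}
  -- Division by Q sends a bound T to (T + E + 2)/2. With T = radius + C this is at most the radius
  -- once the latter is at least C + E + 2; the summand ρ makes the translates by the lattice cover
  -- ℤ^d.
  refine ⟨latticeBox d (ρ + C + E + 2), fun m => ?_, fun i hi w hw => ?_⟩
  · obtain ⟨f, hf, hf0⟩ := hρ ((-m : Fin d → ℤ) : (Fin d → ℤ) ⧸ columnLattice H)
    rw [← QuotientAddGroup.mk_add, QuotientAddGroup.eq_zero_iff] at hf0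
    obtain ⟨q, hq⟩ := (columnLattice H).neg_mem hf0
    refine ⟨f, latticeBox_mono (by linarith) hf, q, ?_⟩
    rw [show H.mulVec q = -(-m + f) from hq]
    abel
  · refine mem_latticeBox.2 fun j => ?_
    have h1 := hb.two_mul_abs_quot_le (w + H.mulVec i - s) j
    have h2 := mem_latticeBox.1 (latticeBox_add hw (hC (Finset.mem_image_of_mem _ hi))) j
    have h3 := mem_latticeBox.1 (hE (Finset.mem_singleton_self a)) j
    rw [← add_sub_assoc] at h2
    linarith

variable [TopologicalSpace A] [DiscreteTopology A]

/-- All images θ(x) with x of class 0 lie in one class; s represents it. -/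
theorem IsClassMap.exists_shiftMap_subst_mem (hτ : θ.IsClassMap Γ τ x₀) (hp : θ.IsPrimitive)
    (hb : θ.IsBlockWith ℓ a) (hΓ : ∀ v ∈ Γ, θ.Q.mulVec v ∈ Γ) :
    ∃ s, ∀ x ∈ θ.zeroClass τ, _root_.shiftMap (-s) (θ.subst x) ∈ θ.zeroClass τ := by
  obtain ⟨s, hs⟩ := hτ.exists_subst hp hb 1 (by simpa using hΓ)
  refine ⟨s, fun x hx => hτ.shiftMap_mem_zeroClass (subst_mem hx.1) ?_⟩
  have := hs x hx.1 0 hx.2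
  simpa using this

variable [Finite A]

/-- `ϑ` describes the map `σ_{-s} ∘ θ` on the configurations of class `0` in terms of their
codes. -/
structure IsInduced (θ : DigitSubstitution d A) (τ : A → (Fin d → ℤ) ⧸ Γ) (s : Fin d → ℤ)
    (W : Finset (Fin d → ℤ))
    (hinv : ∀ x ∈ θ.zeroClass τ, ∀ q, shiftMap (H.mulVec q) x ∈ θ.zeroClass τ)
    (ϑ : DigitSubstitution d (Fin (Nat.card (patternSet (θ.zeroClass τ) W)))) : Prop where
  mul_eq : θ.Q * H = H * ϑ.Q
  mem : ∀ x ∈ θ.zeroClass τ, shiftMap (-s) (θ.subst x) ∈ θ.zeroClass τ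
  subst_latticeCode : ∀ x : θ.zeroClass τ,
    ϑ.subst (latticeCode W hinv x) = latticeCode W hinv ⟨_, mem x.1 x.2⟩
  exists_ball : ∀ r : ℤ, 0 ≤ r → ∃ (c : Fin d → ℤ) (k₀ : ℕ), ∀ q : Fin d → ℤ,
    (∀ i, c i ≤ H.mulVec q i ∧ H.mulVec q i ≤ c i + r) → ∀ k ≥ k₀, ϑ.quot^[k] q = 0

/-- The image of a letter c is read off σ_(-s) θ(x c) for a chosen configuration with pattern c on
W. The window condition makes the part needed at each digit depend on this pattern only, so the
choice does not matter. -/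
theorem exists_isInduced (hb : θ.IsBlockWith ℓ a) (hdet : H.det ≠ 0)
    (hH : Function.Injective H.mulVec) (hh : IsTriangular (columnLattice H) h) {s : Fin d → ℤ}
    (hs : ∀ x ∈ θ.zeroClass τ, shiftMap (-s) (θ.subst x) ∈ θ.zeroClass τ)
    {W : Finset (Fin d → ℤ)}
    (hW : ∀ i ∈ latticeDigits hH h ℓ, ∀ w ∈ W, θ.quot (w + H.mulVec i - s) ∈ W)
    (hinv : ∀ x ∈ θ.zeroClass τ, ∀ q, shiftMap (H.mulVec q) x ∈ θ.zeroClass τ)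
    {Q' : Matrix (Fin d) (Fin d) ℤ} (hQ' : θ.Q * H = H * Q') :
    ∃ ϑ : DigitSubstitution d (Fin (Nat.card (patternSet (θ.zeroClass τ) W))),
      ϑ.Q = Q' ∧ IsInduced θ τ s W hinv ϑ := by
  choose x hx using exists_latticeCode_eq W hinv
  have hℓ : ∀ i, ℓ i ≠ 0 := fun i h0 => by have := hb.two_le i; simp [h0] at this
  have hmul : ∀ v, θ.Q.mulVec (H.mulVec v) = H.mulVec (Q'.mulVec v) := fun v => by
    rw [Matrix.mulVec_mulVec, Matrix.mulVec_mulVec, hQ']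
  have hmul' : ∀ v, θ.Q.mulVec v = ℓ * v := fun v => funext fun i => hb.mulVec_apply v i
  let ϑ : DigitSubstitution d (Fin (Nat.card (patternSet (θ.zeroClass τ) W))) :=
    { Q := Q'
      expansive := norm_gt_one_of_mul_eq_mul hdet hQ' θ.expansive
      digits := latticeDigits hH h ℓ
      complete := existsUnique_latticeDigits hH hh hℓ fun v => by rw [← hmul', hmul]
      rule := fun c i => latticeCode W hinv ⟨_, hs (x c).1 (x c).2⟩ i }
  have hquot : ∀ n, H.mulVec n = H.mulVec (ϑ.rem n) + θ.Q.mulVec (H.mulVec (ϑ.quot n)) := by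
    intro n
    rw [hmul, ← Matrix.mulVec_add, add_comm]
    exact congrArg H.mulVec (ϑ.mulVec_quot_add_rem n).symm
  refine ⟨ϑ, rfl, hQ', hs, fun y => funext fun n => ?_, fun r hr => ?_⟩
  · change latticeCode W hinv ⟨_, hs _ (x (latticeCode W hinv y (ϑ.quot n))).2⟩ (ϑ.rem n) = _
    rw [latticeCode_eq_iff]
    intro w hw
    have h1 := (latticeCode_eq_iff W hinv _ _ _ _).1 (hx (latticeCode W hinv y (ϑ.quot n)))
      _ (hW _ (ϑ.rem n).2 w hw)
    rw [Matrix.mulVec_zero, add_zero] at h1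
    have h2 := θ.subst_iterate_congr_add 1 (m := H.mulVec (ϑ.quot n)) h1.symm
    simp only [shiftMap]
    rw [hquot n]
    simp only [Function.iterate_one, pow_one] at h2
    have e1 : w + H.mulVec (ϑ.rem n) + -s = w + H.mulVec (ϑ.rem n) - s := by abel
    have e2 : w + (H.mulVec (ϑ.rem n) + θ.Q.mulVec (H.mulVec (ϑ.quot n))) + -s =
      w + H.mulVec (ϑ.rem n) - s + θ.Q.mulVec (H.mulVec (ϑ.quot n)) := by abel
    rw [e1, e2, h2]
  · have hcoord : ∀ q, latticeCoord H (H.mulVec q) = q := Function.leftInverse_invFun hH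
    have hbox : ∀ q i, 0 ≤ H.mulVec q i - ℓ i * H.mulVec (ϑ.quot q) i ∧
        H.mulVec q i - ℓ i * H.mulVec (ϑ.quot q) i < h i * |ℓ i| := by
      intro q i
      have e : H.mulVec q i - ℓ i * H.mulVec (ϑ.quot q) i = H.mulVec (ϑ.rem q) i := by
        rw [hquot q, Pi.add_apply, hb.mulVec_apply, add_sub_cancel_right]
      rw [e]
      exact (mem_latticeDigits (hH := hH)).1 (ϑ.rem q).2 i
    obtain ⟨c, k₀, hc⟩ := exists_ball_iterate_eq_zero hh hb.two_le
      (p := fun g => H.mulVec (ϑ.quot (latticeCoord H g))) (fun g _ => ⟨_, rfl⟩)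
      (by
        rintro _ ⟨q, rfl⟩ i
        have := hbox q i
        simpa only [Matrix.mulVecLin_apply, hcoord] using this) r hr
    refine ⟨c, k₀, fun q hq k hk => hH ?_⟩
    rw [Matrix.mulVec_zero, ← hc _ ⟨q, rfl⟩ hq k hk]
    exact (Function.Semiconj.iterate_right (f := H.mulVec) (ga := ϑ.quot)
      (gb := fun g => H.mulVec (ϑ.quot (latticeCoord H g)))
      (fun q => by simp only [hcoord]) k) q

end DigitSubstitution

/-! ### Properties of the induced substitution -/

namespace DigitSubstitution

variable {d : ℕ} {A : Type*} [Finite A] {θ : DigitSubstitution d A} {ℓ a : Fin d → ℤ}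
  [TopologicalSpace A] [DiscreteTopology A] {H : Matrix (Fin d) (Fin d) ℤ}
  {Γ : AddSubgroup (Fin d → ℤ)} {τ : A → (Fin d → ℤ) ⧸ Γ} {x₀ : (Fin d → ℤ) → A}
  {s : Fin d → ℤ} {W : Finset (Fin d → ℤ)}
  {hinv : ∀ x ∈ θ.zeroClass τ, ∀ q, shiftMap (H.mulVec q) x ∈ θ.zeroClass τ}
  {ϑ : DigitSubstitution d (Fin (Nat.card (patternSet (θ.zeroClass τ) W)))}

namespace IsInduced

theorem exists_subst_iterate_latticeCode (hϑ : IsInduced θ τ s W hinv ϑ) (k : ℕ)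
    (x : θ.zeroClass τ) : ∃ y, ϑ.subst^[k] (latticeCode W hinv x) = latticeCode W hinv y := by
  induction k with
  | zero => exact ⟨x, rfl⟩
  | succ k ih =>
    obtain ⟨y, hy⟩ := ih
    exact ⟨_, by rw [Function.iterate_succ_apply', hy, hϑ.subst_latticeCode]⟩

/-- Every pattern of a code occurs in every supertile of sufficiently high level. -/
theorem exists_forall_occurrence (hϑ : IsInduced θ τ s W hinv ϑ) (hτ : θ.IsClassMap Γ τ x₀)
    (hp : θ.IsPrimitive) (hb : θ.IsBlockWith ℓ a) (hH : columnLattice H = Γ)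
    (x : θ.zeroClass τ) (B : Finset (Fin d → ℤ)) :
    ∃ k₀, ∀ k ≥ k₀, ∀ c, ∃ t, ∀ b ∈ B, ϑ.quot^[k] (b + t) = 0 ∧
      latticeCode W hinv x b = ϑ.subst^[k] (fun _ => c) (b + t) := by
  classical
  -- The extra point 0 forces the occurrence u into Γ and keeps u within r of the chosen centre;
  -- points of B then deviate by at most C more.
  obtain ⟨r, hr⟩ := (x.2.1 (insert 0 ((W ×ˢ B).image fun p =>
    p.1 + H.mulVec p.2))).exists_occurrence hp hb
  obtain ⟨C, hC0, hC⟩ := exists_subset_latticeBox (B.image H.mulVec)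
  obtain ⟨c', k₀, hc'⟩ := hϑ.exists_ball (2 * (max r 0 + C))
    (mul_nonneg zero_le_two (add_nonneg (le_max_right _ _) hC0))
  refine ⟨k₀, fun k hk c => ?_⟩
  obtain ⟨z, hz⟩ := exists_latticeCode_eq W hinv c
  obtain ⟨y, hy⟩ := hϑ.exists_subst_iterate_latticeCode k z
  obtain ⟨u, hu, hu'⟩ := hr y.1 y.2.1 fun i => c' i + (max r 0 + C)
  have huΓ : u ∈ Γ := by
    have h1 := hτ.apply y.1 y.2.1 u
    have h2 := hu 0 (Finset.mem_insert_self _ _)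
    rw [zero_add] at h2
    rw [← h2, x.2.2, y.2.2, zero_add] at h1
    exact (QuotientAddGroup.eq_zero_iff u).1 h1.symm
  rw [← hH] at huΓ
  obtain ⟨t, rfl⟩ := huΓ
  simp only [Matrix.mulVecLin_apply] at hu hu'
  refine ⟨t, fun b hbB => ?_⟩
  have hq : ϑ.quot^[k] (b + t) = 0 := by
    refine hc' _ (fun i => ?_) k hk
    have h1 := hu' 0 (Finset.mem_insert_self _ _) i
    have h2 := mem_latticeBox.1 (hC (Finset.mem_image_of_mem _ hbB)) i
    rw [Pi.zero_apply, zero_add] at h1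
    have h3 := abs_le.1 (h1.trans (le_max_left r 0))
    have h4 := abs_le.1 h2
    rw [Matrix.mulVec_add, Pi.add_apply]
    constructor <;> linarith
  refine ⟨hq, ?_⟩
  have h1 : latticeCode W hinv x b = latticeCode W hinv y (b + t) := by
    rw [latticeCode_eq_iff]
    intro w hw
    rw [hu _ (Finset.mem_insert_of_mem (Finset.mem_image.2
      ⟨(w, b), Finset.mem_product.2 ⟨hw, hbB⟩, rfl⟩)), Matrix.mulVec_add, add_assoc]
  rw [h1, ← hy]
  exact ϑ.subst_iterate_congr k (by rw [hq, hz])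

theorem isPrimitive (hϑ : IsInduced θ τ s W hinv ϑ) (hτ : θ.IsClassMap Γ τ x₀)
    (hp : θ.IsPrimitive) (hb : θ.IsBlockWith ℓ a) (hH : columnLattice H = Γ) :
    ϑ.IsPrimitive := by
  choose x hx using exists_latticeCode_eq W hinv
  choose k hk using fun c => hϑ.exists_forall_occurrence hτ hp hb hH (x c) {0}
  refine ⟨Finset.univ.sup k, fun b c => ?_⟩
  obtain ⟨t, ht⟩ := hk c _ (Finset.le_sup (Finset.mem_univ c)) b
  obtain ⟨h1, h2⟩ := ht 0 (by simp)
  rw [hx, zero_add] at h2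
  rw [zero_add] at h1
  exact ⟨t, (ϑ.mem_supertile_iff _ _ _ _).2 ⟨h1, h2⟩⟩

theorem isLegal_latticeCode (hϑ : IsInduced θ τ s W hinv ϑ) (hτ : θ.IsClassMap Γ τ x₀)
    (hp : θ.IsPrimitive) (hb : θ.IsBlockWith ℓ a) (hH : columnLattice H = Γ)
    (x : θ.zeroClass τ) (B : Finset (Fin d → ℤ)) : ϑ.IsLegal B (latticeCode W hinv x) := by
  obtain ⟨k₀, hk⟩ := hϑ.exists_forall_occurrence hτ hp hb hH x B
  obtain ⟨t, ht⟩ := hk (k₀ + 1) (Nat.le_succ _) (latticeCode W hinv x 0)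
  exact (ϑ.isLegal_iff _ _).2 ⟨_, k₀ + 1, t, Nat.le_add_left _ _, ht⟩

theorem exists_eq_latticeCode (hϑ : IsInduced θ τ s W hinv ϑ) {B : Finset (Fin d → ℤ)}
    {P : (Fin d → ℤ) → Fin (Nat.card (patternSet (θ.zeroClass τ) W))} (hP : ϑ.IsLegal B P) :
    ∃ x, ∀ b ∈ B, P b = latticeCode W hinv x b := by
  obtain ⟨c, k, t, -, h⟩ := (ϑ.isLegal_iff _ _).1 hP
  obtain ⟨z, hz⟩ := exists_latticeCode_eq W hinv c
  obtain ⟨y, hy⟩ := hϑ.exists_subst_iterate_latticeCode k z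
  refine ⟨⟨_, hinv y.1 y.2 t⟩, fun b hb => ?_⟩
  obtain ⟨h1, h2⟩ := h b hb
  rw [latticeCode_shiftMap, shiftMap, h2, ← hy]
  exact ϑ.subst_iterate_congr k (by rw [h1, hz])

theorem isExtensible (hϑ : IsInduced θ τ s W hinv ϑ) (hτ : θ.IsClassMap Γ τ x₀)
    (hp : θ.IsPrimitive) (hb : θ.IsBlockWith ℓ a) (hH : columnLattice H = Γ) :
    ϑ.IsExtensible := by
  intro B U _ P hP
  obtain ⟨x, hx⟩ := hϑ.exists_eq_latticeCode hP
  exact ⟨latticeCode W hinv x, fun b hb => (hx b hb).symm,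
    hϑ.isLegal_latticeCode hτ hp hb hH x U⟩

/-- Patterns of codes occur in supertiles; conversely supertiles are pieces of codes, and the set of
codes is closed. -/
theorem latticeSubshift_eq (hϑ : IsInduced θ τ s W hinv ϑ) (hτ : θ.IsClassMap Γ τ x₀)
    (hp : θ.IsPrimitive) (hb : θ.IsBlockWith ℓ a) (hH : columnLattice H = Γ) :
    latticeSubshift W hinv isClosed_zeroClass = ϑ.shiftSpace := by
  have e : (latticeSubshift W hinv isClosed_zeroClass).carrier = ϑ.shiftSpace.carrier := by
    apply Set.Subset.antisymm
    · rintro _ ⟨x, rfl⟩ B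
      exact hϑ.isLegal_latticeCode hτ hp hb hH x B
    · intro y hy
      rw [← (latticeSubshift W hinv isClosed_zeroClass).isClosed_carrier.closure_eq,
        mem_closure_iff]
      intro o ho hyo
      obtain ⟨B, u, hu, hsub⟩ := isOpen_pi_iff.1 ho y hyo
      obtain ⟨x, hx⟩ := hϑ.exists_eq_latticeCode (hy B)
      exact ⟨_, hsub fun b hb => hx b hb ▸ (hu b hb).2, x, rfl⟩
  revert e
  generalize latticeSubshift W hinv isClosed_zeroClass = Y
  generalize ϑ.shiftSpace = Z
  cases Y; cases Z
  rintro rfl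
  rfl

/-- Let Λ compete, M₀ = HΛ. Returns of large patterns are returns of codes, so Q^n maps the return
module of θ into M₀ and Q^(n+N) Γ ⊆ M₀. Coprimality of Λ with ϑ.Q becomes Γ ⊆ M₀ + QΓ, and
`le_of_sub_mul_mem` applies. -/
theorem isHeightLattice_top [Nonempty A] (hϑ : IsInduced θ τ s W hinv ϑ)
    (hτ : θ.IsClassMap Γ τ x₀) (hp : θ.IsPrimitive) (hb : θ.IsBlockWith ℓ a)
    (hΓ : θ.IsHeightLattice Γ) (hH : columnLattice H = Γ)
    (hinj : Function.Injective H.mulVec) : ϑ.IsHeightLattice ⊤ := by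
  have hfin := hΓ.finite_quotient hp hb
  have hmul' : ∀ n v, (θ.Q ^ n).mulVec v = ℓ ^ n * v := fun n v =>
    funext fun i => hb.pow_mulVec_apply n v i
  have hmul : ∀ v, θ.Q.mulVec v = ℓ * v := by simpa using hmul' 1
  refine ⟨⟨le_top, top_sup_eq _⟩, fun Λ ⟨hR, hsup⟩ => ?_⟩
  let M₀ : AddSubgroup (Fin d → ℤ) := Λ.map H.mulVecLin.toAddMonoidHom
  suffices h : Γ ≤ M₀ by
    intro v _
    obtain ⟨u, hu, e⟩ := h (hH ▸ ⟨v, rfl⟩ : H.mulVec v ∈ Γ)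
    rwa [← hinj e]
  -- return times of large patterns give return times of codes
  have hret : ∃ n, ∀ j ∈ θ.shiftSpace.returnModule, (θ.Q ^ n).mulVec j ∈ M₀ := by
    obtain ⟨r, -, hr⟩ := exists_subset_latticeBox W
    obtain ⟨n, hn⟩ := exists_zeroClass_eqOn hb hτ r
    refine ⟨n, fun j hj => ?_⟩
    suffices θ.shiftSpace.returnModule ≤
      M₀.comap (θ.Q ^ n).mulVecLin.toAddMonoidHom from this hj
    refine (AddSubgroup.closure_le _).2 fun j hj => ?_
    obtain ⟨w, hw, hw'⟩ := hn n le_rfl j hj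
    have hjΓ := (hΓ.pow_mulVec_mem_iff hp hb n).2 (hΓ.1.1 (AddSubgroup.subset_closure hj))
    rw [← hH] at hjΓ
    obtain ⟨u, hu⟩ := hjΓ
    replace hu : H.mulVec u = (θ.Q ^ n).mulVec j := hu
    refine ⟨u, hR (AddSubgroup.subset_closure
      ⟨⟨latticeCode W hinv ⟨w, hw⟩, hϑ.isLegal_latticeCode hτ hp hb hH _⟩, 0, ?_⟩), hu⟩
    change latticeCode W hinv ⟨w, hw⟩ (u + 0) = _
    rw [add_zero, latticeCode_eq_iff]
    intro b hbW
    rw [hu, Matrix.mulVec_zero, add_zero]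
    exact hw' b (hr hbW)
  obtain ⟨n, hn⟩ := hret
  obtain ⟨N, hN⟩ := hΓ.exists_pow_mulVec_mem hp hb
  refine le_of_sub_mul_mem (ℓ := ℓ) (m := n + N)
    (fun i h0 => by have := hb.two_le i; simp [h0] at this)
    (fun v => by rw [← hmul, hΓ.mulVec_mem_iff hp hb])
    (fun v hv => by rw [← hmul', pow_add_mulVec]; exact hn _ (hN v hv)) fun g hg => ?_
  rw [← hH] at hg
  obtain ⟨u, rfl⟩ := hg
  obtain ⟨v, hv, _, ⟨q, rfl⟩, e⟩ := AddSubgroup.mem_sup.1 (hsup ▸ AddSubgroup.mem_top u)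
  refine ⟨H.mulVec q, hH ▸ ⟨q, rfl⟩, v, hv, ?_⟩
  rw [← hmul, Matrix.mulVec_mulVec, hϑ.mul_eq, ← Matrix.mulVec_mulVec, ← e]
  change H.mulVec v = H.mulVec (v + ϑ.Q.mulVec q) - _
  rw [Matrix.mulVec_add, add_sub_cancel_right]

end IsInduced

theorem isAperiodic_latticeSubshift (haper : θ.shiftSpace.IsAperiodic)
    (hinj : Function.Injective H.mulVec) (hW : ∀ m, ∃ w ∈ W, ∃ q, w + H.mulVec q = m) :
    (latticeSubshift W hinv isClosed_zeroClass).IsAperiodic := by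
  rintro ⟨_, x, rfl⟩ n hn
  have h1 : shiftMap n (latticeCode W hinv x) = latticeCode W hinv x := congrArg Subtype.val hn
  rw [← latticeCode_shiftMap] at h1
  have h2 := congrArg Subtype.val (latticeCode_injective W hinv hW h1)
  apply hinj
  rw [Matrix.mulVec_zero]
  exact haper ⟨x.1, x.2.1⟩ _ (Subtype.ext h2)

end DigitSubstitution

/-! ### The suspension conjugacy and its automorphisms -/

namespace DigitSubstitution

variable {d : ℕ} {A : Type*} [Finite A] {θ : DigitSubstitution d A} {ℓ a : Fin d → ℤ}
  [TopologicalSpace A] [DiscreteTopology A] {H : Matrix (Fin d) (Fin d) ℤ}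
  [Finite ((Fin d → ℤ) ⧸ columnLattice H)] {F : Set (Fin d → ℤ)}
  {τ : A → (Fin d → ℤ) ⧸ columnLattice H} {x₀ : (Fin d → ℤ) → A} {W : Finset (Fin d → ℤ)}

/-- The conjugacy of `𝕏_θ` with the suspension of the subshift of codes. -/
noncomputable def IsClassMap.suspensionHomeo (hτ : θ.IsClassMap (columnLattice H) τ x₀)
    (hinv : ∀ x ∈ θ.zeroClass τ, ∀ q, _root_.shiftMap (H.mulVec q) x ∈ θ.zeroClass τ)
    (hW : ∀ m, ∃ w ∈ W, ∃ q, w + H.mulVec q = m)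
    (hF : IsFundamentalDomain (columnLattice H) F) :
    θ.shiftSpace ≃ₜ latticeSubshift W hinv isClosed_zeroClass × F :=
  (hτ.prodHomeo hF).symm.trans
    ((latticeHomeo W hinv isClosed_zeroClass hW).prodCongr (Homeomorph.refl F))

variable (hτ : θ.IsClassMap (columnLattice H) τ x₀)
  (hinv : ∀ x ∈ θ.zeroClass τ, ∀ q, _root_.shiftMap (H.mulVec q) x ∈ θ.zeroClass τ)
  (hW : ∀ m, ∃ w ∈ W, ∃ q, w + H.mulVec q = m) (hF : IsFundamentalDomain (columnLattice H) F)

theorem IsClassMap.suspensionHomeo_symm_apply (x : θ.zeroClass τ) (j : F) :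
    (hτ.suspensionHomeo hinv hW hF).symm (latticeHomeo W hinv isClosed_zeroClass hW x, j) =
      θ.shiftSpace.act j ⟨x.1, x.2.1⟩ := by
  change hτ.prodHomeo hF
    ((latticeHomeo W hinv isClosed_zeroClass hW).symm
      (latticeHomeo W hinv isClosed_zeroClass hW x), j) = _
  rw [Homeomorph.symm_apply_apply]
  exact Subtype.ext (hτ.coe_prodHomeo hF (x, j))

theorem IsClassMap.suspensionHomeo_symm_suspensionAct (m : Fin d → ℤ) (x : θ.zeroClass τ)
    (j : F) :
    (hτ.suspensionHomeo hinv hW hF).symm (suspensionAct _ H hF m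
      (latticeHomeo W hinv isClosed_zeroClass hW x, j)) =
      θ.shiftSpace.act (m + j) ⟨x.1, x.2.1⟩ := by
  rw [suspensionAct, act_latticeHomeo, hτ.suspensionHomeo_symm_apply hinv hW hF]
  apply Subtype.ext
  change _root_.shiftMap _ (_root_.shiftMap _ x.1) = _root_.shiftMap _ x.1
  rw [shiftMap_shiftMap, mulVec_latticeCoord (hF.sub_rep_mem _), add_sub_cancel, add_comm]

theorem IsClassMap.suspensionHomeo_act (m : Fin d → ℤ) (x : θ.shiftSpace) :
    hτ.suspensionHomeo hinv hW hF (θ.shiftSpace.act m x) =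
      suspensionAct _ H hF m (hτ.suspensionHomeo hinv hW hF x) := by
  obtain ⟨⟨y, j⟩, rfl⟩ := (hτ.suspensionHomeo hinv hW hF).symm.surjective x
  obtain ⟨z, rfl⟩ := (latticeHomeo W hinv isClosed_zeroClass hW).surjective y
  apply (hτ.suspensionHomeo hinv hW hF).symm.injective
  rw [Homeomorph.symm_apply_apply, Homeomorph.apply_symm_apply,
    hτ.suspensionHomeo_symm_suspensionAct hinv hW hF,
    hτ.suspensionHomeo_symm_apply hinv hW hF]
  exact Subtype.ext (shiftMap_shiftMap _ _ _)

/-- The homeomorphism Φ₀ = σ_(-i) ∘ Φ of the zero class commutes with translations by Γ, so the code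
transports it to an automorphism of the subshift of codes. -/
theorem IsClassMap.exists_automorphism (hp : θ.IsPrimitive) (hb : θ.IsBlockWith ℓ a)
    {Φ : θ.shiftSpace ≃ₜ θ.shiftSpace} (hΦ : θ.shiftSpace.IsAutomorphism Φ) :
    ∃ (Φ' : latticeSubshift W hinv isClosed_zeroClass ≃ₜ
        latticeSubshift W hinv isClosed_zeroClass) (i : F),
      (latticeSubshift W hinv isClosed_zeroClass).IsAutomorphism Φ' ∧
      ∀ y j, hτ.suspensionHomeo hinv hW hF (Φ ((hτ.suspensionHomeo hinv hW hF).symm (y, j))) =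
        suspensionAct _ H hF i (Φ' y, j) := by
  obtain ⟨m, hm⟩ := QuotientAddGroup.mk_surjective (τ ((Φ ⟨x₀, hτ.mem⟩).1 0))
  obtain ⟨Φ₀, hΦ₀⟩ := hτ.exists_restrict hp hb hΦ (i := hF.rep m) (by
    rw [← hm, QuotientAddGroup.eq, ← neg_mem_iff, neg_add_rev, neg_neg, neg_add_eq_sub]
    exact hF.sub_rep_mem m)
  let e := latticeHomeo W hinv isClosed_zeroClass hW
  refine ⟨(e.symm.trans Φ₀).trans e, hF.rep m, fun n y => ?_, fun y j => ?_⟩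
  · obtain ⟨x, rfl⟩ := e.surjective y
    change e (Φ₀ (e.symm (Subshift.act _ n (e x)))) =
      Subshift.act _ n (e (Φ₀ (e.symm (e x))))
    rw [act_latticeHomeo, act_latticeHomeo, e.symm_apply_apply, e.symm_apply_apply]
    congr 1
    apply Subtype.ext
    have h1 := hΦ₀ ⟨_, hinv x.1 x.2 n⟩
    have h2 := hΦ (H.mulVec n) ⟨x.1, x.2.1⟩
    rw [hΦ₀ x] at h2
    have h3 := congrArg (fun z => _root_.shiftMap (-(hF.rep m : Fin d → ℤ)) z.1) (h1.symm.trans h2)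
    change _root_.shiftMap _ (_root_.shiftMap _ _) =
      _root_.shiftMap _ (_root_.shiftMap _ (_root_.shiftMap _ _)) at h3
    rw [shiftMap_shiftMap, shiftMap_shiftMap, shiftMap_shiftMap, neg_add_cancel, shiftMap_zero,
      neg_add_cancel_comm] at h3
    exact h3
  · obtain ⟨x, rfl⟩ := e.surjective y
    apply (hτ.suspensionHomeo hinv hW hF).symm.injective
    rw [Homeomorph.symm_apply_apply]
    change Φ ((hτ.suspensionHomeo hinv hW hF).symm (e x, j)) =
      (hτ.suspensionHomeo hinv hW hF).symm
        (suspensionAct _ H hF (hF.rep m) (e (Φ₀ (e.symm (e x))), j))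
    rw [e.symm_apply_apply, hτ.suspensionHomeo_symm_suspensionAct hinv hW hF,
      hτ.suspensionHomeo_symm_apply hinv hW hF, hΦ, hΦ₀]
    apply Subtype.ext
    change _root_.shiftMap _ (_root_.shiftMap _ _) = _root_.shiftMap _ _
    rw [shiftMap_shiftMap, add_comm]

end DigitSubstitution

theorem mainTheorem6 {d : ℕ} {A : Type*} [Finite A] [Nonempty A] [TopologicalSpace A]
    [DiscreteTopology A] (θ : DigitSubstitution d A) (hblock : θ.IsBlock)
    (hprim : θ.IsPrimitive) (haper : θ.shiftSpace.IsAperiodic)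
    (H : Matrix (Fin d) (Fin d) ℤ) (hheight : θ.IsHeightLattice (columnLattice H))
    (F : Set (Fin d → ℤ)) (hF : IsFundamentalDomain (columnLattice H) F) :
    ∃ (b : ℕ) (Y : Subshift d (Fin b)),
      HasTorsionFreeMEF Y.act ∧
      -- if `H⁻¹ Q H` is an integer matrix `Q'`, then `Y` is a substitution shift
      (∀ Q' : Matrix (Fin d) (Fin d) ℤ, θ.Q * H = H * Q' →
        ∃ ϑ : DigitSubstitution d (Fin b), ϑ.Q = Q' ∧ ϑ.IsPrimitive ∧ ϑ.IsExtensible ∧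
          ϑ.shiftSpace.IsAperiodic ∧ ϑ.IsHeightLattice ⊤ ∧ Y = ϑ.shiftSpace) ∧
      ∃ ψ : θ.shiftSpace ≃ₜ Y × F,
        (∀ (m : Fin d → ℤ) (x : θ.shiftSpace),
          ψ (θ.shiftSpace.act m x) = suspensionAct Y H hF m (ψ x)) ∧
        -- every automorphism is of the form `(y, j) ↦ T_i (Φ' y, j)`
        (∀ Φ : θ.shiftSpace ≃ₜ θ.shiftSpace, θ.shiftSpace.IsAutomorphism Φ →
          ∃ (Φ' : Y ≃ₜ Y) (i : F), Y.IsAutomorphism Φ' ∧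
            ∀ (y : Y) (j : F), ψ (Φ (ψ.symm (y, j))) = suspensionAct Y H hF i (Φ' y, j)) := by
  obtain ⟨ℓ, a, hb⟩ := hblock.exists_isBlockWith
  have hfin := hheight.finite_quotient hprim hb
  have hdet : H.det ≠ 0 := det_ne_zero_of_finite_quotient
  have hinj : Function.Injective H.mulVec := fun v w e =>
    sub_eq_zero.1 (Matrix.eq_zero_of_mulVec_eq_zero hdet
      (by rw [Matrix.mulVec_sub]; exact sub_eq_zero.2 e))
  obtain ⟨τ, x₀, hτ⟩ := DigitSubstitution.exists_isClassMap hprim hb hheight.1.1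
  have hinv : ∀ x ∈ θ.zeroClass τ, ∀ q, shiftMap (H.mulVec q) x ∈ θ.zeroClass τ :=
    fun x hx q => hτ.shiftMap_mem_zeroClass_of_mem hx ⟨q, rfl⟩
  obtain ⟨h, hh⟩ := exists_isTriangular (columnLattice H)
  obtain ⟨s, hs⟩ := hτ.exists_shiftMap_subst_mem hprim hb
    fun v hv => (hheight.mulVec_mem_iff hprim hb).2 hv
  obtain ⟨W, hW, hWD⟩ := hb.exists_window (H := H) (latticeDigits hinj h ℓ) s
  refine ⟨_, latticeSubshift W hinv DigitSubstitution.isClosed_zeroClass,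
    DigitSubstitution.hasTorsionFreeMEF_latticeSubshift hprim hb haper hheight hτ rfl W hinv hW,
    fun Q' hQ' => ?_, hτ.suspensionHomeo hinv hW hF, hτ.suspensionHomeo_act hinv hW hF,
    fun Φ hΦ => hτ.exists_automorphism hinv hW hF hprim hb hΦ⟩
  obtain ⟨ϑ, hϑQ, hϑ⟩ := DigitSubstitution.exists_isInduced hb hdet hinj hh hs hWD hinv hQ'
  have hY := hϑ.latticeSubshift_eq hτ hprim hb rfl
  exact ⟨ϑ, hϑQ, hϑ.isPrimitive hτ hprim hb rfl, hϑ.isExtensible hτ hprim hb rfl,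
    hY ▸ DigitSubstitution.isAperiodic_latticeSubshift haper hinj hW,
    hϑ.isHeightLattice_top hτ hprim hb hheight rfl hinj, hY⟩
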